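/- **Conventions.** Let $\psi\in C_c^\infty(\mathbb R)$ be even, supported in $[-2,2]$, with $\psi=1$ on $[-1,1]$. On $\mathcal S'(\mathbb R)$ (complex-valued), with $\partial_x$ having symbol $i\xi$, let $P_{\le N}$ be the Fourier multiplier with symbol $\psi(\xi/N)$ and $P_j=P_{\le 2^j}-P_{\le 2^{j-1}}$ for $j\in\mathbb Z$. Put $$\|u\|_{\dot B^{-1/2}_{2,\infty}}=\sup_{j\in\mathbb Z}2^{-j/2}\|P_ju\|_{L^2},\qquad \|f\|_{\dot H^{1/2}}=\big\|(|\xi|^{1/2}\hat f)^\vee\big\|_{L^2},$$ where the second norm is the $L^2$ norm of the unique $F\in L^2$ with $\hat f=|\xi|^{-1/2}\hat F$ on $\mathbb R\setminus\{0\}$, and is $\infty$ if there is no such $F$. For $t>0$ let $L(t)=x+5t\partial_x^4$ and $\langle x\rangle=(x^2+t^{2/5})^{1/2}$. **Proposition 3.3.** There are an absolute constant $C$ and, for every $c>0$, a constant $K_c$ depending only on $c$, such that the following holds. Let $t>0$ and let $u\in\mathcal S'(\mathbb R)$ have no component at frequency zero, that is, $P_{\le 2^j}u\to0$ in $\mathcal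 S'(\mathbb R)$ as $j\to-\infty$. Assume that $$\|u\|_{\dot B^{-1/2}_{2,\infty}}+\|L(t)u\|_{\dot H^{1/2}}\le 1 .$$ Then $u$ is (given by) a $C^3$ function, and for $k=0,1,2,3$ and all $x\in\mathbb R$ $$t^{\frac18+\frac k4}\,\langle x\rangle^{\frac38-\frac k4}\,|\partial_x^k u(x)|\le C .$$ Moreover, in the elliptic region, for every $c>0$, all $x\ge c\,t^{1/5}$ and $k=0,1,2,3$, $$t^{\frac k4}\,\langle x\rangle^{1-\frac k4}\,|\partial_x^k u(x)|\le K_c\,\log\!\big(t^{-\frac15}\langle x\rangle\big).$$ -/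

import Mathlib

open MeasureTheory Filter Topology
open scoped SchwartzMap FourierTransform ENNReal ContDiff

noncomputable section

namespace LinearKawahara

/-- A Littlewood-Paley cutoff: a smooth even function supported in `[-2,2]` and equal to `1` on
`[-1,1]`. -/
structure IsLPCutoff (ψ : ℝ → ℂ) : Prop where
  smooth : ContDiff ℝ ∞ ψ
  even : ∀ ξ, ψ (-ξ) = ψ ξ
  support_subset : Function.support ψ ⊆ Set.Icc (-2) 2
  eq_one : ∀ ξ ∈ Set.Icc (-1 : ℝ) 1, ψ ξ = 1

/-- The Fourier multiplier with symbol `m`, for the convention in which `∂ₓ` has symbol `iξ`.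
Mathlib's Fourier transform uses the kernel `exp (-2πixξ)`, so the frequency called `ξ` in that
convention is `2π` times Mathlib's frequency variable. -/
def multiplier (m : ℝ → ℂ) (f : 𝓢'(ℝ, ℂ)) : 𝓢'(ℝ, ℂ) :=
  TemperedDistribution.fourierMultiplierCLM ℂ (fun ξ : ℝ => m (2 * Real.pi * ξ)) f

/-- The projection `P_{≤ N}`, with symbol `ψ (ξ / N)`. -/
def lpLow (ψ : ℝ → ℂ) (N : ℝ) (f : 𝓢'(ℝ, ℂ)) : 𝓢'(ℝ, ℂ) :=
  multiplier (fun ξ => ψ (ξ / N)) f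

/-- The dyadic projection `P_j = P_{≤ 2^j} - P_{≤ 2^j / 2}`. -/
def lpProj (ψ : ℝ → ℂ) (j : ℤ) (f : 𝓢'(ℝ, ℂ)) : 𝓢'(ℝ, ℂ) :=
  lpLow ψ ((2 : ℝ) ^ j) f - lpLow ψ ((2 : ℝ) ^ j / 2) f

/-- The `L²` norm of a tempered distribution; it is `∞` if the distribution is not given by an
`L²` function. (The representing element `F` of `L²` is unique.) -/
def l2Norm (f : 𝓢'(ℝ, ℂ)) : ℝ≥0∞ :=
  ⨅ (F : Lp (α := ℝ) ℂ 2 volume) (_ : (F : 𝓢'(ℝ, ℂ)) = f), ‖F‖ₑ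

/-- The homogeneous Besov norm `Ḃ^s_{2,∞}`: the supremum over `j ∈ ℤ` of `2^{js} ‖P_j f‖_{L²}`. -/
def besovNorm (ψ : ℝ → ℂ) (s : ℝ) (f : 𝓢'(ℝ, ℂ)) : ℝ≥0∞ :=
  ⨆ j : ℤ, ENNReal.ofReal ((2 : ℝ) ^ ((j : ℝ) * s)) * l2Norm (lpProj ψ j f)

/-- `F ∈ L²` is `(|ξ|^s f̂)^∨`. Since `|ξ|^s` is singular at `ξ = 0`, the identity
`f̂ = |ξ|^{-s} F̂` is required on `ℝ \ {0}`, i.e. against Schwartz functions that vanish near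
`ξ = 0`. -/
def IsFracDeriv (s : ℝ) (f : 𝓢'(ℝ, ℂ)) (F : Lp (α := ℝ) ℂ 2 volume) : Prop :=
  ∀ φ : 𝓢(ℝ, ℂ), (0 : ℝ) ∉ tsupport (φ : ℝ → ℂ) →
    (𝓕 f) φ = ∫ ξ : ℝ, φ ξ * ((|2 * Real.pi * ξ| ^ (-s) : ℝ) : ℂ) *
      (𝓕 F : Lp (α := ℝ) ℂ 2 volume) ξ

/-- The homogeneous Sobolev norm `‖(|ξ|^s f̂)^∨‖_{L²}` of `Ḣ^s`; it is `∞` if `|ξ|^s f̂` is not in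
`L²`. (The function `F` is unique.) -/
def sobolevNorm (s : ℝ) (f : 𝓢'(ℝ, ℂ)) : ℝ≥0∞ :=
  ⨅ (F : Lp (α := ℝ) ℂ 2 volume) (_ : IsFracDeriv s f F), ‖F‖ₑ

/-- `f` has no component at frequency zero: `P_{≤ 2^j} f → 0` in `𝓢'` as `j → -∞`. The homogeneous
norms do not see polynomials, and this is what singles out `f` in its class modulo polynomials. -/
def VanishesAtZeroFrequency (ψ : ℝ → ℂ) (f : 𝓢'(ℝ, ℂ)) : Prop :=
  ∀ φ : 𝓢(ℝ, ℂ), Tendsto (fun j : ℤ => lpLow ψ ((2 : ℝ) ^ j) f φ) atBot (𝓝 0)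

/-- The operator `L(t) = x + 5 t ∂ₓ⁴` on tempered distributions. -/
def opL (t : ℝ) (u : 𝓢'(ℝ, ℂ)) : 𝓢'(ℝ, ℂ) :=
  TemperedDistribution.smulLeftCLM ℂ (fun x : ℝ => (x : ℂ)) u +
    ((5 * t : ℝ) : ℂ) • (TemperedDistribution.derivCLM ℂ)^[4] u

/-- The time-dependent Japanese bracket `⟨x⟩ = (x² + t^{2/5})^{1/2}`. -/
def bracket (t x : ℝ) : ℝ := Real.sqrt (x ^ 2 + t ^ (2 / 5 : ℝ))

/-- The tempered distribution `u` is given by the function `v`. -/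
def IsGivenBy (u : 𝓢'(ℝ, ℂ)) (v : ℝ → ℂ) : Prop :=
  ∀ φ : 𝓢(ℝ, ℂ), Integrable (fun x => φ x * v x) ∧ u φ = ∫ x : ℝ, φ x * v x

end LinearKawahara

end

/-!
On the Fourier side the operator `L(t)` is a first-order operator: the flow factor
`e(ξ) = exp (-i t (2πξ)⁵)` conjugates it to `∂_ξ`, so away from frequency zero the profile
`W = e û` has a derivative `h` with `|ξ| |h|² = 2π |F̂|²`, where `F ∈ L²` is the fractional
derivative in the hypothesis (`fourier_apply_flowFactor_deriv`, `abs_mul_norm_profileDeriv_sq`).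
Hence `∫ |ξ| |h|² dξ` is bounded, and by the Cauchy-Schwarz inequality `W` oscillates by `O(1)` over
a dyadic interval. The Besov norm bounds the mean of `W` over each dyadic interval, because
`P_j + P_{j+1}` is the identity on `2^j ≤ |ω| ≤ 2^(j+1)` whatever the cutoff; this is why the
constants do not depend on `ψ`. So `W` is bounded by an absolute constant (`exists_profile`). Since
`u` has no component at frequency zero, `û` is the bounded function `W / e` and nothing more
(`apply_eq_integral_of_halfLines`).

After the rescaling `ξ = t^(-1/5) η / 2π`, `y = t^(-1/5) x` all powers of `t` disappear, and `u` is
the sum of two integrals over the half-lines (`exists_isGivenBy`), the one on the left being the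
conjugate of one on the right. What is left are the bounds for
`∫₀^∞ ηᵏ exp (i (y η + η⁵)) w(η) dη` with `|w| ≤ A` and `∫ η |w'|² dη ≤ A`, which follow from one
integration by parts (`HalfLineProfile.norm_integral_le_of_phase`) with
`|q w'| ≤ ε η |w'|² / 2 + q² / (2 ε η)`, `q = ηᵏ / (y + 5 η⁴)`:

* for `η` above twice the critical frequency the phase derivative dominates `η⁴`, which for `k ≤ 3`
  makes the integral converge, locally uniformly in `y`;
* for `y = 5 ρ⁴ > 0` the phase derivative is at least `5 ρ⁴`, and `∫ q² / η` diverges only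
  logarithmically at `η = 0`: below `η = ρ⁻⁴` the integral is estimated trivially, and above it
  costs the factor `log ⟨y⟩`;
* for `y = -5 ρ⁴ < 0` a window of width `ρ^(-3/2)` around the stationary point `η = ρ` is estimated
  trivially, and this gives the bound `ρ^(k - 3/2)`.
-/

/-! ### Integration by parts against a primitive -/

/-- Exchange of the order of integration over the triangle `a < y ≤ x ≤ b`. -/
theorem integral_mul_integral_eq {a b : ℝ} (hab : a ≤ b) {e h : ℝ → ℂ}
    (he : IntervalIntegrable e volume a b) (hh : IntervalIntegrable h volume a b) :
    ∫ x in a..b, e x * ∫ y in a..x, h y = ∫ y in a..b, (∫ x in y..b, e x) * h y := by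
  rw [intervalIntegrable_iff_integrableOn_Ioc_of_le hab] at he hh
  set μ := volume.restrict (Set.Ioc a b)
  set F : ℝ × ℝ → ℂ := Set.indicator {p | p.2 ≤ p.1} (fun p => e p.1 * h p.2)
  have hF : Integrable F (μ.prod μ) :=
    (he.mul_prod hh).indicator (measurableSet_le measurable_snd measurable_fst)
  have h1 : ∫ x in a..b, e x * ∫ y in a..x, h y = ∫ x, ∫ y, F (x, y) ∂μ ∂μ := by
    rw [intervalIntegral.integral_of_le hab]
    refine setIntegral_congr_fun measurableSet_Ioc fun x hx => ?_
    have : (fun y => F (x, y)) = Set.indicator (Set.Iic x) (fun y => e x * h y) := by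
      funext y; simp [F, Set.indicator_apply]
    simp only [this]
    rw [integral_indicator measurableSet_Iic, Measure.restrict_restrict measurableSet_Iic,
      Set.inter_comm, Set.Ioc_inter_Iic, min_eq_right hx.2,
      ← intervalIntegral.integral_of_le hx.1.le,
      intervalIntegral.integral_const_mul]
  have h2 : ∫ y in a..b, (∫ x in y..b, e x) * h y = ∫ y, ∫ x, F (x, y) ∂μ ∂μ := by
    rw [intervalIntegral.integral_of_le hab]
    refine setIntegral_congr_fun measurableSet_Ioc fun y hy => ?_
    have : (fun x => F (x, y)) = Set.indicator (Set.Ici y) (fun x => e x * h y) := by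
      funext x; simp [F, Set.indicator_apply]
    simp only [this]
    rw [integral_indicator measurableSet_Ici, Measure.restrict_restrict measurableSet_Ici,
      show Set.Ici y ∩ Set.Ioc a b = Set.Icc y b by
        ext z; simp only [Set.mem_inter_iff, Set.mem_Ici, Set.mem_Ioc, Set.mem_Icc]
        exact ⟨fun H => ⟨H.1, H.2.2⟩, fun H => ⟨H.1, hy.1.trans_le H.1, H.2⟩⟩,
      integral_Icc_eq_integral_Ioc, ← intervalIntegral.integral_of_le hy.2,
      intervalIntegral.integral_mul_const]
  rw [h1, h2]
  exact integral_integral_swap hF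

/-- Integration by parts for a `C¹` function `E` and a primitive `w` of a merely integrable
function `h`. -/
theorem integral_deriv_mul_primitive {a b : ℝ} (hab : a ≤ b) {E e w h : ℝ → ℂ}
    (hE : ∀ ξ ∈ Set.Icc a b, HasDerivAt E (e ξ) ξ) (he : ContinuousOn e (Set.Icc a b))
    (hh : IntervalIntegrable h volume a b)
    (hw : ∀ ξ ∈ Set.Icc a b, w ξ - w a = ∫ y in a..ξ, h y) :
    ∫ ξ in a..b, e ξ * w ξ = E b * w b - E a * w a - ∫ ξ in a..b, E ξ * h ξ := by
  rw [← Set.uIcc_of_le hab] at he hE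
  have hei : IntervalIntegrable e volume a b := he.intervalIntegrable
  have hEc : ContinuousOn E (Set.uIcc a b) := fun ξ hξ => (hE ξ hξ).continuousAt.continuousWithinAt
  have hprim : ContinuousOn (fun ξ => ∫ y in a..ξ, h y) (Set.uIcc a b) :=
    intervalIntegral.continuousOn_primitive_interval' hh Set.left_mem_uIcc
  have key : ∀ ξ ∈ Set.uIcc a b, ∫ x in ξ..b, e x = E b - E ξ := fun ξ hξ => by
    have hsub : Set.uIcc ξ b ⊆ Set.uIcc a b := Set.uIcc_subset_uIcc_right hξ
    exact intervalIntegral.integral_eq_sub_of_hasDerivAt (fun x hx => hE x (hsub hx))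
      ((he.mono hsub).intervalIntegrable)
  calc ∫ ξ in a..b, e ξ * w ξ = ∫ ξ in a..b, (e ξ * w a + e ξ * ∫ y in a..ξ, h y) := by
        refine intervalIntegral.integral_congr fun ξ hξ => ?_
        rw [Set.uIcc_of_le hab] at hξ
        simp only [← hw ξ hξ]; ring
    _ = (E b - E a) * w a + ∫ y in a..b, (∫ x in y..b, e x) * h y := by
        rw [intervalIntegral.integral_add (hei.mul_const _)
            (hei.mul_continuousOn hprim),
          intervalIntegral.integral_mul_const, key a Set.left_mem_uIcc,
          integral_mul_integral_eq hab hei hh]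
    _ = (E b - E a) * w a + ∫ y in a..b, (E b * h y - E y * h y) := by
        congr 1
        refine intervalIntegral.integral_congr fun ξ hξ => ?_
        simp only [key ξ hξ]; ring
    _ = _ := by
        rw [intervalIntegral.integral_sub (hh.const_mul _) (hh.continuousOn_mul hEc),
          intervalIntegral.integral_const_mul, ← hw b (Set.right_mem_Icc.2 hab)]
        ring

/-! ### Oscillatory integrals on the half-line -/

/-- A profile on `(0, ∞)`: `w` is bounded by `A` and is a primitive of `h` there, and
`∫ ξ |h|² dξ ≤ A`. A single constant serves for both bounds, and it is taken to be at least `1` so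
that it absorbs absolute constants. Nothing is required of `w` and `h` on `(-∞, 0]`. -/
structure HalfLineProfile (A : ℝ) (w h : ℝ → ℂ) : Prop where
  one_le : 1 ≤ A
  norm_le : ∀ ξ, 0 < ξ → ‖w ξ‖ ≤ A
  intervalIntegrable : ∀ a b, 0 < a → 0 < b → IntervalIntegrable h volume a b
  sub_eq : ∀ a b, 0 < a → 0 < b → w b - w a = ∫ ξ in a..b, h ξ
  integrableOn : IntegrableOn (fun ξ => ξ * ‖h ξ‖ ^ 2) (Set.Ioi 0)
  integral_le : ∫ ξ in Set.Ioi 0, ξ * ‖h ξ‖ ^ 2 ≤ A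

/-- The oscillating factor `exp (i (x ξ + ξ⁵))`. -/
noncomputable def oscFactor (x ξ : ℝ) : ℂ := Complex.exp (Complex.I * ((x * ξ + ξ ^ 5 : ℝ) : ℂ))

theorem norm_oscFactor (x ξ : ℝ) : ‖oscFactor x ξ‖ = 1 := by
  rw [oscFactor, mul_comm, Complex.norm_exp_ofReal_mul_I]

theorem continuous_oscFactor (x : ℝ) : Continuous (oscFactor x) := by
  unfold oscFactor; fun_prop

theorem hasDerivAt_oscFactor (x ξ : ℝ) :
    HasDerivAt (oscFactor x) (oscFactor x ξ * (Complex.I * ((x + 5 * ξ ^ 4 : ℝ) : ℂ))) ξ := by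
  have h1 : HasDerivAt (fun ξ : ℝ => x * ξ + ξ ^ 5) (x + 5 * ξ ^ 4) ξ := by
    simpa using! ((hasDerivAt_id ξ).const_mul x).add (hasDerivAt_pow 5 ξ)
  exact (h1.ofReal_comp.const_mul Complex.I).cexp

/-- The truncated integral `∫₀ᴿ ξᵏ exp (i (x ξ + ξ⁵)) w(ξ) dξ`. -/
noncomputable def oscIntegral (w : ℝ → ℂ) (k : ℕ) (x R : ℝ) : ℂ :=
  ∫ ξ in (0 : ℝ)..R, (ξ : ℂ) ^ k * oscFactor x ξ * w ξ

/-- The quotient `ξᵏ / φ'(ξ)` of the amplitude by the derivative of the phase `x ξ + ξ⁵`. -/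
noncomputable def phaseQuot (k : ℕ) (x ξ : ℝ) : ℝ := ξ ^ k / (x + 5 * ξ ^ 4)

/-- The derivative of `phaseQuot k x`. -/
noncomputable def phaseQuotDeriv (k : ℕ) (x ξ : ℝ) : ℝ :=
  (k * ξ ^ (k - 1) * (x + 5 * ξ ^ 4) - ξ ^ k * (20 * ξ ^ 3)) / (x + 5 * ξ ^ 4) ^ 2

theorem hasDerivAt_phaseQuot (k : ℕ) {x ξ : ℝ} (hd : x + 5 * ξ ^ 4 ≠ 0) :
    HasDerivAt (phaseQuot k x) (phaseQuotDeriv k x ξ) ξ := by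
  have h1 : HasDerivAt (fun ξ : ℝ => x + 5 * ξ ^ 4) (20 * ξ ^ 3) ξ := by
    have := ((hasDerivAt_pow 4 ξ).const_mul 5).const_add x
    refine this.congr_deriv ?_
    norm_num; ring
  exact (hasDerivAt_pow k ξ).div h1 hd

theorem abs_phaseQuotDeriv_le {k : ℕ} {x ξ : ℝ} (hξ : 0 < ξ) (hd : x + 5 * ξ ^ 4 ≠ 0) :
    |phaseQuotDeriv k x ξ| ≤
      k * ξ ^ k / ξ / |x + 5 * ξ ^ 4| + ξ ^ k * (20 * ξ ^ 3) / |x + 5 * ξ ^ 4| ^ 2 := by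
  have hd' : 0 < |x + 5 * ξ ^ 4| := abs_pos.2 hd
  have e : phaseQuotDeriv k x ξ =
      k * ξ ^ (k - 1) / (x + 5 * ξ ^ 4) - ξ ^ k * (20 * ξ ^ 3) / (x + 5 * ξ ^ 4) ^ 2 := by
    unfold phaseQuotDeriv; field_simp
  have e2 : (k : ℝ) * ξ ^ (k - 1) = k * ξ ^ k / ξ := by
    rcases k with _ | k
    · simp
    · simp only [Nat.add_sub_cancel]; rw [pow_succ]; field_simp
  rw [e, e2]
  refine (abs_sub _ _).trans (le_of_eq ?_)
  rw [abs_div _ (x + 5 * ξ ^ 4), abs_div _ ((x + 5 * ξ ^ 4) ^ 2),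
    abs_of_nonneg (show 0 ≤ k * ξ ^ k / ξ by positivity),
    abs_of_nonneg (show 0 ≤ ξ ^ k * (20 * ξ ^ 3) by positivity), abs_pow]

namespace HalfLineProfile

variable {A : ℝ} {w h : ℝ → ℂ}

theorem continuousOn (H : HalfLineProfile A w h) : ContinuousOn w (Set.Ioi 0) := by
  intro ξ hξ
  have hξ' : (0 : ℝ) < ξ := hξ
  have h1 : ContinuousOn (fun b => ∫ y in (ξ / 2)..b, h y) (Set.uIcc (ξ / 2) (2 * ξ)) :=
    intervalIntegral.continuousOn_primitive_interval'
      (H.intervalIntegrable _ _ (by positivity) (by positivity)) Set.left_mem_uIcc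
  rw [Set.uIcc_of_le (by linarith)] at h1
  have h2 : ContinuousAt (fun b => w (ξ / 2) + ∫ y in (ξ / 2)..b, h y) ξ :=
    (h1.continuousAt (Icc_mem_nhds (by linarith) (by linarith))).const_add _
  refine (h2.congr ?_).continuousWithinAt
  filter_upwards [lt_mem_nhds hξ'] with b hb
  rw [← H.sub_eq _ _ (by positivity) hb]; ring

theorem intervalIntegrable_mul (H : HalfLineProfile A w h) {a b : ℝ} (ha : 0 ≤ a) (hb : 0 ≤ b)
    {g : ℝ → ℂ} (hg : Continuous g) : IntervalIntegrable (fun ξ => g ξ * w ξ) volume a b := by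
  have h1 : IntervalIntegrable w volume a b := by
    rw [intervalIntegrable_iff]
    refine IntegrableOn.of_bound (by simp)
      ((H.continuousOn.mono ?_).aestronglyMeasurable measurableSet_uIoc) A ?_
    · intro ξ hξ
      exact (le_min ha hb).trans_lt hξ.1
    · refine (ae_restrict_iff' measurableSet_uIoc).2 (ae_of_all _ fun ξ hξ => H.norm_le ξ ?_)
      exact (le_min ha hb).trans_lt hξ.1
  exact h1.continuousOn_mul hg.continuousOn

theorem continuous_amplitude (k : ℕ) (x : ℝ) :
    Continuous fun ξ : ℝ => (ξ : ℂ) ^ k * oscFactor x ξ := by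
  have := continuous_oscFactor x
  fun_prop

theorem norm_integral_le (H : HalfLineProfile A w h) (k : ℕ) (x : ℝ) {a b B : ℝ} (ha : 0 ≤ a)
    (hab : a ≤ b) (hb : b ≤ B) :
    ‖∫ ξ in a..b, (ξ : ℂ) ^ k * oscFactor x ξ * w ξ‖ ≤ A * B ^ k * (b - a) := by
  rw [← abs_of_nonneg (sub_nonneg.2 hab)]
  refine intervalIntegral.norm_integral_le_of_norm_le_const fun ξ hξ => ?_
  rw [Set.uIoc_of_le hab] at hξ
  have h0 : 0 < ξ := ha.trans_lt hξ.1
  rw [norm_mul, norm_mul, norm_oscFactor, mul_one, norm_pow, Complex.norm_real,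
    Real.norm_of_nonneg h0.le, mul_comm]
  have := H.norm_le ξ h0
  have h3 : ξ ^ k ≤ B ^ k := pow_le_pow_left₀ h0.le (hξ.2.trans hb) k
  have := H.one_le
  gcongr

/-- Non-stationary phase for one integration by parts. The majorants of `|q'|` and of `q² / ξ`,
where `q = ξᵏ / φ'`, enter through their primitives `P` and `S`; the scale `ε` comes from the
arithmetic-geometric mean inequality `|q h| ≤ ε ξ |h|² / 2 + q² / (2 ε ξ)`. -/
theorem norm_integral_le_of_phase (H : HalfLineProfile A w h) (k : ℕ) (x : ℝ) {a b ε : ℝ}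
    (ha : 0 < a) (hab : a ≤ b) (hε : 0 < ε) (hd : ∀ ξ ∈ Set.Icc a b, x + 5 * ξ ^ 4 ≠ 0)
    {P p S s : ℝ → ℝ} (hP : ∀ ξ ∈ Set.Icc a b, HasDerivAt P (p ξ) ξ)
    (hp : ∀ ξ ∈ Set.Icc a b, |phaseQuotDeriv k x ξ| ≤ p ξ)
    (hS : ∀ ξ ∈ Set.Icc a b, HasDerivAt S (s ξ) ξ)
    (hs : ∀ ξ ∈ Set.Icc a b, phaseQuot k x ξ ^ 2 / ξ ≤ s ξ) :
    ‖∫ ξ in a..b, (ξ : ℂ) ^ k * oscFactor x ξ * w ξ‖ ≤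
      A * (|phaseQuot k x a| + |phaseQuot k x b| + (P b - P a) + ε / 2) +
        (S b - S a) / (2 * ε) := by
  have hb : 0 < b := ha.trans_le hab
  have hA := H.one_le
  have hpos : ∀ ξ ∈ Set.Icc a b, 0 < ξ := fun ξ hξ => ha.trans_le hξ.1
  have hqc : ContinuousOn (phaseQuot k x) (Set.Icc a b) := fun ξ hξ =>
    (hasDerivAt_phaseQuot k (hd ξ hξ)).continuousAt.continuousWithinAt
  have hq'c : ContinuousOn (phaseQuotDeriv k x) (Set.Icc a b) := by
    unfold phaseQuotDeriv
    refine ContinuousOn.div (by fun_prop) (by fun_prop) fun ξ hξ => pow_ne_zero _ (hd ξ hξ)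
  have hoc := continuous_oscFactor x
  -- `E` is `-i exp(i φ) q`, whose derivative is the amplitude up to the term with `q'`.
  set E : ℝ → ℂ := fun ξ => -Complex.I * (oscFactor x ξ * (phaseQuot k x ξ : ℂ)) with hEdef
  set e : ℝ → ℂ := fun ξ => (ξ : ℂ) ^ k * oscFactor x ξ -
    Complex.I * (oscFactor x ξ * (phaseQuotDeriv k x ξ : ℂ)) with hedef
  have hE : ∀ ξ ∈ Set.Icc a b, HasDerivAt E (e ξ) ξ := fun ξ hξ => by
    have h1 := ((hasDerivAt_oscFactor x ξ).mul
      (hasDerivAt_phaseQuot k (hd ξ hξ)).ofReal_comp).const_mul (-Complex.I)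
    refine h1.congr_deriv ?_
    have h2 : ((x + 5 * ξ ^ 4 : ℝ) : ℂ) ≠ 0 := Complex.ofReal_ne_zero.2 (hd ξ hξ)
    have h3 : ((x + 5 * ξ ^ 4 : ℝ) : ℂ) * (phaseQuot k x ξ : ℂ) = (ξ : ℂ) ^ k := by
      rw [phaseQuot, Complex.ofReal_div, mul_div_cancel₀ _ h2]; push_cast; rfl
    rw [hedef]
    linear_combination (-oscFactor x ξ * ((x + 5 * ξ ^ 4 : ℝ) : ℂ) * (phaseQuot k x ξ : ℂ)) *
      Complex.I_sq + oscFactor x ξ * h3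
  have hec : ContinuousOn e (Set.Icc a b) := by
    have h1 : ContinuousOn (fun ξ => (phaseQuotDeriv k x ξ : ℂ)) (Set.Icc a b) :=
      Complex.continuous_ofReal.comp_continuousOn hq'c
    have h2 := hoc.continuousOn (s := Set.Icc a b)
    exact ContinuousOn.sub (by fun_prop) (by fun_prop)
  have hEn : ∀ ξ, ‖E ξ‖ = |phaseQuot k x ξ| := fun ξ => by
    simp [hEdef, norm_oscFactor]
  have hhi := H.intervalIntegrable a b ha hb
  have ibp := integral_deriv_mul_primitive hab hE hec hhi
    (fun ξ hξ => H.sub_eq a ξ ha (hpos ξ hξ))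
  have hint2 : IntervalIntegrable
      (fun ξ => Complex.I * (oscFactor x ξ * (phaseQuotDeriv k x ξ : ℂ)) * w ξ) volume a b := by
    refine ContinuousOn.intervalIntegrable ?_
    rw [Set.uIcc_of_le hab]
    have h1 : ContinuousOn (fun ξ => (phaseQuotDeriv k x ξ : ℂ)) (Set.Icc a b) :=
      Complex.continuous_ofReal.comp_continuousOn hq'c
    have h2 := hoc.continuousOn (s := Set.Icc a b)
    have h3 : ContinuousOn w (Set.Icc a b) := H.continuousOn.mono hpos
    fun_prop
  have main : ∫ ξ in a..b, (ξ : ℂ) ^ k * oscFactor x ξ * w ξ =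
      E b * w b - E a * w a - (∫ ξ in a..b, E ξ * h ξ) +
        ∫ ξ in a..b, Complex.I * (oscFactor x ξ * (phaseQuotDeriv k x ξ : ℂ)) * w ξ := by
    rw [← ibp, hedef, ← intervalIntegral.integral_add _ hint2]
    · refine intervalIntegral.integral_congr fun ξ _ => ?_
      simp only; ring
    · have := (H.intervalIntegrable_mul ha.le hb.le (continuous_amplitude k x)).sub hint2
      refine this.congr fun ξ _ => ?_
      ring
  have hcP : ContinuousOn P (Set.Icc a b) := fun ξ hξ => (hP ξ hξ).continuousAt.continuousWithinAt
  have hcS : ContinuousOn S (Set.Icc a b) := fun ξ hξ => (hS ξ hξ).continuousAt.continuousWithinAt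
  have hsub : Set.Ioo a b ⊆ Set.Icc a b := Set.Ioo_subset_Icc_self
  have b1 : ‖∫ ξ in a..b, Complex.I * (oscFactor x ξ * (phaseQuotDeriv k x ξ : ℂ)) * w ξ‖ ≤
      A * (P b - P a) := by
    refine (intervalIntegral.norm_integral_le_integral_norm hab).trans ?_
    have := intervalIntegral.integral_le_sub_of_hasDeriv_right_of_le hab (hcP.const_mul A)
      (fun ξ hξ => ((hP ξ (hsub hξ)).const_mul A).hasDerivWithinAt)
      (φ := fun ξ => ‖Complex.I * (oscFactor x ξ * (phaseQuotDeriv k x ξ : ℂ)) * w ξ‖)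
      ?_ fun ξ hξ => ?_
    · simpa [mul_sub] using this
    · rw [integrableOn_Icc_iff_integrableOn_Ioc]
      exact ((intervalIntegrable_iff_integrableOn_Ioc_of_le hab).1 hint2).norm
    · simp only [norm_mul, Complex.norm_I, norm_oscFactor, one_mul, Complex.norm_real,
        Real.norm_eq_abs]
      rw [mul_comm]
      have := H.norm_le ξ (hpos ξ (hsub hξ))
      have := hp ξ (hsub hξ)
      gcongr
  have b2 : ‖∫ ξ in a..b, E ξ * h ξ‖ ≤ A * (ε / 2) + (S b - S a) / (2 * ε) := by
    refine (intervalIntegral.norm_integral_le_integral_norm hab).trans ?_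
    have hw2 : IntervalIntegrable (fun ξ => ξ * ‖h ξ‖ ^ 2) volume a b := by
      rw [intervalIntegrable_iff_integrableOn_Ioc_of_le hab]
      exact H.integrableOn.mono_set fun ξ hξ => ha.trans hξ.1
    have hw3 : ∫ ξ in a..b, ξ * ‖h ξ‖ ^ 2 ≤ A := by
      rw [intervalIntegral.integral_of_le hab]
      refine le_trans (setIntegral_mono_set H.integrableOn ?_ ?_) H.integral_le
      · refine (ae_restrict_iff' measurableSet_Ioi).2 (ae_of_all _ fun ξ hξ => ?_)
        have : (0 : ℝ) < ξ := hξ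
        simp only [Pi.zero_apply]; positivity
      · exact (Set.Ioc_subset_Ioi_self.trans (Set.Ioi_subset_Ioi ha.le)).eventuallyLE
    have hq2 : IntervalIntegrable (fun ξ => phaseQuot k x ξ ^ 2 / ξ) volume a b := by
      refine ContinuousOn.intervalIntegrable ?_
      rw [Set.uIcc_of_le hab]
      exact (hqc.pow 2).div continuousOn_id fun ξ hξ => (hpos ξ hξ).ne'
    have hEi : IntervalIntegrable (fun ξ => E ξ * h ξ) volume a b := by
      refine hhi.continuousOn_mul ?_
      rw [Set.uIcc_of_le hab]
      exact fun ξ hξ => (hE ξ hξ).continuousAt.continuousWithinAt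
    have hS' : ∫ ξ in a..b, phaseQuot k x ξ ^ 2 / ξ ≤ S b - S a := by
      refine intervalIntegral.integral_le_sub_of_hasDeriv_right_of_le hab hcS
        (fun ξ hξ => (hS ξ (hsub hξ)).hasDerivWithinAt) ?_ fun ξ hξ => hs ξ (hsub hξ)
      rw [integrableOn_Icc_iff_integrableOn_Ioc]
      exact (intervalIntegrable_iff_integrableOn_Ioc_of_le hab).1 hq2
    calc ∫ ξ in a..b, ‖E ξ * h ξ‖
        ≤ ∫ ξ in a..b, (ε / 2 * (ξ * ‖h ξ‖ ^ 2) + 1 / (2 * ε) * (phaseQuot k x ξ ^ 2 / ξ)) := by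
          refine intervalIntegral.integral_mono_on hab hEi.norm
            ((hw2.const_mul _).add (hq2.const_mul _)) fun ξ hξ => ?_
          have h0 := hpos ξ hξ
          rw [norm_mul, hEn, ← sq_abs (phaseQuot k x ξ)]
          have : ε / 2 * (ξ * ‖h ξ‖ ^ 2) + 1 / (2 * ε) * (|phaseQuot k x ξ| ^ 2 / ξ) -
              |phaseQuot k x ξ| * ‖h ξ‖ =
              (ε * ξ * ‖h ξ‖ - |phaseQuot k x ξ|) ^ 2 / (2 * ε * ξ) := by
            field_simp; ring
          have h4 : 0 ≤ (ε * ξ * ‖h ξ‖ - |phaseQuot k x ξ|) ^ 2 / (2 * ε * ξ) := by positivity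
          linarith
      _ = ε / 2 * (∫ ξ in a..b, ξ * ‖h ξ‖ ^ 2) +
            1 / (2 * ε) * ∫ ξ in a..b, phaseQuot k x ξ ^ 2 / ξ := by
          rw [intervalIntegral.integral_add (hw2.const_mul _) (hq2.const_mul _),
            intervalIntegral.integral_const_mul, intervalIntegral.integral_const_mul]
      _ ≤ ε / 2 * A + 1 / (2 * ε) * (S b - S a) := by gcongr
      _ = _ := by ring
  rw [main]
  have n1 : ‖E b * w b‖ ≤ A * |phaseQuot k x b| := by
    rw [norm_mul, hEn, mul_comm]; gcongr; exact H.norm_le b hb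
  have n2 : ‖E a * w a‖ ≤ A * |phaseQuot k x a| := by
    rw [norm_mul, hEn, mul_comm]; gcongr; exact H.norm_le a ha
  calc _ ≤ ‖E b * w b‖ + ‖E a * w a‖ + ‖∫ ξ in a..b, E ξ * h ξ‖ +
        ‖∫ ξ in a..b, Complex.I * (oscFactor x ξ * (phaseQuotDeriv k x ξ : ℂ)) * w ξ‖ :=
        (norm_add_le _ _).trans (add_le_add_left ((norm_sub_le _ _).trans
          (add_le_add_left (norm_sub_le _ _) _)) _)
    _ ≤ _ := by linarith

end HalfLineProfile

/-! ### Non-stationary phase in the frequency regions -/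

theorem abs_phaseQuot_le {k : ℕ} {x ξ G d : ℝ} (hξ : 0 < ξ) (hG : ξ ^ k ≤ G) (hd : 0 < d)
    (hd' : d ≤ |x + 5 * ξ ^ 4|) : |phaseQuot k x ξ| ≤ G / d := by
  rw [phaseQuot, abs_div, abs_of_pos (pow_pos hξ k)]
  have := pow_pos hξ k
  have := this.le.trans hG
  gcongr

theorem phaseQuot_sq_div_le {k : ℕ} {x ξ G d : ℝ} (hξ : 0 < ξ) (hG : ξ ^ k ≤ G) (hd : 0 < d)
    (hd' : d ≤ |x + 5 * ξ ^ 4|) : phaseQuot k x ξ ^ 2 / ξ ≤ (G / d) ^ 2 / ξ := by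
  rw [← sq_abs]
  have := abs_phaseQuot_le hξ hG hd hd'
  gcongr

theorem natCast_mul_pow_div_le {k : ℕ} {ξ B : ℝ} (hξ : 0 < ξ) (hB : ξ ≤ B) :
    k * ξ ^ k / ξ ≤ k * B ^ k / B := by
  rcases k with _ | k
  · simp
  · have hB0 := hξ.trans_le hB
    have e : ∀ z : ℝ, 0 < z → ((k + 1 : ℕ) : ℝ) * z ^ (k + 1) / z = ((k + 1 : ℕ) : ℝ) * z ^ k :=
      fun z hz => by rw [pow_succ]; field_simp
    rw [e _ hξ, e _ hB0]
    gcongr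

theorem abs_phaseQuotDeriv_le_of_le {k : ℕ} (hk : k ≤ 3) {x ξ B d : ℝ} (hξ : 0 < ξ) (hB : ξ ≤ B)
    (hd : 0 < d) (hd' : d ≤ |x + 5 * ξ ^ 4|) :
    |phaseQuotDeriv k x ξ| ≤ B ^ k * (3 / (B * d) + 20 * B ^ 3 / d ^ 2) := by
  have hB0 := hξ.trans_le hB
  refine (abs_phaseQuotDeriv_le hξ (abs_pos.1 (hd.trans_le hd'))).trans ?_
  have h1 : (k : ℝ) * ξ ^ k / ξ ≤ 3 * B ^ k / B :=
    (natCast_mul_pow_div_le hξ hB).trans (by gcongr; exact_mod_cast hk)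
  have h2 : ξ ^ k ≤ B ^ k := pow_le_pow_left₀ hξ.le hB k
  calc _ ≤ 3 * B ^ k / B / d + B ^ k * (20 * B ^ 3) / d ^ 2 := by gcongr
    _ = _ := by field_simp

namespace HalfLineProfile

variable {A : ℝ} {w h : ℝ → ℂ}

/-- At high frequency the phase derivative is comparable to `ξ⁴`. -/
theorem norm_integral_high_le (H : HalfLineProfile A w h) {k : ℕ} (hk : k ≤ 3) {x M a b : ℝ}
    (hM : 1 ≤ M) (hx : |x| ≤ 5 * M ^ 4) (ha : 2 * M ≤ a) (hab : a ≤ b) :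
    ‖∫ ξ in a..b, (ξ : ℂ) ^ k * oscFactor x ξ * w ξ‖ ≤ 4 * A * (a ^ k / a ^ 4) := by
  have hA := H.one_le
  have ha0 : 0 < a := by linarith
  have hd : ∀ ξ ∈ Set.Icc a b, 4 * ξ ^ 4 ≤ |x + 5 * ξ ^ 4| := fun ξ hξ => by
    have h1 : (2 * M) ^ 4 ≤ ξ ^ 4 := pow_le_pow_left₀ (by linarith) (ha.trans hξ.1) 4
    have h2 := neg_abs_le x
    refine le_trans ?_ (le_abs_self _)
    nlinarith [pow_nonneg (show 0 ≤ M by linarith) 4]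
  have hpos : ∀ ξ ∈ Set.Icc a b, 0 < ξ := fun ξ hξ => ha0.trans_le hξ.1
  set g : ℝ := a ^ k / a ^ 3 with hg
  have hg0 : 0 < g := by positivity
  have hG : ∀ ξ ∈ Set.Icc a b, ξ ^ k ≤ g * ξ ^ 3 := fun ξ hξ => by
    have h1 : a ^ (3 - k) ≤ ξ ^ (3 - k) := pow_le_pow_left₀ ha0.le hξ.1 _
    have h0 := hpos ξ hξ
    rw [hg, div_mul_eq_mul_div, le_div_iff₀ (by positivity)]
    calc ξ ^ k * a ^ 3 = ξ ^ k * a ^ k * a ^ (3 - k) := by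
          rw [mul_assoc, ← pow_add, Nat.add_sub_cancel' hk]
      _ ≤ ξ ^ k * a ^ k * ξ ^ (3 - k) := by gcongr
      _ = a ^ k * ξ ^ 3 := by
          rw [mul_comm (ξ ^ k), mul_assoc, ← pow_add, Nat.add_sub_cancel' hk]
  have hq : ∀ ξ ∈ Set.Icc a b, |phaseQuot k x ξ| ≤ g / a / 4 := fun ξ hξ => by
    have h0 := hpos ξ hξ
    refine (abs_phaseQuot_le h0 (hG ξ hξ) (by positivity) (hd ξ hξ)).trans ?_
    have : g * ξ ^ 3 / (4 * ξ ^ 4) = g / ξ / 4 := by field_simp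
    rw [this]
    have := hξ.1
    gcongr
  have key := H.norm_integral_le_of_phase k x (ε := g / a) ha0 hab (by positivity)
    (fun ξ hξ => abs_pos.1 (lt_of_lt_of_le (by have := hpos ξ hξ; positivity) (hd ξ hξ)))
    (P := fun ξ => -(2 * g) * ξ⁻¹) (p := fun ξ => 2 * g / ξ ^ 2)
    (S := fun ξ => -(g ^ 2 / 32) * (ξ ^ 2)⁻¹) (s := fun ξ => g ^ 2 / 16 / ξ ^ 3) ?_ ?_ ?_ ?_
  · refine key.trans ?_
    have q1 := hq a (Set.left_mem_Icc.2 hab)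
    have q2 := hq b (Set.right_mem_Icc.2 hab)
    have hb0 : 0 < b := hpos b (Set.right_mem_Icc.2 hab)
    have e1 : -(2 * g) * b⁻¹ - -(2 * g) * a⁻¹ ≤ 2 * (g / a) := by
      have : 0 ≤ 2 * g * b⁻¹ := by positivity
      have e : 2 * (g / a) = 2 * g * a⁻¹ := by ring
      linarith
    have e2 : (-(g ^ 2 / 32) * (b ^ 2)⁻¹ - -(g ^ 2 / 32) * (a ^ 2)⁻¹) / (2 * (g / a)) ≤
        g / a := by
      rw [div_le_iff₀ (by positivity)]
      have : 0 ≤ g ^ 2 / 32 * (b ^ 2)⁻¹ := by positivity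
      have h2 : 0 ≤ (g / a) ^ 2 := by positivity
      have e : g ^ 2 / 32 * (a ^ 2)⁻¹ = (g / a) ^ 2 / 32 := by ring
      nlinarith
    have e3 : a ^ k / a ^ 4 = g / a := by rw [hg]; field_simp
    rw [e3]
    have hga : 0 < g / a := by positivity
    calc _ ≤ A * (g / a / 4 + g / a / 4 + 2 * (g / a) + g / a / 2) + g / a := by gcongr
      _ ≤ _ := by nlinarith
  · intro ξ hξ
    have h0 := hpos ξ hξ
    refine ((hasDerivAt_inv h0.ne').const_mul _).congr_deriv ?_
    field_simp
  · intro ξ hξ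
    have h0 := hpos ξ hξ
    have hd0 := hd ξ hξ
    refine (abs_phaseQuotDeriv_le h0 (abs_pos.1 (lt_of_lt_of_le (by positivity) hd0))).trans ?_
    have hG0 := hG ξ hξ
    have hk' : (k : ℝ) ≤ 3 := by exact_mod_cast hk
    calc _ ≤ 3 * (g * ξ ^ 3) / ξ / (4 * ξ ^ 4) + g * ξ ^ 3 * (20 * ξ ^ 3) / (4 * ξ ^ 4) ^ 2 := by
          gcongr
      _ = 2 * g / ξ ^ 2 := by field_simp; norm_num
  · intro ξ hξ
    have h0 := hpos ξ hξ
    refine (((hasDerivAt_pow 2 ξ).inv (by positivity)).const_mul _).congr_deriv ?_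
    field_simp; norm_num; ring
  · intro ξ hξ
    have h0 := hpos ξ hξ
    refine (phaseQuot_sq_div_le h0 (hG ξ hξ) (by positivity) (hd ξ hξ)).trans (le_of_eq ?_)
    field_simp; norm_num

/-- For `x = 5 ρ⁴` the phase derivative is at least `5 ρ⁴`. The logarithm is `∫ dξ / ξ` over the
interval, which begins at `ρ⁻⁴` because `[0, ρ⁻⁴]` contributes no more than the other terms. -/
theorem norm_integral_elliptic_le (H : HalfLineProfile A w h) {k : ℕ} (hk : k ≤ 3) {ρ : ℝ}
    (hρ : 1 ≤ ρ) :
    ‖∫ ξ in (1 / ρ ^ 4)..(2 * ρ), (ξ : ℂ) ^ k * oscFactor (5 * ρ ^ 4) ξ * w ξ‖ ≤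
      15 * A * ((2 * ρ) ^ k / ρ ^ 4) * (1 + Real.log (2 * ρ ^ 5)) := by
  have hA := H.one_le
  have hρ0 : 0 < ρ := by linarith
  have ha0 : 0 < 1 / ρ ^ 4 := by positivity
  have hab : 1 / ρ ^ 4 ≤ 2 * ρ := by
    rw [div_le_iff₀ (by positivity)]
    nlinarith [one_le_pow₀ hρ (n := 5)]
  have hd : ∀ ξ ∈ Set.Icc (1 / ρ ^ 4) (2 * ρ), 5 * ρ ^ 4 ≤ |5 * ρ ^ 4 + 5 * ξ ^ 4| := fun ξ hξ => by
    refine le_trans ?_ (le_abs_self _)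
    have : 0 ≤ ξ ^ 4 := by positivity
    linarith
  have hpos : ∀ ξ ∈ Set.Icc (1 / ρ ^ 4) (2 * ρ), 0 < ξ := fun ξ hξ => ha0.trans_le hξ.1
  set G : ℝ := (2 * ρ) ^ k with hGdef
  have hG : ∀ ξ ∈ Set.Icc (1 / ρ ^ 4) (2 * ρ), ξ ^ k ≤ G := fun ξ hξ =>
    pow_le_pow_left₀ (hpos ξ hξ).le hξ.2 k
  have hG0 : 0 < G := by positivity
  have hd0 : 0 < 5 * ρ ^ 4 := by positivity
  have key := H.norm_integral_le_of_phase k (5 * ρ ^ 4) (ε := G / ρ ^ 4) ha0 hab (by positivity)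
    (fun ξ hξ => abs_pos.1 (hd0.trans_le (hd ξ hξ)))
    (P := fun ξ => 7 * (G / ρ ^ 5) * ξ) (p := fun ξ => 7 * (G / ρ ^ 5))
    (S := fun ξ => (G / (5 * ρ ^ 4)) ^ 2 * Real.log ξ)
    (s := fun ξ => (G / (5 * ρ ^ 4)) ^ 2 / ξ) ?_ ?_ ?_ ?_
  · refine key.trans ?_
    have hl : Real.log (2 * ρ) - Real.log (1 / ρ ^ 4) = Real.log (2 * ρ ^ 5) := by
      rw [← Real.log_div (by positivity) (by positivity)]
      congr 1; field_simp
    have hl0 : 0 ≤ Real.log (2 * ρ ^ 5) :=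
      Real.log_nonneg (by nlinarith [one_le_pow₀ hρ (n := 5)])
    have q1 := abs_phaseQuot_le (hpos _ (Set.left_mem_Icc.2 hab)) (hG _ (Set.left_mem_Icc.2 hab))
      hd0
      (hd _ (Set.left_mem_Icc.2 hab))
    have q2 := abs_phaseQuot_le (hpos _ (Set.right_mem_Icc.2 hab)) (hG _ (Set.right_mem_Icc.2 hab))
      hd0 (hd _ (Set.right_mem_Icc.2 hab))
    set T := G / ρ ^ 4 with hT
    have hT0 : 0 < T := by positivity
    have e0 : G / (5 * ρ ^ 4) = T / 5 := by rw [hT]; field_simp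
    rw [e0] at q1 q2
    have e1 : 7 * (G / ρ ^ 5) * (2 * ρ) - 7 * (G / ρ ^ 5) * (1 / ρ ^ 4) ≤ 14 * T := by
      have : 0 ≤ 7 * (G / ρ ^ 5) * (1 / ρ ^ 4) := by positivity
      have e : 7 * (G / ρ ^ 5) * (2 * ρ) = 14 * T := by rw [hT]; field_simp; norm_num
      linarith
    have e2 : ((G / (5 * ρ ^ 4)) ^ 2 * Real.log (2 * ρ) -
        (G / (5 * ρ ^ 4)) ^ 2 * Real.log (1 / ρ ^ 4)) / (2 * T) =
        T * Real.log (2 * ρ ^ 5) / 50 := by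
      rw [← mul_sub, hl, e0]; field_simp; ring
    calc _ ≤ A * (T / 5 + T / 5 + 14 * T + T / 2) + T * Real.log (2 * ρ ^ 5) / 50 := by
          rw [e2]; gcongr
      _ ≤ _ := by nlinarith [mul_nonneg hT0.le hl0, mul_pos (by linarith : 0 < A) hT0,
            mul_nonneg (sub_nonneg.2 hA) (mul_nonneg hT0.le hl0)]
  · intro ξ hξ
    simpa using (hasDerivAt_id ξ).const_mul (7 * (G / ρ ^ 5))
  · intro ξ hξ
    refine (abs_phaseQuotDeriv_le_of_le hk (hpos ξ hξ) hξ.2 hd0 (hd ξ hξ)).trans ?_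
    rw [← hGdef]
    have : G * (3 / (2 * ρ * (5 * ρ ^ 4)) + 20 * (2 * ρ) ^ 3 / (5 * ρ ^ 4) ^ 2) =
      67 / 10 * (G / ρ ^ 5) := by field_simp; norm_num
    rw [this]
    have : 0 < G / ρ ^ 5 := by positivity
    linarith
  · intro ξ hξ
    exact ((Real.hasDerivAt_log (hpos ξ hξ).ne').const_mul _)
  · intro ξ hξ
    exact phaseQuot_sq_div_le (hpos ξ hξ) (hG ξ hξ) hd0 (hd ξ hξ)

/-- For `x = -5 ρ⁴` with `ρ = σ²`, away from a window of width `σ⁻³` around the stationary point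
`ρ`, and above the frequency `σ⁻³ / 2`. -/
theorem norm_integral_hyperbolic_le (H : HalfLineProfile A w h) {k : ℕ} (hk : k ≤ 3) {σ a b : ℝ}
    (hσ : 1 ≤ σ) (ha : 1 / σ ^ 3 / 2 ≤ a) (hab : a ≤ b) (hb : b ≤ 2 * σ ^ 2)
    (hsep : ∀ ξ ∈ Set.Icc a b, 1 / σ ^ 3 / 2 ≤ |ξ - σ ^ 2|) :
    ‖∫ ξ in a..b, (ξ : ℂ) ^ k * oscFactor (-(5 * σ ^ 8)) ξ * w ξ‖ ≤
      30 * A * ((2 * σ ^ 2) ^ k / σ ^ 3) := by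
  have hA := H.one_le
  have hσ0 : 0 < σ := by linarith
  have hτ0 : 0 < 1 / σ ^ 3 / 2 := by positivity
  have ha0 : 0 < a := hτ0.trans_le ha
  have hpos : ∀ ξ ∈ Set.Icc a b, 0 < ξ := fun ξ hξ => ha0.trans_le hξ.1
  have hD0 : ∀ ξ ∈ Set.Icc a b, 0 < |ξ - σ ^ 2| := fun ξ hξ => hτ0.trans_le (hsep ξ hξ)
  have hDle : ∀ ξ ∈ Set.Icc a b, |ξ - σ ^ 2| ≤ σ ^ 2 := fun ξ hξ => by
    rw [abs_le]; constructor <;> linarith [hpos ξ hξ, hξ.2]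
  -- `φ' = 5 (ξ - ρ) (ξ + ρ) (ξ² + ρ²)`
  have hd : ∀ ξ ∈ Set.Icc a b,
      5 * σ ^ 6 * |ξ - σ ^ 2| ≤ |-(5 * σ ^ 8) + 5 * ξ ^ 4| := fun ξ hξ => by
    have h0 := hpos ξ hξ
    have e : -(5 * σ ^ 8) + 5 * ξ ^ 4 =
        (5 * ((ξ + σ ^ 2) * (ξ ^ 2 + σ ^ 4))) * (ξ - σ ^ 2) := by ring
    rw [e, abs_mul, abs_of_pos (show 0 < 5 * ((ξ + σ ^ 2) * (ξ ^ 2 + σ ^ 4)) by positivity)]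
    gcongr
    have : (0 : ℝ) ≤ ξ ^ 3 + ξ * σ ^ 4 + σ ^ 2 * ξ ^ 2 := by positivity
    nlinarith
  set G : ℝ := (2 * σ ^ 2) ^ k with hGdef
  have hG : ∀ ξ ∈ Set.Icc a b, ξ ^ k ≤ G := fun ξ hξ =>
    pow_le_pow_left₀ (hpos ξ hξ).le (hξ.2.trans hb) k
  have hG0 : 0 < G := by positivity
  set T := G / σ ^ 3 with hT
  have hT0 : 0 < T := by positivity
  have hd0 : ∀ ξ ∈ Set.Icc a b, 0 < 5 * σ ^ 6 * |ξ - σ ^ 2| := fun ξ hξ => by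
    have := hD0 ξ hξ; positivity
  have hne : ∀ ξ ∈ Set.Icc a b, ξ - σ ^ 2 ≠ 0 := fun ξ hξ => abs_pos.1 (hD0 ξ hξ)
  have hinv : ∀ ξ ∈ Set.Icc a b, |(ξ - σ ^ 2)⁻¹| ≤ 2 * σ ^ 3 := fun ξ hξ => by
    rw [abs_inv, inv_le_comm₀ (hD0 ξ hξ) (by positivity)]
    refine le_trans (le_of_eq ?_) (hsep ξ hξ)
    field_simp
  have hderiv : ∀ (c : ℝ), ∀ ξ ∈ Set.Icc a b,
      HasDerivAt (fun ξ => -c * (ξ - σ ^ 2)⁻¹) (c / (ξ - σ ^ 2) ^ 2) ξ := fun c ξ hξ => by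
    refine ((((hasDerivAt_id ξ).sub_const _).inv (hne ξ hξ)).const_mul _).congr_deriv ?_
    have := hne ξ hξ
    simp only [id]
    field_simp
  have hdiff : ∀ c : ℝ, 0 ≤ c → -c * (b - σ ^ 2)⁻¹ - -c * (a - σ ^ 2)⁻¹ ≤ c * (4 * σ ^ 3) :=
    fun c hc => by
      have h1 := hinv a (Set.left_mem_Icc.2 hab)
      have h2 := hinv b (Set.right_mem_Icc.2 hab)
      have : -c * (b - σ ^ 2)⁻¹ - -c * (a - σ ^ 2)⁻¹ =
        c * ((a - σ ^ 2)⁻¹ - (b - σ ^ 2)⁻¹) := by ring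
      rw [this]
      gcongr
      linarith [(abs_le.1 h1).2, (abs_le.1 h2).1]
  have hq : ∀ ξ ∈ Set.Icc a b, |phaseQuot k (-(5 * σ ^ 8)) ξ| ≤ T := fun ξ hξ => by
    refine (abs_phaseQuot_le (hpos ξ hξ) (hG ξ hξ) (hd0 ξ hξ) (hd ξ hξ)).trans ?_
    rw [hT]
    have h1 := hsep ξ hξ
    gcongr
    calc σ ^ 3 ≤ 5 * σ ^ 6 * (1 / σ ^ 3 / 2) := by
          have : 5 * σ ^ 6 * (1 / σ ^ 3 / 2) = 5 / 2 * σ ^ 3 := by field_simp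
          rw [this]; nlinarith [pow_pos hσ0 3]
      _ ≤ _ := by gcongr
  have key := H.norm_integral_le_of_phase k (-(5 * σ ^ 8)) (ε := T) ha0 hab hT0
    (fun ξ hξ => abs_pos.1 ((hd0 ξ hξ).trans_le (hd ξ hξ)))
    (P := fun ξ => -(67 / 10 * (G / σ ^ 6)) * (ξ - σ ^ 2)⁻¹)
    (p := fun ξ => 67 / 10 * (G / σ ^ 6) / (ξ - σ ^ 2) ^ 2)
    (S := fun ξ => -(2 / 25 * G ^ 2 / σ ^ 9) * (ξ - σ ^ 2)⁻¹)
    (s := fun ξ => 2 / 25 * G ^ 2 / σ ^ 9 / (ξ - σ ^ 2) ^ 2)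
    (hderiv _) ?_ (hderiv _) ?_
  · refine key.trans ?_
    have q1 := hq a (Set.left_mem_Icc.2 hab)
    have q2 := hq b (Set.right_mem_Icc.2 hab)
    have e1 := hdiff (67 / 10 * (G / σ ^ 6)) (by positivity)
    have e2 := hdiff (2 / 25 * G ^ 2 / σ ^ 9) (by positivity)
    have e3 : 67 / 10 * (G / σ ^ 6) * (4 * σ ^ 3) = 134 / 5 * T := by
      rw [hT]; field_simp; norm_num
    have e4 : 2 / 25 * G ^ 2 / σ ^ 9 * (4 * σ ^ 3) / (2 * T) = 4 / 25 * T := by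
      rw [hT]; field_simp
    rw [e3] at e1
    calc _ ≤ A * (T + T + 134 / 5 * T + T / 2) +
          2 / 25 * G ^ 2 / σ ^ 9 * (4 * σ ^ 3) / (2 * T) := by gcongr
      _ ≤ _ := by rw [e4]; nlinarith
  · intro ξ hξ
    have hD := hD0 ξ hξ
    have hDle' := hDle ξ hξ
    refine (abs_phaseQuotDeriv_le_of_le hk (hpos ξ hξ) (hξ.2.trans hb) (hd0 ξ hξ)
      (hd ξ hξ)).trans ?_
    rw [← hGdef, ← sq_abs (ξ - σ ^ 2)]
    set D := |ξ - σ ^ 2|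
    have e : G * (3 / (2 * σ ^ 2 * (5 * σ ^ 6 * D)) +
        20 * (2 * σ ^ 2) ^ 3 / (5 * σ ^ 6 * D) ^ 2) =
        G / σ ^ 6 / D ^ 2 * (3 / 10 * (D / σ ^ 2) + 32 / 5) := by field_simp; ring
    have e' : 67 / 10 * (G / σ ^ 6) / D ^ 2 = G / σ ^ 6 / D ^ 2 * (67 / 10) := by ring
    rw [e, e']
    have : D / σ ^ 2 ≤ 1 := (div_le_one (by positivity)).2 hDle'
    gcongr
    linarith
  · intro ξ hξ
    have hD := hD0 ξ hξ
    have h0 := hpos ξ hξ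
    refine (phaseQuot_sq_div_le h0 (hG ξ hξ) (hd0 ξ hξ) (hd ξ hξ)).trans ?_
    rw [← sq_abs (ξ - σ ^ 2)]
    set D := |ξ - σ ^ 2|
    have e1 : 2 / 25 * G ^ 2 / σ ^ 9 / D ^ 2 = (G / (5 * σ ^ 6 * D)) ^ 2 / (1 / σ ^ 3 / 2) := by
      field_simp; norm_num
    rw [e1]
    have := ha.trans hξ.1
    gcongr

end HalfLineProfile

/-! ### Bounds for the truncated integrals and passage to the limit -/

namespace HalfLineProfile

variable {A : ℝ} {w h : ℝ → ℂ}

theorem integral_add_adjacent (H : HalfLineProfile A w h) (k : ℕ) (x : ℝ) {a b c : ℝ}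
    (ha : 0 ≤ a) (hb : 0 ≤ b) (hc : 0 ≤ c) :
    (∫ ξ in a..b, (ξ : ℂ) ^ k * oscFactor x ξ * w ξ) +
      (∫ ξ in b..c, (ξ : ℂ) ^ k * oscFactor x ξ * w ξ) =
      ∫ ξ in a..c, (ξ : ℂ) ^ k * oscFactor x ξ * w ξ :=
  intervalIntegral.integral_add_adjacent_intervals
    (H.intervalIntegrable_mul ha hb (continuous_amplitude k x))
    (H.intervalIntegrable_mul hb hc (continuous_amplitude k x))

/-- The tail estimate behind the convergence of the improper integral. -/
theorem norm_oscIntegral_sub_le (H : HalfLineProfile A w h) {k : ℕ} (hk : k ≤ 3) {x M a b : ℝ}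
    (hM : 1 ≤ M) (hx : |x| ≤ 5 * M ^ 4) (ha : 2 * M ≤ a) (hab : a ≤ b) :
    ‖oscIntegral w k x b - oscIntegral w k x a‖ ≤ 4 * A * (a ^ k / a ^ 4) := by
  have h0 : (0 : ℝ) ≤ a := by linarith
  rw [oscIntegral, oscIntegral, ← H.integral_add_adjacent k x le_rfl h0 (h0.trans hab),
    add_sub_cancel_left]
  exact H.norm_integral_high_le hk hM hx ha hab

theorem pow_div_pow_four_le {k : ℕ} (hk : k ≤ 3) {a : ℝ} (ha : 1 ≤ a) : a ^ k / a ^ 4 ≤ 1 / a := by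
  have h0 : 0 < a := by linarith
  rw [div_le_div_iff₀ (by positivity) h0, ← pow_succ, one_mul]
  exact pow_le_pow_right₀ ha (by omega)

theorem norm_oscIntegral_central_le (H : HalfLineProfile A w h) {k : ℕ} (hk : k ≤ 3) {x R : ℝ}
    (hx : |x| ≤ 5) (hR : 2 ≤ R) : ‖oscIntegral w k x R‖ ≤ 18 * A := by
  have hA := H.one_le
  have h1 := H.norm_integral_le k x (a := 0) (b := 2) (B := 2) le_rfl (by norm_num) le_rfl
  have h2 := H.norm_oscIntegral_sub_le hk (x := x) (M := 1) (a := 2) (b := R) le_rfl (by simpa)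
    (by norm_num) hR
  have h3 : (2 : ℝ) ^ k ≤ 2 ^ 3 := pow_le_pow_right₀ (by norm_num) hk
  have h4 : ‖oscIntegral w k x R‖ ≤ ‖oscIntegral w k x R - oscIntegral w k x 2‖ +
    ‖oscIntegral w k x 2‖ := by
      simpa using norm_add_le (oscIntegral w k x R - oscIntegral w k x 2) (oscIntegral w k x 2)
  rw [← oscIntegral] at h1
  have h5 : A * 2 ^ k * (2 - 0) ≤ 16 * A := by nlinarith
  have h6 : 4 * A * (2 ^ k / 2 ^ 4) ≤ 2 * A := by nlinarith
  linarith

theorem norm_oscIntegral_elliptic_le (H : HalfLineProfile A w h) {k : ℕ} (hk : k ≤ 3) {ρ R : ℝ}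
    (hρ : 1 ≤ ρ) (hR : 2 * ρ ≤ R) :
    ‖oscIntegral w k (5 * ρ ^ 4) R‖ ≤ 136 * A * (ρ ^ k / ρ ^ 4) * (1 + Real.log (2 * ρ ^ 5)) := by
  have hA := H.one_le
  have hρ0 : 0 < ρ := by linarith
  have hab : 1 / ρ ^ 4 ≤ 2 * ρ := by
    rw [div_le_iff₀ (by positivity)]
    nlinarith [one_le_pow₀ hρ (n := 5)]
  have h1 := H.norm_integral_le k (5 * ρ ^ 4) (a := 0) (b := 1 / ρ ^ 4) le_rfl (by positivity) hab
  have h2 := H.norm_integral_elliptic_le hk hρ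
  have h3 := H.norm_oscIntegral_sub_le hk (x := 5 * ρ ^ 4) hρ
    (le_of_eq (abs_of_pos (by positivity))) le_rfl hR
  have e : oscIntegral w k (5 * ρ ^ 4) R =
      (∫ ξ in (0 : ℝ)..(1 / ρ ^ 4), (ξ : ℂ) ^ k * oscFactor (5 * ρ ^ 4) ξ * w ξ) +
      (∫ ξ in (1 / ρ ^ 4)..(2 * ρ), (ξ : ℂ) ^ k * oscFactor (5 * ρ ^ 4) ξ * w ξ) +
      (oscIntegral w k (5 * ρ ^ 4) R - oscIntegral w k (5 * ρ ^ 4) (2 * ρ)) := by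
    rw [H.integral_add_adjacent k _ le_rfl (by positivity) (by positivity), ← oscIntegral]; ring
  rw [e]
  refine (norm_add₃_le).trans ((add_le_add (add_le_add h1 h2) h3).trans ?_)
  have hl0 : 0 ≤ Real.log (2 * ρ ^ 5) :=
    Real.log_nonneg (by nlinarith [one_le_pow₀ hρ (n := 5)])
  have h4 : (2 * ρ) ^ k ≤ 8 * ρ ^ k := by
    rw [mul_pow]; gcongr
    calc (2 : ℝ) ^ k ≤ 2 ^ 3 := pow_le_pow_right₀ (by norm_num) hk
      _ = 8 := by norm_num
  set T := (2 * ρ) ^ k / ρ ^ 4 with hT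
  have hT0 : 0 < T := by positivity
  have h5 : T ≤ 8 * (ρ ^ k / ρ ^ 4) := by
    rw [hT, ← mul_div_assoc]; gcongr
  have e1 : A * (2 * ρ) ^ k * (1 / ρ ^ 4 - 0) = A * T := by rw [hT]; ring
  have e2 : 4 * A * ((2 * ρ) ^ k / (2 * ρ) ^ 4) = A * T / 4 := by
    rw [hT, mul_pow 2 ρ 4]; field_simp; norm_num
  rw [e1, e2]
  have hAT : 0 < A * T := by positivity
  calc A * T + 15 * A * T * (1 + Real.log (2 * ρ ^ 5)) + A * T / 4
      ≤ 17 * A * T * (1 + Real.log (2 * ρ ^ 5)) := by nlinarith [mul_nonneg hAT.le hl0]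
    _ ≤ 17 * A * (8 * (ρ ^ k / ρ ^ 4)) * (1 + Real.log (2 * ρ ^ 5)) := by gcongr
    _ = _ := by ring

/-- For `x = -5 ρ⁴` with `ρ = σ²`, the window of width `σ⁻³` around the stationary point `ρ` and a
neighbourhood of the origin are estimated trivially, and the rest by non-stationary phase. -/
theorem norm_oscIntegral_hyperbolic_le (H : HalfLineProfile A w h) {k : ℕ} (hk : k ≤ 3) {σ R : ℝ}
    (hσ : 1 ≤ σ) (hR : 2 * σ ^ 2 ≤ R) :
    ‖oscIntegral w k (-(5 * σ ^ 8)) R‖ ≤ 496 * A * (σ ^ (2 * k) / σ ^ 3) := by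
  have hA := H.one_le
  have hσ0 : 0 < σ := by linarith
  have hσ2 : 1 ≤ σ ^ 2 := one_le_pow₀ hσ
  set τ := 1 / σ ^ 3 with hτ
  have hτ0 : 0 < τ := by positivity
  have hτ1 : τ ≤ 1 := (div_le_one (by positivity)).2 (one_le_pow₀ hσ)
  have h1 := H.norm_integral_le k (-(5 * σ ^ 8)) (a := 0) (b := τ / 2) (B := 2 * σ ^ 2) le_rfl
    (by positivity) (by linarith)
  have h2 := H.norm_integral_hyperbolic_le hk hσ (a := τ / 2) (b := σ ^ 2 - τ / 2) le_rfl
    (by linarith) (by linarith)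
    (fun ξ hξ => by rw [abs_sub_comm]; exact le_trans (by linarith [hξ.2]) (le_abs_self _))
  have h3 := H.norm_integral_le k (-(5 * σ ^ 8)) (a := σ ^ 2 - τ / 2) (b := σ ^ 2 + τ / 2)
    (B := 2 * σ ^ 2) (by linarith) (by linarith) (by linarith)
  have h4 := H.norm_integral_hyperbolic_le hk hσ (a := σ ^ 2 + τ / 2) (b := 2 * σ ^ 2)
    (by linarith) (by linarith) le_rfl
    (fun ξ hξ => le_trans (by linarith [hξ.1]) (le_abs_self _))
  have h5 := H.norm_oscIntegral_sub_le hk (x := -(5 * σ ^ 8)) (M := σ ^ 2) hσ2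
    (le_of_eq (by rw [abs_neg, abs_of_pos (by positivity)]; ring)) le_rfl hR
  have e : oscIntegral w k (-(5 * σ ^ 8)) R =
      (∫ ξ in (0 : ℝ)..(τ / 2), (ξ : ℂ) ^ k * oscFactor (-(5 * σ ^ 8)) ξ * w ξ) +
      (∫ ξ in (τ / 2)..(σ ^ 2 - τ / 2), (ξ : ℂ) ^ k * oscFactor (-(5 * σ ^ 8)) ξ * w ξ) +
      (∫ ξ in (σ ^ 2 - τ / 2)..(σ ^ 2 + τ / 2),
        (ξ : ℂ) ^ k * oscFactor (-(5 * σ ^ 8)) ξ * w ξ) +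
      (∫ ξ in (σ ^ 2 + τ / 2)..(2 * σ ^ 2), (ξ : ℂ) ^ k * oscFactor (-(5 * σ ^ 8)) ξ * w ξ) +
      (oscIntegral w k (-(5 * σ ^ 8)) R - oscIntegral w k (-(5 * σ ^ 8)) (2 * σ ^ 2)) := by
    rw [H.integral_add_adjacent k _ le_rfl (by positivity) (by linarith),
      H.integral_add_adjacent k _ le_rfl (by linarith) (by positivity),
      H.integral_add_adjacent k _ le_rfl (by positivity) (by positivity), ← oscIntegral]
    ring
  have tri : ∀ z₁ z₂ z₃ z₄ z₅ : ℂ,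
      ‖z₁ + z₂ + z₃ + z₄ + z₅‖ ≤ ‖z₁‖ + ‖z₂‖ + ‖z₃‖ + ‖z₄‖ + ‖z₅‖ := fun z₁ z₂ z₃ z₄ z₅ =>
    (norm_add_le _ _).trans (add_le_add_left ((norm_add_le _ _).trans
      (add_le_add_left norm_add₃_le _)) _)
  rw [e]
  refine (tri _ _ _ _ _).trans ((add_le_add (add_le_add (add_le_add (add_le_add h1 h2) h3) h4)
    h5).trans ?_)
  set T := (2 * σ ^ 2) ^ k / σ ^ 3 with hT
  have hT0 : 0 < T := by positivity
  have h6 : T ≤ 8 * (σ ^ (2 * k) / σ ^ 3) := by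
    rw [hT, ← mul_div_assoc, mul_pow, ← pow_mul]
    gcongr
    calc (2 : ℝ) ^ k ≤ 2 ^ 3 := pow_le_pow_right₀ (by norm_num) hk
      _ = 8 := by norm_num
  have e1 : A * (2 * σ ^ 2) ^ k * (τ / 2 - 0) = A * T / 2 := by rw [hT, hτ]; ring
  have e2 : A * (2 * σ ^ 2) ^ k * (σ ^ 2 + τ / 2 - (σ ^ 2 - τ / 2)) = A * T := by
    rw [hT, hτ]; ring
  have e3 : 4 * A * ((2 * σ ^ 2) ^ k / (2 * σ ^ 2) ^ 4) ≤ A * T / 4 := by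
    have : (2 * σ ^ 2) ^ k / (2 * σ ^ 2) ^ 4 ≤ T / 16 := by
      have : σ ^ 3 ≤ (σ ^ 2) ^ 4 := by
        rw [← pow_mul]; exact pow_le_pow_right₀ hσ (by norm_num)
      rw [hT, div_div, mul_pow 2 (σ ^ 2) 4, mul_comm (σ ^ 3)]
      gcongr
      norm_num
    nlinarith
  have hAT : 0 < A * T := by positivity
  calc _ ≤ A * T / 2 + 30 * A * T + A * T + 30 * A * T + A * T / 4 := by
        rw [e1, e2]; gcongr
    _ ≤ 62 * A * T := by nlinarith
    _ ≤ 62 * A * (8 * (σ ^ (2 * k) / σ ^ 3)) := by gcongr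
    _ = _ := by ring

/-- A crude bound, uniform in the truncation. -/
theorem norm_oscIntegral_le (H : HalfLineProfile A w h) (x : ℝ) {R : ℝ} (hR : 0 ≤ R) :
    ‖oscIntegral w 0 x R‖ ≤ 6 * A * (1 + |x|) := by
  have hA := H.one_le
  set M := 1 + |x| with hMdef
  have hM : 1 ≤ M := by have := abs_nonneg x; linarith
  have hx : |x| ≤ 5 * M ^ 4 := by
    have : M ≤ M ^ 4 := le_self_pow₀ hM (by norm_num)
    linarith
  have h1 : ∀ R', 0 ≤ R' → R' ≤ 2 * M → ‖oscIntegral w 0 x R'‖ ≤ A * (2 * M) := fun R' h0 h1 => by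
    refine (H.norm_integral_le 0 x le_rfl h0 le_rfl).trans ?_
    rw [pow_zero, mul_one, sub_zero]
    gcongr
  rcases le_total R (2 * M) with h2 | h2
  · refine (h1 R hR h2).trans ?_
    nlinarith
  · have h3 := H.norm_oscIntegral_sub_le (k := 0) (by norm_num) hM hx le_rfl h2
    have h4 := h1 (2 * M) (by linarith) le_rfl
    have h5 : (2 * M) ^ 0 / (2 * M) ^ 4 ≤ 1 := by
      refine (pow_div_pow_four_le (by norm_num) (by linarith)).trans ?_
      rw [div_le_one (by linarith)]; linarith
    have h6 : ‖oscIntegral w 0 x R‖ ≤ ‖oscIntegral w 0 x R - oscIntegral w 0 x (2 * M)‖ +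
        ‖oscIntegral w 0 x (2 * M)‖ := by
      simpa using norm_add_le (oscIntegral w 0 x R - oscIntegral w 0 x (2 * M))
        (oscIntegral w 0 x (2 * M))
    nlinarith

end HalfLineProfile

/-- The improper integral `∫₀^∞ ξᵏ exp (i (x ξ + ξ⁵)) w(ξ) dξ`, as the limit of its truncations.
The limit exists for a profile `w` and `k ≤ 3`, see `HalfLineProfile.tendsto_oscIntegral`. -/
noncomputable def oscLimit (w : ℝ → ℂ) (k : ℕ) (x : ℝ) : ℂ :=
  limUnder atTop fun R : ℝ => oscIntegral w k x R

namespace HalfLineProfile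

variable {A : ℝ} {w h : ℝ → ℂ}

theorem tendsto_oscIntegral (H : HalfLineProfile A w h) {k : ℕ} (hk : k ≤ 3) (x : ℝ) :
    Tendsto (fun R => oscIntegral w k x R) atTop (𝓝 (oscLimit w k x)) := by
  refine CauchySeq.tendsto_limUnder (Metric.cauchySeq_iff'.2 fun ε hε => ?_)
  have hA := H.one_le
  set M := 1 + |x| with hMdef
  have hM : 1 ≤ M := by have := abs_nonneg x; linarith
  have hx : |x| ≤ 5 * M ^ 4 := by
    have : M ≤ M ^ 4 := le_self_pow₀ hM (by norm_num)
    linarith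
  refine ⟨max (2 * M) (8 * A / ε), fun R hR => ?_⟩
  set N := max (2 * M) (8 * A / ε)
  have hN : 2 * M ≤ N := le_max_left _ _
  have hN' : 8 * A / ε ≤ N := le_max_right _ _
  have hN0 : 0 < N := by linarith
  rw [dist_eq_norm]
  refine (H.norm_oscIntegral_sub_le hk hM hx hN hR).trans_lt ?_
  refine (mul_le_mul_of_nonneg_left (pow_div_pow_four_le hk (by linarith))
    (by linarith : 0 ≤ 4 * A)).trans_lt ?_
  rw [div_le_iff₀ hε] at hN'
  rw [mul_one_div, div_lt_iff₀ hN0]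
  linarith

theorem norm_oscLimit_sub_le (H : HalfLineProfile A w h) {k : ℕ} (hk : k ≤ 3) {x M a : ℝ}
    (hM : 1 ≤ M) (hx : |x| ≤ 5 * M ^ 4) (ha : 2 * M ≤ a) :
    ‖oscLimit w k x - oscIntegral w k x a‖ ≤ 4 * A / a := by
  refine le_of_tendsto ((H.tendsto_oscIntegral hk x).sub_const _).norm ?_
  filter_upwards [eventually_ge_atTop a] with b hb
  refine (H.norm_oscIntegral_sub_le hk hM hx ha hb).trans ?_
  have := H.one_le
  exact (mul_le_mul_of_nonneg_left (pow_div_pow_four_le hk (by linarith))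
    (by linarith)).trans_eq (mul_one_div _ _)

theorem tendstoUniformlyOn_oscIntegral (H : HalfLineProfile A w h) {k : ℕ} (hk : k ≤ 3) (r : ℝ) :
    TendstoUniformlyOn (fun R x => oscIntegral w k x R) (oscLimit w k) atTop (Metric.ball 0 r) := by
  have hA := H.one_le
  rw [Metric.tendstoUniformlyOn_iff]
  intro ε hε
  set M := 1 + |r| with hMdef
  have hM : 1 ≤ M := by have := abs_nonneg r; linarith
  filter_upwards [eventually_ge_atTop (2 * M), eventually_gt_atTop (4 * A / ε)] with R h1 h2 x hx
  have hx' : |x| ≤ 5 * M ^ 4 := by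
    have : M ≤ M ^ 4 := le_self_pow₀ hM (by norm_num)
    have h3 : |x| < r := by simpa using hx
    have := le_abs_self r
    linarith
  rw [dist_eq_norm]
  refine (H.norm_oscLimit_sub_le hk hM hx' h1).trans_lt ?_
  rw [div_lt_iff₀ hε] at h2
  rw [div_lt_iff₀ (by linarith)]
  linarith

theorem hasDerivAt_oscIntegral (H : HalfLineProfile A w h) (k : ℕ) {R : ℝ} (hR : 0 ≤ R) (x : ℝ) :
    HasDerivAt (fun x => oscIntegral w k x R) (Complex.I * oscIntegral w (k + 1) x R) x := by
  have hint : ∀ j y, IntervalIntegrable (fun ξ : ℝ => (ξ : ℂ) ^ j * oscFactor y ξ * w ξ)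
      volume 0 R := fun j y => H.intervalIntegrable_mul le_rfl hR (continuous_amplitude j y)
  have key := intervalIntegral.hasDerivAt_integral_of_dominated_loc_of_deriv_le (𝕜 := ℝ)
    (μ := volume) (a := 0) (b := R)
    (F := fun y ξ => (ξ : ℂ) ^ k * oscFactor y ξ * w ξ)
    (F' := fun y ξ => Complex.I * ((ξ : ℂ) ^ (k + 1) * oscFactor y ξ * w ξ))
    (bound := fun _ => A * R ^ (k + 1)) (x₀ := x) (s := Set.univ) Filter.univ_mem
    (Eventually.of_forall fun y => (hint k y).aestronglyMeasurable_restrict_uIoc)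
    (hint k x) ((hint (k + 1) x).const_mul _).aestronglyMeasurable_restrict_uIoc
    (ae_of_all _ fun ξ hξ y _ => ?_) intervalIntegrable_const
    (ae_of_all _ fun ξ hξ y _ => ?_)
  · have := key.2
    rwa [intervalIntegral.integral_const_mul] at this
  · rw [Set.uIoc_of_le hR] at hξ
    rw [norm_mul, Complex.norm_I, one_mul, norm_mul, norm_mul, norm_oscFactor, mul_one, norm_pow,
      Complex.norm_real, Real.norm_of_nonneg hξ.1.le, mul_comm]
    have := H.norm_le ξ hξ.1
    have := H.one_le
    have := hξ.1.le
    have := hξ.2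
    gcongr
  · have h1 : HasDerivAt (fun y : ℝ => y * ξ + ξ ^ 5) ξ y := by
      simpa using! ((hasDerivAt_id y).mul_const ξ).add_const (ξ ^ 5)
    have h2 : HasDerivAt (fun y => oscFactor y ξ) (oscFactor y ξ * (Complex.I * (ξ : ℂ))) y :=
      (h1.ofReal_comp.const_mul Complex.I).cexp
    refine ((h2.const_mul ((ξ : ℂ) ^ k)).mul_const (w ξ)).congr_deriv ?_
    ring

theorem hasDerivAt_oscLimit (H : HalfLineProfile A w h) {k : ℕ} (hk : k < 3) (x : ℝ) :
    HasDerivAt (oscLimit w k) (Complex.I * oscLimit w (k + 1) x) x := by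
  have hx : x ∈ Metric.ball (0 : ℝ) (|x| + 1) := by simp
  refine hasDerivAt_of_tendstoUniformlyOn (g' := fun x => Complex.I * oscLimit w (k + 1) x)
    (f := fun R x => oscIntegral w k x R) (f' := fun R x => Complex.I * oscIntegral w (k + 1) x R)
    (l := atTop) Metric.isOpen_ball ?_ ?_ (fun y _ => H.tendsto_oscIntegral hk.le y) hx
  · have h1 := H.tendstoUniformlyOn_oscIntegral (k := k + 1) hk (|x| + 1)
    rw [Metric.tendstoUniformlyOn_iff] at h1 ⊢
    intro ε hε
    filter_upwards [h1 ε hε] with R hR y hy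
    have := hR y hy
    rwa [dist_eq_norm, ← mul_sub, norm_mul, Complex.norm_I, one_mul, ← dist_eq_norm]
  · filter_upwards [eventually_ge_atTop 0] with R hR y _
    exact H.hasDerivAt_oscIntegral k hR y

theorem continuous_oscLimit (H : HalfLineProfile A w h) {k : ℕ} (hk : k ≤ 3) :
    Continuous (oscLimit w k) := by
  rw [continuous_iff_continuousAt]
  intro x
  have hx : Metric.ball (0 : ℝ) (|x| + 1) ∈ 𝓝 x := Metric.isOpen_ball.mem_nhds (by simp)
  refine ((H.tendstoUniformlyOn_oscIntegral hk (|x| + 1)).continuousOn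
    (Eventually.frequently ?_)).continuousAt hx
  filter_upwards [eventually_ge_atTop 0] with R hR
  exact fun y _ => (H.hasDerivAt_oscIntegral k hR y).continuousAt.continuousWithinAt

theorem norm_oscLimit_le_of_forall (H : HalfLineProfile A w h) {k : ℕ} (hk : k ≤ 3) {x R₀ B : ℝ}
    (hB : ∀ R, R₀ ≤ R → ‖oscIntegral w k x R‖ ≤ B) : ‖oscLimit w k x‖ ≤ B :=
  le_of_tendsto (H.tendsto_oscIntegral hk x).norm
    ((eventually_ge_atTop R₀).mono hB)

end HalfLineProfile

/-! ### Decay in the scaling-invariant variable -/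

theorem rpow_mul_le_of_comparable {B J e : ℝ} (hB : 0 < B) (h1 : B ≤ J) (h2 : J ≤ 10 * B)
    (he : e ≤ 1) : J ^ e ≤ 10 * B ^ e := by
  have e1 : J = (J / B) * B := by field_simp
  have h3 : 1 ≤ J / B := (one_le_div hB).2 h1
  have h4 : J / B ≤ 10 := (div_le_iff₀ hB).2 h2
  rw [e1, Real.mul_rpow (by linarith) hB.le]
  gcongr
  calc (J / B) ^ e ≤ (J / B) ^ (1 : ℝ) := Real.rpow_le_rpow_of_exponent_le h3 he
    _ ≤ 10 := by rwa [Real.rpow_one]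

namespace HalfLineProfile

variable {A : ℝ} {w h : ℝ → ℂ}

theorem oscLimit_elliptic_large (H : HalfLineProfile A w h) {k : ℕ} (hk : k ≤ 3) {y : ℝ}
    (hy : 5 ≤ y) :
    Real.sqrt (y ^ 2 + 1) ^ (1 - (k : ℝ) / 4) * ‖oscLimit w k y‖ ≤
      4080 * A * Real.log (Real.sqrt (y ^ 2 + 1)) := by
  have hA := H.one_le
  set J := Real.sqrt (y ^ 2 + 1) with hJ
  set ρ := (y / 5) ^ (1 / 4 : ℝ) with hρdef
  have hy5 : 1 ≤ y / 5 := by linarith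
  have hρ : 1 ≤ ρ := Real.one_le_rpow hy5 (by norm_num)
  have hρ0 : 0 < ρ := by linarith
  have hρ4 : ρ ^ 4 = y / 5 := by
    rw [hρdef, ← Real.rpow_mul_natCast (by linarith)]; norm_num
  have hyρ : y = 5 * ρ ^ 4 := by rw [hρ4]; ring
  have hyJ : y ≤ J := Real.le_sqrt_of_sq_le (by linarith)
  have hJy : J ≤ 2 * y := Real.sqrt_le_iff.2 ⟨by linarith, by nlinarith⟩
  have hV : ‖oscLimit w k y‖ ≤ 136 * A * (ρ ^ k / ρ ^ 4) * (1 + Real.log (2 * ρ ^ 5)) := by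
    rw [hyρ]
    exact H.norm_oscLimit_le_of_forall hk fun R hR => H.norm_oscIntegral_elliptic_le hk hρ hR
  have hJe : J ^ (1 - (k : ℝ) / 4) ≤ 10 * (ρ ^ 4 / ρ ^ k) := by
    have h1 := rpow_mul_le_of_comparable (B := ρ ^ 4) (J := J) (e := 1 - (k : ℝ) / 4)
      (by positivity) (by linarith) (by linarith) (by have : (0:ℝ) ≤ k := by positivity
                                                      linarith)
    have h2 : (ρ ^ 4) ^ (1 - (k : ℝ) / 4) = ρ ^ 4 / ρ ^ k := by
      rw [← Real.rpow_natCast_mul hρ0.le, ← Real.rpow_natCast, ← Real.rpow_natCast,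
        ← Real.rpow_sub hρ0]
      congr 1; push_cast; ring
    rwa [h2] at h1
  have hJ5 : 5 ≤ J := hy.trans hyJ
  have hlogJ : 1 ≤ Real.log J := by
    rw [Real.le_log_iff_exp_le (by linarith)]
    have := Real.exp_one_lt_d9
    linarith
  have hlog : Real.log (2 * ρ ^ 5) ≤ 2 * Real.log J := by
    rw [← Real.log_rpow (by linarith)]
    refine Real.log_le_log (by positivity) ?_
    rw [Real.rpow_two]
    have h1 : ρ ^ 5 ≤ ρ ^ 8 := pow_le_pow_right₀ hρ (by norm_num)
    have h2 : (5 * ρ ^ 4) ^ 2 ≤ J ^ 2 := pow_le_pow_left₀ (by positivity) (by linarith) 2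
    nlinarith [pow_pos hρ0 8]
  calc J ^ (1 - (k : ℝ) / 4) * ‖oscLimit w k y‖
      ≤ (10 * (ρ ^ 4 / ρ ^ k)) *
        (136 * A * (ρ ^ k / ρ ^ 4) * (1 + Real.log (2 * ρ ^ 5))) := by
        have : 0 ≤ J := by linarith
        gcongr
    _ = 1360 * A * (1 + Real.log (2 * ρ ^ 5)) := by field_simp; ring
    _ ≤ 1360 * A * (3 * Real.log J) := by gcongr; linarith
    _ = _ := by ring

theorem oscLimit_hyperbolic_large (H : HalfLineProfile A w h) {k : ℕ} (hk : k ≤ 3) {y : ℝ}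
    (hy : y ≤ -5) :
    Real.sqrt (y ^ 2 + 1) ^ (3 / 8 - (k : ℝ) / 4) * ‖oscLimit w k y‖ ≤ 4960 * A := by
  have hA := H.one_le
  set J := Real.sqrt (y ^ 2 + 1) with hJ
  set σ := (-y / 5) ^ (1 / 8 : ℝ) with hσdef
  have hy5 : 1 ≤ -y / 5 := by linarith
  have hσ : 1 ≤ σ := Real.one_le_rpow hy5 (by norm_num)
  have hσ0 : 0 < σ := by linarith
  have hσ8 : σ ^ 8 = -y / 5 := by
    rw [hσdef, ← Real.rpow_mul_natCast (by linarith)]; norm_num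
  have hyσ : y = -(5 * σ ^ 8) := by rw [hσ8]; ring
  have hyJ : -y ≤ J := Real.le_sqrt_of_sq_le (by linarith [neg_sq y])
  have hJy : J ≤ 2 * (-y) := Real.sqrt_le_iff.2 ⟨by linarith, by nlinarith⟩
  have hV : ‖oscLimit w k y‖ ≤ 496 * A * (σ ^ (2 * k) / σ ^ 3) := by
    rw [hyσ]
    exact H.norm_oscLimit_le_of_forall hk fun R hR => H.norm_oscIntegral_hyperbolic_le hk hσ hR
  have hJe : J ^ (3 / 8 - (k : ℝ) / 4) ≤ 10 * (σ ^ 3 / σ ^ (2 * k)) := by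
    have h1 := rpow_mul_le_of_comparable (B := σ ^ 8) (J := J) (e := 3 / 8 - (k : ℝ) / 4)
      (by positivity) (by linarith) (by linarith) (by have : (0:ℝ) ≤ k := by positivity
                                                      linarith)
    have h2 : (σ ^ 8) ^ (3 / 8 - (k : ℝ) / 4) = σ ^ 3 / σ ^ (2 * k) := by
      rw [← Real.rpow_natCast_mul hσ0.le, ← Real.rpow_natCast, ← Real.rpow_natCast,
        ← Real.rpow_sub hσ0]
      congr 1; push_cast; ring
    rwa [h2] at h1
  calc J ^ (3 / 8 - (k : ℝ) / 4) * ‖oscLimit w k y‖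
      ≤ (10 * (σ ^ 3 / σ ^ (2 * k))) * (496 * A * (σ ^ (2 * k) / σ ^ 3)) := by
        have : 0 ≤ J := by linarith
        gcongr
    _ = _ := by field_simp; norm_num

theorem norm_oscLimit_central_le (H : HalfLineProfile A w h) {k : ℕ} (hk : k ≤ 3) {y : ℝ}
    (hy : |y| ≤ 5) : ‖oscLimit w k y‖ ≤ 18 * A :=
  H.norm_oscLimit_le_of_forall hk fun _ hR => H.norm_oscIntegral_central_le hk hy hR

theorem rpow_bracket_le {y e : ℝ} (hy : |y| ≤ 5) (he : e ≤ 1) : Real.sqrt (y ^ 2 + 1) ^ e ≤ 6 := by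
  have h1 : 1 ≤ Real.sqrt (y ^ 2 + 1) := Real.one_le_sqrt.2 (by nlinarith)
  have h2 : Real.sqrt (y ^ 2 + 1) ≤ 6 :=
    Real.sqrt_le_iff.2 ⟨by norm_num, by nlinarith [sq_abs y, abs_nonneg y]⟩
  calc Real.sqrt (y ^ 2 + 1) ^ e ≤ Real.sqrt (y ^ 2 + 1) ^ (1 : ℝ) :=
        Real.rpow_le_rpow_of_exponent_le h1 he
    _ ≤ 6 := by rwa [Real.rpow_one]

/-- The pointwise decay on the whole line. -/
theorem oscLimit_decay (H : HalfLineProfile A w h) {k : ℕ} (hk : k ≤ 3) (y : ℝ) :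
    Real.sqrt (y ^ 2 + 1) ^ (3 / 8 - (k : ℝ) / 4) * ‖oscLimit w k y‖ ≤ 6528 * A := by
  have hA := H.one_le
  have hk0 : (0 : ℝ) ≤ k := by positivity
  rcases le_total y (-5) with h1 | h1
  · exact (H.oscLimit_hyperbolic_large hk h1).trans (by linarith)
  rcases le_total 5 y with h2 | h2
  · have h3 := H.oscLimit_elliptic_large hk h2
    set J := Real.sqrt (y ^ 2 + 1) with hJ
    have hJ0 : 0 < J := Real.sqrt_pos.2 (by positivity)
    have e : (3 / 8 - (k : ℝ) / 4) = (1 - (k : ℝ) / 4) + (-(5 / 8)) := by ring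
    have h4 : Real.log J ≤ J ^ (5 / 8 : ℝ) / (5 / 8) := Real.log_le_rpow_div hJ0.le (by norm_num)
    have h5 : J ^ (-(5 / 8) : ℝ) * J ^ (5 / 8 : ℝ) = 1 := by
      rw [← Real.rpow_add hJ0]; norm_num
    have h6 : 0 < J ^ (-(5 / 8) : ℝ) := Real.rpow_pos_of_pos hJ0 _
    rw [e, Real.rpow_add hJ0]
    calc J ^ (1 - (k : ℝ) / 4) * J ^ (-(5 / 8) : ℝ) * ‖oscLimit w k y‖
        = J ^ (-(5 / 8) : ℝ) * (J ^ (1 - (k : ℝ) / 4) * ‖oscLimit w k y‖) := by ring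
      _ ≤ J ^ (-(5 / 8) : ℝ) * (4080 * A * (J ^ (5 / 8 : ℝ) / (5 / 8))) := by
          refine mul_le_mul_of_nonneg_left (h3.trans ?_) h6.le
          gcongr
      _ = 6528 * A * (J ^ (-(5 / 8) : ℝ) * J ^ (5 / 8 : ℝ)) := by ring
      _ = _ := by rw [h5, mul_one]
  · have h3 : |y| ≤ 5 := abs_le.2 ⟨h1, h2⟩
    calc _ ≤ 6 * (18 * A) := by
          have := rpow_bracket_le h3 (e := 3 / 8 - (k : ℝ) / 4) (by linarith)
          have := H.norm_oscLimit_central_le hk h3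
          gcongr
      _ ≤ _ := by linarith

/-- The logarithmic improvement in the elliptic region. -/
theorem oscLimit_elliptic (H : HalfLineProfile A w h) {k : ℕ} (hk : k ≤ 3) {c y : ℝ} (hc : 0 < c)
    (hy : c ≤ y) :
    Real.sqrt (y ^ 2 + 1) ^ (1 - (k : ℝ) / 4) * ‖oscLimit w k y‖ ≤
      (4080 + 108 / Real.log (Real.sqrt (c ^ 2 + 1))) * A *
        Real.log (Real.sqrt (y ^ 2 + 1)) := by
  have hA := H.one_le
  have hk0 : (0 : ℝ) ≤ k := by positivity
  have hc1 : 1 < Real.sqrt (c ^ 2 + 1) := Real.lt_sqrt_of_sq_lt (by nlinarith)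
  have hlc : 0 < Real.log (Real.sqrt (c ^ 2 + 1)) := Real.log_pos hc1
  have hle : Real.log (Real.sqrt (c ^ 2 + 1)) ≤ Real.log (Real.sqrt (y ^ 2 + 1)) := by
    refine Real.log_le_log (by linarith) (Real.sqrt_le_sqrt ?_)
    gcongr
  rcases le_total 5 y with h2 | h2
  · refine (H.oscLimit_elliptic_large hk h2).trans ?_
    have : 0 ≤ 108 / Real.log (Real.sqrt (c ^ 2 + 1)) := by positivity
    have := hlc.le.trans hle
    gcongr
    linarith
  · have h3 : |y| ≤ 5 := abs_le.2 ⟨by linarith, h2⟩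
    calc _ ≤ 6 * (18 * A) := by
          have := rpow_bracket_le h3 (e := 1 - (k : ℝ) / 4) (by linarith)
          have := H.norm_oscLimit_central_le hk h3
          gcongr
      _ = 108 / Real.log (Real.sqrt (c ^ 2 + 1)) * A * Real.log (Real.sqrt (c ^ 2 + 1)) := by
          field_simp; norm_num
      _ ≤ _ := by gcongr; linarith

end HalfLineProfile

/-! ### Functionals on test functions of the half-line -/

theorem exists_tsupport_subset_Ioo {χ : ℝ → ℂ} (hc : HasCompactSupport χ)
    (hs : tsupport χ ⊆ Set.Ioi 0) : ∃ α β : ℝ, 0 < α ∧ α ≤ β ∧ tsupport χ ⊆ Set.Ioo α β := by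
  have hc' : IsCompact (tsupport χ) := hc
  rcases (tsupport χ).eq_empty_or_nonempty with h0 | hne
  · exact ⟨1, 1, one_pos, le_rfl, by simp [h0]⟩
  obtain ⟨a, ha, ha'⟩ := hc'.exists_isLeast hne
  obtain ⟨b, hb, hb'⟩ := hc'.exists_isGreatest hne
  have h1 : 0 < a := hs ha
  have h2 := ha' hb
  exact ⟨a / 2, b + 1, by linarith, by linarith, fun x hx =>
    ⟨by linarith [ha' hx], by linarith [hb' hx]⟩⟩

theorem integral_mul_eq_intervalIntegral {χ g : ℝ → ℂ} {α β : ℝ}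
    (hs : tsupport χ ⊆ Set.Ioo α β) : ∫ ξ, χ ξ * g ξ = ∫ ξ in α..β, χ ξ * g ξ := by
  refine (intervalIntegral.integral_eq_integral_of_support_subset fun ξ hξ => ?_).symm
  exact Set.Ioo_subset_Ioc_self (hs (subset_tsupport _ (left_ne_zero_of_mul hξ)))

/-- Integration by parts on the half-line against a test function. -/
theorem integral_deriv_mul_primitive_eq_neg {w h : ℝ → ℂ}
    (hh : ∀ a b, 0 < a → 0 < b → IntervalIntegrable h volume a b)
    (hw : ∀ a b, 0 < a → 0 < b → w b - w a = ∫ ξ in a..b, h ξ) {η : ℝ → ℂ} (hη : ContDiff ℝ ∞ η)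
    (hc : HasCompactSupport η) (hs : tsupport η ⊆ Set.Ioi 0) :
    ∫ ξ, deriv η ξ * w ξ = -∫ ξ, η ξ * h ξ := by
  obtain ⟨α, β, hα, hαβ, hsub⟩ := exists_tsupport_subset_Ioo hc hs
  have hsub' : tsupport (deriv η) ⊆ Set.Ioo α β :=
    (closure_minimal (support_deriv_subset) (isClosed_tsupport η)).trans hsub
  have hβ : 0 < β := hα.trans_le hαβ
  rw [integral_mul_eq_intervalIntegral hsub', integral_mul_eq_intervalIntegral hsub]
  have h0 : ∀ x, x ∉ Set.Ioo α β → η x = 0 := fun x hx =>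
    image_eq_zero_of_notMem_tsupport fun hx' => hx (hsub hx')
  rw [integral_deriv_mul_primitive hαβ (E := η)
    (fun ξ _ => (hη.differentiable (by simp)).differentiableAt.hasDerivAt)
    (hη.continuous_deriv (by simp)).continuousOn (hh α β hα hβ)
    (fun ξ hξ => hw α ξ hα (hα.trans_le hξ.1)), h0 α (by simp), h0 β (by simp)]
  ring

/-- Two test functions on the half-line with the same integral differ by the derivative of a
test function. -/
theorem exists_deriv_eq_of_integral_eq_zero {g : ℝ → ℂ} (hg : ContDiff ℝ ∞ g)
    (hc : HasCompactSupport g) (hs : tsupport g ⊆ Set.Ioi 0) (h0 : ∫ ξ, g ξ = 0) :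
    ∃ η : ℝ → ℂ, ContDiff ℝ ∞ η ∧ HasCompactSupport η ∧ tsupport η ⊆ Set.Ioi 0 ∧
      deriv η = g := by
  obtain ⟨α, β, hα, hαβ, hsub⟩ := exists_tsupport_subset_Ioo hc hs
  have hd : ∀ x, HasDerivAt (fun x => ∫ ξ in α..x, g ξ) (g x) x := fun x =>
    intervalIntegral.integral_hasDerivAt_right (hg.continuous.intervalIntegrable _ _)
      (hg.continuous.stronglyMeasurableAtFilter _ _) hg.continuous.continuousAt
  have hderiv : deriv (fun x => ∫ ξ in α..x, g ξ) = g := funext fun x => (hd x).deriv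
  have hg0 : ∀ x, x ∉ Set.Ioo α β → g x = 0 := fun x hx =>
    image_eq_zero_of_notMem_tsupport fun hx' => hx (hsub hx')
  have hαβ0 : ∫ ξ in α..β, g ξ = 0 := by
    rw [intervalIntegral.integral_eq_integral_of_support_subset, h0]
    exact fun ξ hξ => Set.Ioo_subset_Ioc_self (hsub (subset_tsupport _ hξ))
  have hts : tsupport (fun x => ∫ ξ in α..x, g ξ) ⊆ Set.Icc α β := by
    refine closure_minimal (fun x hx => ?_) isClosed_Icc
    by_contra hx'
    refine hx ?_
    rw [Set.mem_Icc, not_and_or, not_le, not_le] at hx'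
    rcases hx' with h1 | h1
    · refine (intervalIntegral.integral_congr fun ξ hξ => hg0 ξ ?_).trans
        intervalIntegral.integral_zero
      rw [Set.uIcc_of_ge h1.le] at hξ
      exact fun H => absurd H.1 (not_lt.2 hξ.2)
    · simp only
      rw [← intervalIntegral.integral_add_adjacent_intervals
        (hg.continuous.intervalIntegrable α β) (hg.continuous.intervalIntegrable β x), hαβ0,
        zero_add]
      refine (intervalIntegral.integral_congr fun ξ hξ => hg0 ξ ?_).trans
        intervalIntegral.integral_zero
      rw [Set.uIcc_of_le h1.le] at hξ
      exact fun H => absurd H.2 (not_lt.2 hξ.1)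
  refine ⟨fun x => ∫ ξ in α..x, g ξ, ?_, ?_, ?_, hderiv⟩
  · rw [contDiff_infty_iff_deriv, hderiv]
    exact ⟨fun x => (hd x).differentiableAt, hg⟩
  · exact isCompact_Icc.of_isClosed_subset (isClosed_tsupport _) hts
  · exact hts.trans fun x hx => hα.trans_le hx.1

/-- A real bump function on `(r, 2r)` with values in `[0, 1]` and integral at least `r / 2`. -/
theorem exists_bump {r : ℝ} (hr : 0 < r) : ∃ χ : ℝ → ℝ, ContDiff ℝ ∞ χ ∧ HasCompactSupport χ ∧
    tsupport χ ⊆ Set.Ioo r (2 * r) ∧ (∀ x, 0 ≤ χ x) ∧ (∀ x, χ x ≤ 1) ∧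
    r / 2 ≤ ∫ x, χ x := by
  let f : ContDiffBump (3 / 2 * r) := ⟨r / 4, 3 / 8 * r, by positivity, by linarith⟩
  have hts : tsupport f ⊆ Set.Ioo r (2 * r) := by
    rw [f.tsupport_eq, Real.closedBall_eq_Icc]
    intro x hx
    change x ∈ Set.Icc (3 / 2 * r - 3 / 8 * r) (3 / 2 * r + 3 / 8 * r) at hx
    exact ⟨by linarith [hx.1], by linarith [hx.2]⟩
  have hint : Integrable f := f.integrable
  refine ⟨f, f.contDiff, f.hasCompactSupport, hts, fun x => f.nonneg, fun x => f.le_one, ?_⟩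
  have h1 : ∫ x in Metric.closedBall (3 / 2 * r) (r / 4), f x = r / 2 := by
    rw [setIntegral_congr_fun (g := fun _ => (1 : ℝ)) Metric.isClosed_closedBall.measurableSet
      (fun x hx => f.one_of_mem_closedBall hx)]
    have : volume.real (Metric.closedBall (3 / 2 * r) (r / 4)) = 2 * (r / 4) :=
      Real.volume_real_closedBall (by positivity)
    rw [setIntegral_const, this, smul_eq_mul]
    ring
  rw [← h1]
  exact setIntegral_le_integral hint (ae_of_all _ fun x => f.nonneg)

/-- A functional on test functions of the half-line whose derivative is a function `h` is a
function `w`, a primitive of `h`. -/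
theorem exists_primitive_of_deriv_eq (Λ : 𝓢(ℝ, ℂ) →ₗ[ℂ] ℂ) {h : ℝ → ℂ}
    (hh : ∀ a b, 0 < a → 0 < b → IntervalIntegrable h volume a b)
    (hΛ : ∀ η : 𝓢(ℝ, ℂ), HasCompactSupport η → tsupport η ⊆ Set.Ioi 0 →
      Λ (SchwartzMap.derivCLM ℂ ℂ η) = -∫ ξ, η ξ * h ξ) :
    ∃ w : ℝ → ℂ, (∀ a b, 0 < a → 0 < b → w b - w a = ∫ ξ in a..b, h ξ) ∧
      ∀ χ : 𝓢(ℝ, ℂ), HasCompactSupport χ → tsupport χ ⊆ Set.Ioi 0 → Λ χ = ∫ ξ, χ ξ * w ξ := by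
  obtain ⟨b, hb, hbc, hbs, -, -, hb1⟩ := exists_bump (r := 1) one_pos
  have hi : ∫ x, b x ≠ 0 := by intro h; rw [h] at hb1; linarith
  -- `χ₀` is a test function of integral one
  set f₀ : ℝ → ℂ := fun x => ((∫ x, b x)⁻¹ * b x : ℝ) with hf₀
  have hf₀c : HasCompactSupport f₀ := (hbc.mul_left (f := fun _ => (∫ x, b x)⁻¹)).comp_left
    (g := ((↑) : ℝ → ℂ)) Complex.ofReal_zero
  have hf₀s : ContDiff ℝ ∞ f₀ := Complex.ofRealCLM.contDiff.comp (contDiff_const.mul hb)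
  have hf₀i : ∫ x, f₀ x = 1 := by
    rw [hf₀, integral_complex_ofReal, integral_const_mul, inv_mul_cancel₀ hi, Complex.ofReal_one]
  have hf₀t : tsupport f₀ ⊆ Set.Ioi 0 := by
    refine (closure_mono (fun x hx => ?_) : tsupport f₀ ⊆ tsupport b).trans
      (hbs.trans fun x hx => one_pos.trans hx.1)
    intro h0
    exact hx (by simp [hf₀, h0])
  set χ₀ : 𝓢(ℝ, ℂ) := hf₀c.toSchwartzMap hf₀s
  have hprim : ∀ a b, 0 < a → 0 < b →
      (∫ ξ in (1 : ℝ)..b, h ξ) - (∫ ξ in (1 : ℝ)..a, h ξ) = ∫ ξ in a..b, h ξ := fun a b ha hb =>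
    intervalIntegral.integral_interval_sub_left (hh 1 b one_pos hb) (hh 1 a one_pos ha)
  have hGc : ContinuousOn (fun x => ∫ ξ in (1 : ℝ)..x, h ξ) (Set.Ioi 0) := fun x hx => by
    have hx0 : (0 : ℝ) < x := hx
    have h1 := intervalIntegral.continuousOn_primitive_interval'
      (hh (min 1 x / 2) (max 1 x + 1) (by positivity) (by positivity))
      (a := 1) (by
        rw [Set.uIcc_of_le (by linarith [min_le_left 1 x, le_max_left 1 x])]
        exact ⟨by linarith [min_le_left 1 x], by linarith [le_max_left 1 x]⟩)
    rw [Set.uIcc_of_le (by linarith [min_le_left 1 x, le_max_left 1 x])] at h1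
    refine (h1.continuousAt (Icc_mem_nhds ?_ ?_)).continuousWithinAt
    · linarith [min_le_right 1 x]
    · linarith [le_max_right 1 x]
  have hint : ∀ χ : ℝ → ℂ, Continuous χ → HasCompactSupport χ → tsupport χ ⊆ Set.Ioi 0 →
      Integrable (fun ξ => χ ξ * ∫ y in (1 : ℝ)..ξ, h y) := fun χ h1 h2 h3 => by
    refine Continuous.integrable_of_hasCompactSupport ?_ (h2.mul_right)
    refine continuous_iff_continuousAt.2 fun x => ?_
    rcases lt_or_ge 0 x with hx | hx
    · exact h1.continuousAt.mul (hGc.continuousAt (Ioi_mem_nhds hx))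
    · have : (fun ξ => χ ξ * ∫ y in (1 : ℝ)..ξ, h y) =ᶠ[𝓝 x] fun _ => 0 := by
        filter_upwards [(isClosed_tsupport χ).isOpen_compl.mem_nhds
          (fun hx' => absurd (h3 hx') (not_lt.2 hx) : x ∉ tsupport χ)] with y hy
        rw [image_eq_zero_of_notMem_tsupport hy, zero_mul]
      exact continuousAt_const.congr this.symm
  refine ⟨fun x => (Λ χ₀ - ∫ ξ, f₀ ξ * ∫ y in (1 : ℝ)..ξ, h y) + ∫ ξ in (1 : ℝ)..x, h ξ,
    fun a b ha hb => by rw [← hprim a b ha hb]; ring, fun χ hχc hχs => ?_⟩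
  set c := ∫ ξ, χ ξ with hc
  have hgs : ContDiff ℝ ∞ (fun x => χ x - c * f₀ x) :=
    (χ.smooth ⊤).sub (contDiff_const.mul hf₀s)
  have hgc : HasCompactSupport (fun x => χ x - c * f₀ x) := hχc.sub hf₀c.mul_left
  have hgt : tsupport (fun x => χ x - c * f₀ x) ⊆ Set.Ioi 0 := by
    refine (closure_minimal (fun x hx => ?_)
      ((isClosed_tsupport χ).union (isClosed_tsupport f₀))).trans (Set.union_subset hχs hf₀t)
    by_contra hx'
    rw [Set.mem_union, not_or] at hx'
    exact hx (by simp [image_eq_zero_of_notMem_tsupport hx'.1,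
      image_eq_zero_of_notMem_tsupport hx'.2])
  have hf₀int : Integrable f₀ := hf₀s.continuous.integrable_of_hasCompactSupport hf₀c
  obtain ⟨η, hη, hηc, hηt, hηd⟩ := exists_deriv_eq_of_integral_eq_zero hgs hgc hgt (by
    rw [integral_sub χ.integrable (hf₀int.const_mul c), integral_const_mul, hf₀i, mul_one,
      ← hc, sub_self])
  have e1 : SchwartzMap.derivCLM ℂ ℂ (hηc.toSchwartzMap hη) = χ - c • χ₀ := by
    ext x
    rw [SchwartzMap.derivCLM_apply]
    change deriv η x = χ x - c * f₀ x
    rw [hηd]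
  have e2 := hΛ (hηc.toSchwartzMap hη) hηc hηt
  rw [e1, map_sub, map_smul, smul_eq_mul] at e2
  have e3 := integral_deriv_mul_primitive_eq_neg hh (fun a b ha hb => (hprim a b ha hb)) hη hηc hηt
  have e4 : ∫ ξ, (hηc.toSchwartzMap hη) ξ * h ξ = ∫ ξ, η ξ * h ξ := rfl
  rw [e4, ← e3, hηd] at e2
  have i1 := hint χ χ.continuous hχc hχs
  have i2 := hint f₀ hf₀s.continuous hf₀c hf₀t
  have e5 : ∫ ξ, (χ ξ - c * f₀ ξ) * ∫ y in (1 : ℝ)..ξ, h y =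
      (∫ ξ, χ ξ * ∫ y in (1 : ℝ)..ξ, h y) - c * ∫ ξ, f₀ ξ * ∫ y in (1 : ℝ)..ξ, h y := by
    rw [← integral_const_mul, ← integral_sub i1 (i2.const_mul c)]
    congr 1; funext ξ; ring
  rw [e5] at e2
  have e6 : ∫ ξ, χ ξ * ((Λ χ₀ - ∫ ξ, f₀ ξ * ∫ y in (1 : ℝ)..ξ, h y) + ∫ y in (1 : ℝ)..ξ, h y) =
      c * (Λ χ₀ - ∫ ξ, f₀ ξ * ∫ y in (1 : ℝ)..ξ, h y) +
        ∫ ξ, χ ξ * ∫ y in (1 : ℝ)..ξ, h y := by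
    rw [hc, ← integral_mul_const, ← integral_add (χ.integrable.mul_const _) i1]
    congr 1; funext ξ; ring
  rw [e6]
  linear_combination e2

/-- If moreover the functional is bounded by `D r ‖χ‖_∞` on test functions of suitable dyadic
intervals `(r, 2r)`, then `w` is bounded: a weighted mean of `w` over each of these intervals is
bounded, and the oscillation of `w` there is at most `∫ |h| ≤ ∫ (ξ |h|² + 1 / ξ) / 2`. -/
theorem exists_halfLineProfile (Λ : 𝓢(ℝ, ℂ) →ₗ[ℂ] ℂ) {h : ℝ → ℂ} {B D : ℝ} (hB : 0 ≤ B)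
    (hD : 0 ≤ D) (hm : AEStronglyMeasurable h volume)
    (hi : IntegrableOn (fun ξ => ξ * ‖h ξ‖ ^ 2) (Set.Ioi 0))
    (hiB : ∫ ξ in Set.Ioi 0, ξ * ‖h ξ‖ ^ 2 ≤ B)
    (hΛ : ∀ η : 𝓢(ℝ, ℂ), HasCompactSupport η → tsupport η ⊆ Set.Ioi 0 →
      Λ (SchwartzMap.derivCLM ℂ ℂ η) = -∫ ξ, η ξ * h ξ)
    (hbd : ∀ x, 0 < x → ∃ r, 0 < r ∧ r ≤ x ∧ x ≤ 2 * r ∧ ∀ χ : 𝓢(ℝ, ℂ), HasCompactSupport χ →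
      tsupport χ ⊆ Set.Ioo r (2 * r) → (∀ ξ, ‖χ ξ‖ ≤ 1) → ‖Λ χ‖ ≤ D * r) :
    ∃ w : ℝ → ℂ, HalfLineProfile (2 * D + 2 * B + 2) w h ∧
      ∀ χ : 𝓢(ℝ, ℂ), HasCompactSupport χ → tsupport χ ⊆ Set.Ioi 0 → Λ χ = ∫ ξ, χ ξ * w ξ := by
  -- the pointwise inequality behind the oscillation bound
  have hpt : ∀ ξ, 0 < ξ → ‖h ξ‖ ≤ (ξ * ‖h ξ‖ ^ 2 + ξ⁻¹) / 2 := fun ξ hξ => by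
    have e : (ξ * ‖h ξ‖ ^ 2 + ξ⁻¹) / 2 - ‖h ξ‖ = (ξ * ‖h ξ‖ - 1) ^ 2 / (2 * ξ) := by
      field_simp; ring
    have : 0 ≤ (ξ * ‖h ξ‖ - 1) ^ 2 / (2 * ξ) := by positivity
    linarith
  have hmaj : ∀ a b, 0 < a → a ≤ b →
      IntegrableOn (fun ξ => (ξ * ‖h ξ‖ ^ 2 + ξ⁻¹) / 2) (Set.Ioc a b) := fun a b ha hab => by
    refine ((hi.mono_set fun ξ hξ => ha.trans hξ.1).add ?_).div_const 2
    have : IntervalIntegrable (fun ξ : ℝ => ξ⁻¹) volume a b := by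
      refine ContinuousOn.intervalIntegrable (continuousOn_inv₀.mono fun ξ hξ => ?_)
      rw [Set.uIcc_of_le hab] at hξ
      exact (ha.trans_le hξ.1).ne'
    exact (intervalIntegrable_iff_integrableOn_Ioc_of_le hab).1 this
  have hloc : ∀ a b, 0 < a → a ≤ b → IntegrableOn h (Set.Ioc a b) := fun a b ha hab => by
    refine (hmaj a b ha hab).mono' hm.restrict ?_
    exact (ae_restrict_iff' measurableSet_Ioc).2 (ae_of_all _ fun ξ hξ => hpt ξ (ha.trans hξ.1))
  have hh : ∀ a b, 0 < a → 0 < b → IntervalIntegrable h volume a b := fun a b ha hb => by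
    rcases le_total a b with hab | hab
    · exact (intervalIntegrable_iff_integrableOn_Ioc_of_le hab).2 (hloc a b ha hab)
    · exact ((intervalIntegrable_iff_integrableOn_Ioc_of_le hab).2 (hloc b a hb hab)).symm
  obtain ⟨w, hw, hΛw⟩ := exists_primitive_of_deriv_eq Λ hh hΛ
  refine ⟨w, ⟨by linarith, fun x hx => ?_, hh, hw, hi, by linarith⟩, hΛw⟩
  obtain ⟨r, hr, hrx, hxr, hχ⟩ := hbd x hx
  have hosc : ∀ ξ ∈ Set.Icc r (2 * r), ‖w ξ - w x‖ ≤ (B + 1) / 2 := fun ξ hξ => by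
    rw [hw x ξ hx (hr.trans_le hξ.1)]
    calc ‖∫ y in x..ξ, h y‖ ≤ ∫ y in Set.uIoc x ξ, ‖h y‖ :=
          intervalIntegral.norm_integral_le_integral_norm_uIoc
      _ ≤ ∫ y in Set.Ioc r (2 * r), ‖h y‖ := by
          refine setIntegral_mono_set (hloc r (2 * r) hr (by linarith)).norm
            (ae_of_all _ fun _ => norm_nonneg _) (LE.le.eventuallyLE ?_)
          exact Set.Ioc_subset_Ioc (le_min hrx hξ.1) (max_le hxr hξ.2)
      _ ≤ ∫ y in Set.Ioc r (2 * r), (y * ‖h y‖ ^ 2 + y⁻¹) / 2 :=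
          setIntegral_mono_on (hloc r (2 * r) hr (by linarith)).norm
            (hmaj r (2 * r) hr (by linarith)) measurableSet_Ioc
            fun y hy => hpt y (hr.trans hy.1)
      _ = ((∫ y in Set.Ioc r (2 * r), y * ‖h y‖ ^ 2) + ∫ y in Set.Ioc r (2 * r), y⁻¹) / 2 := by
          have hinv : IntegrableOn (fun ξ : ℝ => ξ⁻¹) (Set.Ioc r (2 * r)) := by
            refine (ContinuousOn.integrableOn_Icc (continuousOn_inv₀.mono fun ξ hξ => ?_)).mono_set
              Set.Ioc_subset_Icc_self
            exact (hr.trans_le hξ.1).ne'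
          rw [integral_div, integral_add (hi.mono_set fun ξ hξ => hr.trans hξ.1) hinv]
      _ ≤ (B + 1) / 2 := by
          gcongr
          · refine le_trans (setIntegral_mono_set hi ?_ ?_) hiB
            · refine (ae_restrict_iff' measurableSet_Ioi).2 (ae_of_all _ fun ξ hξ => ?_)
              have : (0 : ℝ) < ξ := hξ
              simp only [Pi.zero_apply]; positivity
            · exact LE.le.eventuallyLE fun ξ hξ => hr.trans hξ.1
          · rw [← intervalIntegral.integral_of_le (by linarith),
              integral_inv_of_pos hr (by linarith), mul_div_assoc, div_self hr.ne', mul_one]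
            have := Real.log_two_lt_d9
            linarith
  obtain ⟨b, hb, hbc, hbs, hb0, hb1, hbi⟩ := exists_bump hr
  have hbc' : HasCompactSupport (fun x => (b x : ℂ)) :=
    hbc.comp_left (g := ((↑) : ℝ → ℂ)) Complex.ofReal_zero
  have hbs' : ContDiff ℝ ∞ (fun x => (b x : ℂ)) := Complex.ofRealCLM.contDiff.comp hb
  have hbt' : tsupport (fun x => (b x : ℂ)) ⊆ Set.Ioo r (2 * r) := by
    refine (closure_mono fun x hx => ?_ : _ ⊆ tsupport b).trans hbs
    intro h0
    exact hx (by simp [h0])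
  have k1 := hχ (hbc'.toSchwartzMap hbs') hbc' hbt' fun ξ => by
    change ‖(b ξ : ℂ)‖ ≤ 1
    rw [Complex.norm_real, Real.norm_of_nonneg (hb0 ξ)]; exact hb1 ξ
  rw [hΛw (hbc'.toSchwartzMap hbs') hbc' (hbt'.trans fun y hy => hr.trans hy.1)] at k1
  have k2 : ∫ ξ, (hbc'.toSchwartzMap hbs') ξ * w ξ = ∫ ξ, (b ξ : ℂ) * w ξ := rfl
  rw [k2, integral_mul_eq_intervalIntegral hbt'] at k1
  have hbci : IntervalIntegrable (fun x => (b x : ℂ)) volume r (2 * r) :=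
    hbs'.continuous.intervalIntegrable _ _
  have hwint : IntervalIntegrable (fun ξ => (b ξ : ℂ) * (w ξ - w x)) volume r (2 * r) := by
    refine IntervalIntegrable.continuousOn_mul ?_ hbs'.continuous.continuousOn
    have h1 := intervalIntegral.continuousOn_primitive_interval'
      (hh r (2 * r) hr (by linarith)) (a := x) (by
        rw [Set.uIcc_of_le (by linarith)]; exact ⟨hrx, hxr⟩)
    refine (h1.congr fun ξ hξ => ?_).intervalIntegrable
    rw [Set.uIcc_of_le (by linarith)] at hξ
    exact hw x ξ hx (hr.trans_le hξ.1)
  have hbI : ∫ ξ in r..(2 * r), (b ξ : ℂ) = ((∫ ξ, b ξ : ℝ) : ℂ) := by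
    rw [← integral_complex_ofReal]
    refine intervalIntegral.integral_eq_integral_of_support_subset fun ξ hξ => ?_
    exact Set.Ioo_subset_Ioc_self (hbt' (subset_tsupport _ hξ))
  have k3 : (∫ ξ in r..(2 * r), (b ξ : ℂ) * w ξ) =
      (∫ ξ in r..(2 * r), (b ξ : ℂ) * (w ξ - w x)) + ((∫ ξ, b ξ : ℝ) : ℂ) * w x := by
    rw [← hbI, ← intervalIntegral.integral_mul_const,
      ← intervalIntegral.integral_add hwint (hbci.mul_const _)]
    refine intervalIntegral.integral_congr fun ξ _ => ?_
    ring
  have k4 : ‖∫ ξ in r..(2 * r), (b ξ : ℂ) * (w ξ - w x)‖ ≤ (B + 1) / 2 * r := by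
    have := intervalIntegral.norm_integral_le_of_norm_le_const (a := r) (b := 2 * r)
      (f := fun ξ => (b ξ : ℂ) * (w ξ - w x)) (C := (B + 1) / 2) fun ξ hξ => ?_
    · rwa [abs_of_pos (by linarith), show 2 * r - r = r by ring] at this
    · rw [Set.uIoc_of_le (by linarith)] at hξ
      rw [norm_mul, Complex.norm_real, Real.norm_of_nonneg (hb0 ξ)]
      calc b ξ * ‖w ξ - w x‖ ≤ 1 * ((B + 1) / 2) := by
            have := hosc ξ (Set.Ioc_subset_Icc_self hξ)
            have := hb1 ξ
            gcongr
        _ = _ := one_mul _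
  have k5 : ‖((∫ ξ, b ξ : ℝ) : ℂ) * w x‖ ≤ D * r + (B + 1) / 2 * r := by
    have : ((∫ ξ, b ξ : ℝ) : ℂ) * w x = (∫ ξ in r..(2 * r), (b ξ : ℂ) * w ξ) -
      ∫ ξ in r..(2 * r), (b ξ : ℂ) * (w ξ - w x) := by rw [k3]; ring
    rw [this]
    exact (norm_sub_le _ _).trans (add_le_add k1 k4)
  rw [norm_mul, Complex.norm_real, Real.norm_of_nonneg (by linarith)] at k5
  have k6 : r / 2 * ‖w x‖ ≤ r / 2 * (2 * D + (B + 1)) :=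
    (mul_le_mul_of_nonneg_right hbi (norm_nonneg _)).trans (k5.trans (le_of_eq (by ring)))
  have := le_of_mul_le_mul_left k6 (by positivity)
  linarith

/-! ### The equation on the Fourier side -/

theorem hasTemperateGrowth_cexp_I_mul :
    Function.HasTemperateGrowth (fun x : ℝ => Complex.exp (Complex.I * (x : ℂ))) := by
  have hd : ∀ x : ℝ, HasDerivAt (fun x : ℝ => Complex.exp (Complex.I * (x : ℂ)))
      (Complex.exp (Complex.I * (x : ℂ)) * (Complex.I * 1)) x := fun x =>
    ((hasDerivAt_id x).ofReal_comp.const_mul Complex.I).cexp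
  have hit : ∀ n : ℕ, iteratedDeriv n (fun x : ℝ => Complex.exp (Complex.I * (x : ℂ))) =
      fun x : ℝ => Complex.I ^ n * Complex.exp (Complex.I * (x : ℂ)) := fun n => by
    induction n with
    | zero => simp
    | succ n ih =>
      rw [iteratedDeriv_succ, ih]
      funext x
      rw [((hd x).const_mul (Complex.I ^ n)).deriv]
      ring
  refine ⟨(contDiff_const.mul Complex.ofRealCLM.contDiff).cexp, fun n => ⟨0, 1, fun x => ?_⟩⟩
  rw [norm_iteratedFDeriv_eq_norm_iteratedDeriv, hit]
  simp [mul_comm Complex.I, Complex.norm_exp_ofReal_mul_I]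

/-- `exp (-i t (2πξ)⁵)`, the factor that removes the linear flow on the Fourier side. -/
noncomputable def flowFactor (t ξ : ℝ) : ℂ :=
  Complex.exp (Complex.I * ((-(t * (2 * Real.pi * ξ) ^ 5) : ℝ) : ℂ))

theorem norm_flowFactor (t ξ : ℝ) : ‖flowFactor t ξ‖ = 1 := by
  rw [flowFactor, mul_comm, Complex.norm_exp_ofReal_mul_I]

theorem hasTemperateGrowth_flowFactor (t : ℝ) : (flowFactor t).HasTemperateGrowth := by
  have h : Function.HasTemperateGrowth (fun ξ : ℝ => -(t * (2 * Real.pi * ξ) ^ 5)) := by fun_prop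
  exact hasTemperateGrowth_cexp_I_mul.comp h

theorem hasDerivAt_flowFactor (t ξ : ℝ) : HasDerivAt (flowFactor t)
    (flowFactor t ξ * (Complex.I * ((-(10 * Real.pi * t * (2 * Real.pi * ξ) ^ 4) : ℝ) : ℂ))) ξ := by
  have h1 : HasDerivAt (fun ξ : ℝ => -(t * (2 * Real.pi * ξ) ^ 5))
      (-(10 * Real.pi * t * (2 * Real.pi * ξ) ^ 4)) ξ := by
    refine (((((hasDerivAt_id ξ).const_mul (2 * Real.pi)).pow 5).const_mul t).neg).congr_deriv ?_
    simp only [id]; push_cast; ring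
  exact (h1.ofReal_comp.const_mul Complex.I).cexp

namespace SchwartzMap

theorem smulLeft_id_fourier (φ : 𝓢(ℝ, ℂ)) :
    smulLeftCLM ℂ (fun x : ℝ => (x : ℂ)) (𝓕 φ) =
      (2 * Real.pi * Complex.I)⁻¹ • 𝓕 (derivCLM ℂ ℂ φ) := by
  ext x
  have h1 := Real.fourier_deriv φ.integrable φ.differentiable (derivCLM ℂ ℂ φ).integrable
  have h2 : (𝓕 (derivCLM ℂ ℂ φ) : 𝓢(ℝ, ℂ)) x = (2 * Real.pi * Complex.I * x) • (𝓕 φ : 𝓢(ℝ, ℂ)) x :=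
    congrFun h1 x
  have hpi : (2 * Real.pi * Complex.I : ℂ) ≠ 0 := Complex.two_pi_I_ne_zero
  rw [smulLeftCLM_apply_apply (by fun_prop), smul_apply, h2, smul_eq_mul, smul_eq_mul, smul_eq_mul]
  field_simp

theorem derivCLM_fourier (φ : 𝓢(ℝ, ℂ)) :
    derivCLM ℂ ℂ (𝓕 φ) =
      𝓕 (smulLeftCLM ℂ (fun x : ℝ => -2 * Real.pi * Complex.I * (x : ℂ)) φ) := by
  ext x
  rw [derivCLM_apply]
  have hi : Integrable fun x : ℝ => x • φ x := by
    have h := (smulLeftCLM ℂ (fun x : ℝ => (x : ℂ)) φ).integrable (μ := volume)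
    rw [smulLeftCLM_apply (by fun_prop)] at h
    exact h
  have h1 := Real.deriv_fourier φ.integrable hi
  refine (congrFun h1 x).trans ?_
  rw [fourier_coe, smulLeftCLM_apply (by fun_prop)]

theorem iterate_derivCLM_fourier (φ : 𝓢(ℝ, ℂ)) :
    (derivCLM ℂ ℂ)^[4] (𝓕 φ) =
      𝓕 (smulLeftCLM ℂ (fun x : ℝ => ((2 * Real.pi * x : ℝ) : ℂ) ^ 4) φ) := by
  have hg : Function.HasTemperateGrowth (fun x : ℝ => -2 * Real.pi * Complex.I * (x : ℂ)) := by
    fun_prop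
  have hg4 : Function.HasTemperateGrowth (fun x : ℝ => ((2 * Real.pi * x : ℝ) : ℂ) ^ 4) := by
    fun_prop
  simp only [Function.iterate_succ, Function.iterate_zero, Function.comp_apply, id,
    derivCLM_fourier]
  congr 1
  ext x
  simp only [smulLeftCLM_apply_apply hg, smulLeftCLM_apply_apply hg4, smul_eq_mul]
  push_cast
  linear_combination (16 * (Real.pi : ℂ) ^ 4 * x ^ 4 * φ x) * Complex.I_pow_four

end SchwartzMap

namespace LinearKawahara

/-- On the Fourier side, `L(t)` is `(i / 2π) ∂_ξ + 5 t (2πξ)⁴`. -/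
theorem fourier_opL_apply (t : ℝ) (u : 𝓢'(ℝ, ℂ)) (φ : 𝓢(ℝ, ℂ)) :
    (𝓕 (opL t u)) φ = (𝓕 u) ((2 * Real.pi * Complex.I)⁻¹ • SchwartzMap.derivCLM ℂ ℂ φ +
      ((5 * t : ℝ) : ℂ) •
        SchwartzMap.smulLeftCLM ℂ (fun x : ℝ => ((2 * Real.pi * x : ℝ) : ℂ) ^ 4) φ) := by
  have h4 : ∀ g : 𝓢(ℝ, ℂ), ((TemperedDistribution.derivCLM ℂ)^[4] u) g =
      u ((SchwartzMap.derivCLM ℂ ℂ)^[4] g) := fun g => by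
    simp only [Function.iterate_succ, Function.iterate_zero, Function.comp_apply, id,
      TemperedDistribution.derivCLM_apply_apply, map_neg, neg_neg]
  have h5 : ∀ a b : 𝓢'(ℝ, ℂ), ∀ c : ℂ, ∀ g : 𝓢(ℝ, ℂ), (a + c • b) g = a g + c • b g :=
    fun _ _ _ _ => rfl
  rw [TemperedDistribution.fourier_apply, opL, h5, h4,
    TemperedDistribution.smulLeftCLM_apply_apply, SchwartzMap.smulLeft_id_fourier,
    SchwartzMap.iterate_derivCLM_fourier, TemperedDistribution.fourier_apply,
    FourierTransform.fourier_add,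
    map_add, FourierTransform.fourier_smul, FourierTransform.fourier_smul, map_smul, map_smul]

/-- The derivative of the profile on the Fourier side, in terms of `F = (|ξ|^{1/2} (Lu)^)^∨`. -/
noncomputable def profileDeriv (t : ℝ) (F : Lp (α := ℝ) ℂ 2 volume) (ξ : ℝ) : ℂ :=
  -(2 * Real.pi * Complex.I) * flowFactor t ξ * ((|2 * Real.pi * ξ| ^ (-(1 / 2) : ℝ) : ℝ) : ℂ) *
    (𝓕 F : Lp (α := ℝ) ℂ 2 volume) ξ

/-- Away from frequency zero, the derivative of `exp (-i t (2πξ)⁵) û` is `profileDeriv`. -/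
theorem fourier_apply_flowFactor_deriv {t : ℝ} {u : 𝓢'(ℝ, ℂ)} {F : Lp (α := ℝ) ℂ 2 volume}
    (hF : IsFracDeriv (1 / 2) (opL t u) F) {χ : 𝓢(ℝ, ℂ)} (hχ : (0 : ℝ) ∉ tsupport χ) :
    (𝓕 u) (SchwartzMap.smulLeftCLM ℂ (flowFactor t) (SchwartzMap.derivCLM ℂ ℂ χ)) =
      -∫ ξ, χ ξ * profileDeriv t F ξ := by
  have hg := hasTemperateGrowth_flowFactor t
  have hg4 : Function.HasTemperateGrowth (fun x : ℝ => ((2 * Real.pi * x : ℝ) : ℂ) ^ 4) := by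
    fun_prop
  have hpi : (2 * Real.pi * Complex.I : ℂ) ≠ 0 := Complex.two_pi_I_ne_zero
  set φ := SchwartzMap.smulLeftCLM ℂ (flowFactor t) χ with hφ
  have hφs : (0 : ℝ) ∉ tsupport φ := fun h => by
    rw [hφ, SchwartzMap.smulLeftCLM_apply hg] at h
    exact hχ (tsupport_smul_subset_right _ _ h)
  have h1 := hF φ hφs
  rw [fourier_opL_apply] at h1
  have h2 : (2 * Real.pi * Complex.I)⁻¹ • SchwartzMap.derivCLM ℂ ℂ φ + ((5 * t : ℝ) : ℂ) •
        SchwartzMap.smulLeftCLM ℂ (fun x : ℝ => ((2 * Real.pi * x : ℝ) : ℂ) ^ 4) φ =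
      (2 * Real.pi * Complex.I)⁻¹ •
        SchwartzMap.smulLeftCLM ℂ (flowFactor t) (SchwartzMap.derivCLM ℂ ℂ χ) := by
    ext ξ
    have h3 : deriv φ ξ = flowFactor t ξ *
        (Complex.I * ((-(10 * Real.pi * t * (2 * Real.pi * ξ) ^ 4) : ℝ) : ℂ)) * χ ξ +
        flowFactor t ξ * deriv χ ξ := by
      have h4 : (φ : ℝ → ℂ) = fun ξ => flowFactor t ξ * χ ξ := by
        rw [hφ, SchwartzMap.smulLeftCLM_apply hg]; rfl
      rw [h4]
      exact ((hasDerivAt_flowFactor t ξ).mul (χ.hasDerivAt ξ)).deriv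
    rw [add_apply, smul_apply, smul_apply, smul_apply,
      SchwartzMap.smulLeftCLM_apply_apply hg4,
      SchwartzMap.smulLeftCLM_apply_apply hg (SchwartzMap.derivCLM ℂ ℂ χ) ξ,
      SchwartzMap.derivCLM_apply, SchwartzMap.derivCLM_apply, h3, hφ,
      SchwartzMap.smulLeftCLM_apply_apply hg]
    simp only [smul_eq_mul]
    push_cast
    field_simp
    ring
  rw [h2, map_smul, smul_eq_mul, inv_mul_eq_iff_eq_mul₀ hpi] at h1
  rw [h1, ← integral_const_mul, ← integral_neg]
  congr 1
  funext ξ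
  rw [hφ, SchwartzMap.smulLeftCLM_apply_apply hg, profileDeriv, smul_eq_mul]
  ring

theorem integral_norm_sq_eq (G : Lp (α := ℝ) ℂ 2 volume) :
    Integrable (fun ξ => ‖G ξ‖ ^ 2) ∧ ∫ ξ, ‖G ξ‖ ^ 2 = ‖G‖ ^ 2 := by
  refine ⟨(Lp.memLp G).integrable_norm_pow (p := 2) (by norm_num), ?_⟩
  have h := L2.inner_def (𝕜 := ℂ) G G
  rw [inner_self_eq_norm_sq_to_K] at h
  have h2 : (fun a => inner ℂ (G a) (G a)) = fun a => ((‖G a‖ ^ 2 : ℝ) : ℂ) := by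
    funext a; rw [inner_self_eq_norm_sq_to_K]; push_cast; rfl
  rw [h2, integral_complex_ofReal] at h
  exact Complex.ofReal_injective ((h.trans rfl).symm.trans (by push_cast; rfl))

theorem aestronglyMeasurable_profileDeriv (t : ℝ) (F : Lp (α := ℝ) ℂ 2 volume) :
    AEStronglyMeasurable (profileDeriv t F) volume := by
  have h1 : Measurable (flowFactor t) := by
    unfold flowFactor; fun_prop
  have h2 : Measurable fun ξ : ℝ => ((|2 * Real.pi * ξ| ^ (-(1 / 2) : ℝ) : ℝ) : ℂ) := by fun_prop
  unfold profileDeriv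
  exact ((h1.const_mul _).mul h2).aestronglyMeasurable.mul (Lp.aestronglyMeasurable _)

theorem abs_mul_norm_profileDeriv_sq (t : ℝ) (F : Lp (α := ℝ) ℂ 2 volume) {ξ : ℝ} (hξ : ξ ≠ 0) :
    |ξ| * ‖profileDeriv t F ξ‖ ^ 2 =
      2 * Real.pi * ‖(𝓕 F : Lp (α := ℝ) ℂ 2 volume) ξ‖ ^ 2 := by
  have h0 : 0 < |2 * Real.pi * ξ| := abs_pos.2 (by positivity)
  have hpi := Real.pi_pos
  rw [profileDeriv, norm_mul, norm_mul, norm_mul, norm_flowFactor, Complex.norm_real,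
    Real.norm_of_nonneg (by positivity), norm_neg, mul_pow, mul_pow, mul_pow,
    ← Real.rpow_mul_natCast h0.le]
  have e1 : ‖(2 * Real.pi * Complex.I : ℂ)‖ = 2 * Real.pi := by
    simp [abs_of_pos hpi]
  have e2 : (-(1 / 2) : ℝ) * (2 : ℕ) = -1 := by norm_num
  rw [e1, e2, Real.rpow_neg_one, abs_mul, abs_of_pos (by positivity : 0 < 2 * Real.pi)]
  have := abs_pos.2 hξ
  field_simp

/-! ### The dyadic bound -/

/-- The norm is an infimum, so only a bound larger than `1` is available for a representative. -/
theorem exists_of_sobolevNorm_le {s : ℝ} {f : 𝓢'(ℝ, ℂ)} (h : sobolevNorm s f ≤ 1) :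
    ∃ F, IsFracDeriv s f F ∧ ‖F‖ ≤ 2 := by
  have h1 : sobolevNorm s f < 2 := h.trans_lt (by norm_num)
  obtain ⟨F, h2⟩ := iInf_lt_iff.1 h1
  obtain ⟨h3, h4⟩ := iInf_lt_iff.1 h2
  refine ⟨F, h3, ?_⟩
  have h5 : ‖F‖ₑ ≤ ENNReal.ofReal 2 := by simpa using h4.le
  rw [← ofReal_norm] at h5
  exact (ENNReal.ofReal_le_ofReal_iff (by norm_num)).1 h5

theorem exists_of_besovNorm_le {ψ : ℝ → ℂ} {f : 𝓢'(ℝ, ℂ)} (h : besovNorm ψ (-(1 / 2)) f ≤ 1)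
    (j : ℤ) : ∃ F : Lp (α := ℝ) ℂ 2 volume, (F : 𝓢'(ℝ, ℂ)) = lpProj ψ j f ∧
      ‖F‖ ^ 2 ≤ 4 * (2 : ℝ) ^ j := by
  have h1 := (le_iSup (fun j : ℤ => ENNReal.ofReal ((2 : ℝ) ^ ((j : ℝ) * (-(1 / 2)))) *
    l2Norm (lpProj ψ j f)) j).trans h
  set c : ℝ := (2 : ℝ) ^ ((j : ℝ) * (-(1 / 2))) with hc
  have hc0 : 0 < c := Real.rpow_pos_of_pos two_pos _
  have h2 : l2Norm (lpProj ψ j f) < ENNReal.ofReal (2 * c⁻¹) := by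
    have h3 : l2Norm (lpProj ψ j f) ≤ ENNReal.ofReal c⁻¹ := by
      rw [ENNReal.ofReal_inv_of_pos hc0, ENNReal.le_inv_iff_mul_le, mul_comm]
      exact h1
    refine h3.trans_lt ((ENNReal.ofReal_lt_ofReal_iff (by positivity)).2 ?_)
    have : 0 < c⁻¹ := inv_pos.2 hc0
    linarith
  obtain ⟨F, h3⟩ := iInf_lt_iff.1 h2
  obtain ⟨h4, h5⟩ := iInf_lt_iff.1 h3
  refine ⟨F, h4, ?_⟩
  have h6 := h5.le
  rw [← ofReal_norm, ENNReal.ofReal_le_ofReal_iff (by positivity)] at h6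
  calc ‖F‖ ^ 2 ≤ (2 * c⁻¹) ^ 2 := by gcongr
    _ = 4 * (2 : ℝ) ^ j := by
      rw [mul_pow, hc, ← Real.rpow_neg two_pos.le, ← Real.rpow_mul_natCast two_pos.le,
        ← Real.rpow_intCast]
      norm_num
      ring_nf
      exact Real.rpow_intCast 2 j

theorem IsLPCutoff.hasTemperateGrowth {ψ : ℝ → ℂ} (hψ : IsLPCutoff ψ) {N : ℝ} (hN : 0 < N) :
    Function.HasTemperateGrowth (fun ξ : ℝ => ψ (2 * Real.pi * ξ / N)) := by
  have hpi := Real.pi_pos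
  have hs := hψ.smooth
  refine HasCompactSupport.hasTemperateGrowth ?_ (by fun_prop)
  refine HasCompactSupport.intro (isCompact_Icc (a := -(N / Real.pi)) (b := N / Real.pi))
    fun ξ hξ => ?_
  by_contra h
  have h1 := hψ.support_subset h
  refine hξ ⟨?_, ?_⟩
  · have := (le_div_iff₀ hN).1 h1.1
    rw [← neg_div, div_le_iff₀ hpi]; linarith
  · have := (div_le_iff₀ hN).1 h1.2
    rw [le_div_iff₀ hpi]; linarith

theorem fourier_lpLow_apply (ψ : ℝ → ℂ) (N : ℝ) (u : 𝓢'(ℝ, ℂ)) (φ : 𝓢(ℝ, ℂ)) :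
    (𝓕 (lpLow ψ N u)) φ =
      (𝓕 u) (SchwartzMap.smulLeftCLM ℂ (fun ξ : ℝ => ψ (2 * Real.pi * ξ / N)) φ) := by
  rw [lpLow, multiplier, TemperedDistribution.fourierMultiplierCLM_apply,
    FourierTransform.fourier_fourierInv_eq, TemperedDistribution.smulLeftCLM_apply_apply]

/-- On the annulus `2^j ≤ |2πξ| ≤ 2^(j+1)` the projection `P_j + P_{j+1}` is the identity,
whatever the cutoff. This is why the constants do not depend on `ψ`. -/
theorem fourier_apply_eq_of_annulus {ψ : ℝ → ℂ} (hψ : IsLPCutoff ψ) (u : 𝓢'(ℝ, ℂ)) (j : ℤ)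
    {φ : 𝓢(ℝ, ℂ)} (hφ : ∀ ξ, φ ξ ≠ 0 → (2 : ℝ) ^ j ≤ |2 * Real.pi * ξ| ∧
      |2 * Real.pi * ξ| ≤ 2 * (2 : ℝ) ^ j) :
    (𝓕 u) φ = (𝓕 (lpProj ψ j u)) φ + (𝓕 (lpProj ψ (j + 1) u)) φ := by
  have hj : (0 : ℝ) < 2 ^ j := by positivity
  have hsub : ∀ a b : 𝓢'(ℝ, ℂ), (𝓕 (a - b)) φ = (𝓕 a) φ - (𝓕 b) φ := fun a b => by
    rw [TemperedDistribution.fourier_apply, TemperedDistribution.fourier_apply,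
      TemperedDistribution.fourier_apply]; rfl
  have e : (2 : ℝ) ^ (j + 1) = 2 * 2 ^ j := by rw [zpow_add_one₀ two_ne_zero]; ring
  rw [lpProj, lpProj, hsub, hsub, fourier_lpLow_apply, fourier_lpLow_apply, fourier_lpLow_apply,
    fourier_lpLow_apply, e, mul_div_cancel_left₀ _ two_ne_zero]
  have e2 : φ = SchwartzMap.smulLeftCLM ℂ (fun ξ : ℝ => ψ (2 * Real.pi * ξ / (2 * 2 ^ j))) φ -
      SchwartzMap.smulLeftCLM ℂ (fun ξ : ℝ => ψ (2 * Real.pi * ξ / (2 ^ j / 2))) φ := by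
    ext ξ
    rw [sub_apply, SchwartzMap.smulLeftCLM_apply_apply (hψ.hasTemperateGrowth (by positivity)),
      SchwartzMap.smulLeftCLM_apply_apply (hψ.hasTemperateGrowth (by positivity))]
    by_cases h0 : φ ξ = 0
    · simp [h0]
    obtain ⟨h1, h2⟩ := hφ ξ h0
    have e3 : ψ (2 * Real.pi * ξ / (2 * 2 ^ j)) = 1 := by
      refine hψ.eq_one _ (abs_le.1 ?_)
      rw [abs_div, abs_of_pos (by positivity : (0 : ℝ) < 2 * 2 ^ j)]
      exact (div_le_one (by positivity)).2 h2
    have hcont : Continuous ψ := hψ.smooth.continuous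
    -- at the endpoint `±2` of the support, continuity gives that `ψ` vanishes as well
    have hzero : ∀ z : ℝ, 2 ≤ |z| → ψ z = 0 := fun z hz => by
      have hcl : Set.Ici (2 : ℝ) ⊆ {z | ψ z = 0} := by
        rw [← closure_Ioi]
        refine closure_minimal (fun z hz => ?_) (isClosed_eq hcont continuous_const)
        by_contra h
        exact absurd (hψ.support_subset h).2 (not_le.2 hz)
      rcases abs_cases z with ⟨hz', _⟩ | ⟨hz', _⟩
      · exact hcl (hz' ▸ hz : (2 : ℝ) ≤ z)
      · rw [← hψ.even]
        exact hcl (hz' ▸ hz : (2 : ℝ) ≤ -z)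
    have e4 : ψ (2 * Real.pi * ξ / (2 ^ j / 2)) = 0 := by
      refine hzero _ ?_
      rw [abs_div, abs_of_pos (by positivity : (0 : ℝ) < 2 ^ j / 2), le_div_iff₀ (by positivity)]
      linarith
    rw [e3, e4]; simp
  conv_lhs => rw [e2, map_sub]
  ring

/-- Pairing of an `L²` function with a test function on a short interval; Cauchy-Schwarz is used in
its additive form `|φ Ĝ| ≤ (1 + |Ĝ|²) / 2`. -/
theorem norm_fourier_apply_le {G : Lp (α := ℝ) ℂ 2 volume} {φ : 𝓢(ℝ, ℂ)} {a b : ℝ} (hab : a ≤ b)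
    (hφ : ∀ ξ, φ ξ ≠ 0 → ξ ∈ Set.Icc a b) (hφ1 : ∀ ξ, ‖φ ξ‖ ≤ 1) :
    ‖(𝓕 (G : 𝓢'(ℝ, ℂ))) φ‖ ≤ (b - a + ‖G‖ ^ 2) / 2 := by
  rw [Lp.fourier_toTemperedDistribution_eq, Lp.toTemperedDistribution_apply]
  obtain ⟨h1, h2⟩ := integral_norm_sq_eq (𝓕 G)
  rw [Lp.norm_fourier_eq] at h2
  have h3 : Integrable (Set.indicator (Set.Icc a b) fun _ => (1 : ℝ)) :=
    (integrable_indicator_iff measurableSet_Icc).2 (by simp)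
  refine (norm_integral_le_of_norm_le ((h3.add h1).div_const 2) (ae_of_all _ fun ξ => ?_)).trans
    (le_of_eq ?_)
  · rw [norm_smul, Pi.add_apply]
    by_cases h0 : φ ξ = 0
    · rw [h0, norm_zero, zero_mul]
      have : (0 : ℝ) ≤ Set.indicator (Set.Icc a b) (fun _ => (1 : ℝ)) ξ :=
        Set.indicator_nonneg (fun _ _ => zero_le_one) _
      positivity
    · rw [Set.indicator_of_mem (hφ ξ h0)]
      have := hφ1 ξ
      nlinarith [sq_nonneg (‖φ ξ‖ - ‖(𝓕 G : Lp (α := ℝ) ℂ 2 volume) ξ‖), norm_nonneg (φ ξ)]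
  · rw [integral_div, integral_add' h3 h1, h2, integral_indicator measurableSet_Icc]
    simp [hab]

end LinearKawahara

/-! ### Rescaling to a profile on the half-line -/

namespace SchwartzMap

/-- The dilation `χ ↦ χ (· * c)`. -/
noncomputable def dilation (c : ℝ) (hc : c ≠ 0) : 𝓢(ℝ, ℂ) →L[ℂ] 𝓢(ℝ, ℂ) :=
  compCLMOfContinuousLinearEquiv ℂ (ContinuousLinearEquiv.unitsEquivAut ℝ (Units.mk0 c hc))

@[simp] theorem dilation_apply {c : ℝ} (hc : c ≠ 0) (χ : 𝓢(ℝ, ℂ)) (ξ : ℝ) :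
    dilation c hc χ ξ = χ (ξ * c) := rfl

theorem derivCLM_dilation {c : ℝ} (hc : c ≠ 0) (χ : 𝓢(ℝ, ℂ)) :
    derivCLM ℂ ℂ (dilation c hc χ) = (c : ℂ) • dilation c hc (derivCLM ℂ ℂ χ) := by
  ext ξ
  rw [derivCLM_apply, smul_apply, dilation_apply, derivCLM_apply]
  have h1 : HasDerivAt (fun ξ : ℝ => ξ * c) c ξ := by
    simpa using (hasDerivAt_id ξ).mul_const c
  have h2 := (χ.hasDerivAt (ξ * c)).scomp ξ h1
  rw [show (dilation c hc χ : ℝ → ℂ) = χ ∘ fun ξ => ξ * c from rfl, h2.deriv]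
  simp

theorem tsupport_dilation {c : ℝ} (hc : c ≠ 0) (χ : 𝓢(ℝ, ℂ)) :
    tsupport (dilation c hc χ) = (fun ξ => ξ * c) ⁻¹' tsupport χ :=
  tsupport_comp_eq_preimage χ
    (ContinuousLinearEquiv.unitsEquivAut ℝ (Units.mk0 c hc)).toHomeomorph

theorem zero_notMem_tsupport_dilation {c : ℝ} (hc : c ≠ 0) {χ : 𝓢(ℝ, ℂ)}
    (h : (0 : ℝ) ∉ tsupport χ) : (0 : ℝ) ∉ tsupport (dilation c hc χ) := by
  rw [tsupport_dilation]
  simpa using h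

end SchwartzMap

namespace LinearKawahara

/-- The dyadic bound for the distribution `û` restricted to a half-line and dilated. The sign of `c`
selects the half-line. The radius is `r = |c| 2^j / 2π`, so that `(r, 2r)` corresponds to the
annulus `2^j < |2πξ| < 2^(j+1)`; two projections contribute `r + 12 π r ≤ 40 r`. -/
theorem norm_fourier_apply_dilation_le {ψ : ℝ → ℂ} (hψ : IsLPCutoff ψ) {t : ℝ} {u : 𝓢'(ℝ, ℂ)}
    (hu : besovNorm ψ (-(1 / 2)) u ≤ 1) {c : ℝ} (hc : c ≠ 0) {x : ℝ} (hx : 0 < x) :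
    ∃ r, 0 < r ∧ r ≤ x ∧ x ≤ 2 * r ∧ ∀ χ : 𝓢(ℝ, ℂ), tsupport χ ⊆ Set.Ioo r (2 * r) →
      (∀ ξ, ‖χ ξ‖ ≤ 1) →
      |c| * ‖(𝓕 u) (SchwartzMap.smulLeftCLM ℂ (flowFactor t) (SchwartzMap.dilation c hc χ))‖ ≤
        40 * r := by
  have hpi := Real.pi_pos
  have hpi2 := Real.pi_lt_d2
  have hc0 := abs_pos.2 hc
  obtain ⟨j, hj1, hj2⟩ := exists_mem_Ico_zpow (x := 2 * Real.pi * x / |c|) (y := (2 : ℝ))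
    (by positivity) (by norm_num)
  have hj : (0 : ℝ) < 2 ^ j := by positivity
  rw [zpow_add_one₀ two_ne_zero, div_lt_iff₀ hc0] at hj2
  rw [le_div_iff₀ hc0] at hj1
  set r := |c| * 2 ^ j / (2 * Real.pi) with hr
  have hr0 : 0 < r := by positivity
  have hrc : 2 * Real.pi * r = |c| * 2 ^ j := by rw [hr]; field_simp
  refine ⟨r, hr0, ?_, ?_, fun χ hχs hχ1 => ?_⟩
  · rw [hr, div_le_iff₀ (by positivity)]; linarith
  · have : x * (2 * Real.pi) ≤ (2 * r) * (2 * Real.pi) := by linarith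
    exact le_of_mul_le_mul_right this (by positivity)
  have hg := hasTemperateGrowth_flowFactor t
  set φ := SchwartzMap.smulLeftCLM ℂ (flowFactor t) (SchwartzMap.dilation c hc χ) with hφ
  have hφa : ∀ ξ, φ ξ = flowFactor t ξ * χ (ξ * c) := fun ξ => by
    rw [hφ, SchwartzMap.smulLeftCLM_apply_apply hg]; rfl
  have hφn : ∀ ξ, ‖φ ξ‖ ≤ 1 := fun ξ => by
    rw [hφa, norm_mul, norm_flowFactor, one_mul]; exact hχ1 _
  have hsupp : ∀ ξ, φ ξ ≠ 0 → r < ξ * c ∧ ξ * c < 2 * r := fun ξ h => by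
    refine hχs (subset_tsupport _ fun h0 => h ?_)
    rw [hφa, h0, mul_zero]
  have hann : ∀ ξ, φ ξ ≠ 0 → (2 : ℝ) ^ j ≤ |2 * Real.pi * ξ| ∧
      |2 * Real.pi * ξ| ≤ 2 * (2 : ℝ) ^ j := fun ξ h => by
    obtain ⟨h1, h2⟩ := hsupp ξ h
    have h3 : |2 * Real.pi * ξ| * |c| = 2 * Real.pi * (ξ * c) := by
      rw [← abs_mul, mul_assoc, abs_of_pos]
      exact mul_pos (by positivity) (hr0.trans h1)
    constructor
    · refine le_of_mul_le_mul_right ?_ hc0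
      rw [h3]; nlinarith
    · refine le_of_mul_le_mul_right ?_ hc0
      rw [h3]; nlinarith
  obtain ⟨a, b, hab, hba, hIcc⟩ : ∃ a b : ℝ, a ≤ b ∧ (b - a) * |c| = r ∧
      ∀ ξ, φ ξ ≠ 0 → ξ ∈ Set.Icc a b := by
    rcases lt_or_gt_of_ne hc with h | h
    · refine ⟨2 * r / c, r / c, ?_, ?_, fun ξ hξ => ?_⟩
      · exact div_le_div_of_nonpos_of_le h.le (by linarith)
      · rw [abs_of_neg h]; field_simp; ring
      · obtain ⟨h1, h2⟩ := hsupp ξ hξ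
        exact ⟨(div_le_iff_of_neg h).2 h2.le, (le_div_iff_of_neg h).2 h1.le⟩
    · refine ⟨r / c, 2 * r / c, ?_, ?_, fun ξ hξ => ?_⟩
      · gcongr; linarith
      · rw [abs_of_pos h]; field_simp; ring
      · obtain ⟨h1, h2⟩ := hsupp ξ hξ
        exact ⟨(div_le_iff₀ h).2 h1.le, (le_div_iff₀ h).2 h2.le⟩
  obtain ⟨F₁, e₁, hF₁⟩ := exists_of_besovNorm_le hu j
  obtain ⟨F₂, e₂, hF₂⟩ := exists_of_besovNorm_le hu (j + 1)
  rw [zpow_add_one₀ two_ne_zero] at hF₂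
  rw [fourier_apply_eq_of_annulus hψ u j hann, ← e₁, ← e₂]
  have h1 := norm_fourier_apply_le (G := F₁) hab hIcc hφn
  have h2 := norm_fourier_apply_le (G := F₂) hab hIcc hφn
  have h3 := norm_add_le ((𝓕 (F₁ : 𝓢'(ℝ, ℂ))) φ) ((𝓕 (F₂ : 𝓢'(ℝ, ℂ))) φ)
  have h4 : ‖(𝓕 (F₁ : 𝓢'(ℝ, ℂ))) φ + (𝓕 (F₂ : 𝓢'(ℝ, ℂ))) φ‖ ≤ (b - a) + 6 * 2 ^ j := by
    linarith
  have h5 := mul_le_mul_of_nonneg_left h4 hc0.le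
  nlinarith

/-- The restriction of `exp (-i t (2πξ)⁵) û` to a half-line, dilated, is a profile. The constant is
`2 * 40 + 2 * 26 + 2`, where `40` comes from the dyadic bound and `26 ≥ 8 π ≥ 2 π ‖F‖²`. -/
theorem exists_profile {ψ : ℝ → ℂ} (hψ : IsLPCutoff ψ) {t : ℝ} {u : 𝓢'(ℝ, ℂ)}
    (hu : besovNorm ψ (-(1 / 2)) u ≤ 1) {F : Lp (α := ℝ) ℂ 2 volume}
    (hF : IsFracDeriv (1 / 2) (opL t u) F) (hF2 : ‖F‖ ≤ 2) {c : ℝ} (hc : c ≠ 0) :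
    ∃ w h : ℝ → ℂ, HalfLineProfile 134 w h ∧ ∀ χ : 𝓢(ℝ, ℂ), HasCompactSupport χ →
      tsupport χ ⊆ Set.Ioi 0 →
      (𝓕 u) (SchwartzMap.smulLeftCLM ℂ (flowFactor t) (SchwartzMap.dilation c hc χ)) =
        ((|c|⁻¹ : ℝ) : ℂ) * ∫ ξ, χ ξ * w ξ := by
  have hpi := Real.pi_pos
  have hpi2 := Real.pi_lt_d2
  have hc0 := abs_pos.2 hc
  have hcC : (c : ℂ) ≠ 0 := Complex.ofReal_ne_zero.2 hc
  have hcA : ((|c| : ℝ) : ℂ) ≠ 0 := Complex.ofReal_ne_zero.2 hc0.ne'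
  set h : ℝ → ℂ := fun η => (c : ℂ)⁻¹ * profileDeriv t F (η * c⁻¹) with hh
  set Λ : 𝓢(ℝ, ℂ) →ₗ[ℂ] ℂ :=
    { toFun := fun χ => ((|c| : ℝ) : ℂ) *
        (𝓕 u) (SchwartzMap.smulLeftCLM ℂ (flowFactor t) (SchwartzMap.dilation c hc χ))
      map_add' := fun a b => by simp only [map_add]; ring
      map_smul' := fun a b => by simp only [map_smul, smul_eq_mul, RingHom.id_apply]; ring } with hΛ
  have hΛa : ∀ χ, Λ χ = ((|c| : ℝ) : ℂ) *
        (𝓕 u) (SchwartzMap.smulLeftCLM ℂ (flowFactor t) (SchwartzMap.dilation c hc χ)) :=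
    fun χ => rfl
  have hqmp : Measure.QuasiMeasurePreserving (fun η : ℝ => η * c⁻¹) volume volume :=
    ⟨measurable_mul_const _, by
      rw [Real.map_volume_mul_right (inv_ne_zero hc)]
      exact Measure.smul_absolutelyContinuous⟩
  have hm : AEStronglyMeasurable h volume :=
    ((aestronglyMeasurable_profileDeriv t F).comp_quasiMeasurePreserving hqmp).const_mul _
  obtain ⟨hG1, hG2⟩ := integral_norm_sq_eq (𝓕 F)
  rw [Lp.norm_fourier_eq] at hG2
  set G : ℝ → ℝ := fun ξ => ‖(𝓕 F : Lp (α := ℝ) ℂ 2 volume) ξ‖ ^ 2 with hG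
  have hGc : Integrable (fun η => 2 * Real.pi * |c|⁻¹ * G (η * c⁻¹)) :=
    (hG1.comp_mul_right' (inv_ne_zero hc)).const_mul _
  have hsq : ∀ η ∈ Set.Ioi (0 : ℝ), η * ‖h η‖ ^ 2 = 2 * Real.pi * |c|⁻¹ * G (η * c⁻¹) := by
    intro η hη
    have hη' : (0 : ℝ) < η := hη
    have h1 := abs_mul_norm_profileDeriv_sq t F (mul_ne_zero hη'.ne' (inv_ne_zero hc))
    rw [abs_mul, abs_of_pos hη', abs_inv] at h1
    simp only [hh, hG]
    rw [norm_mul, norm_inv, Complex.norm_real, Real.norm_eq_abs, mul_pow,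
      mul_right_comm (2 * Real.pi), ← h1]
    ring
  have hi : IntegrableOn (fun ξ => ξ * ‖h ξ‖ ^ 2) (Set.Ioi 0) :=
    hGc.integrableOn.congr_fun (fun η hη => (hsq η hη).symm) measurableSet_Ioi
  have hiB : ∫ ξ in Set.Ioi 0, ξ * ‖h ξ‖ ^ 2 ≤ 26 := by
    rw [setIntegral_congr_fun measurableSet_Ioi hsq]
    refine (setIntegral_le_integral hGc (ae_of_all _ fun η => by positivity)).trans ?_
    rw [integral_const_mul, Measure.integral_comp_mul_right G c⁻¹, hG2, inv_inv, smul_eq_mul]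
    have : 2 * Real.pi * |c|⁻¹ * (|c| * ‖F‖ ^ 2) = 2 * Real.pi * ‖F‖ ^ 2 := by
      field_simp
    rw [this]
    nlinarith [norm_nonneg F]
  have hder : ∀ η : 𝓢(ℝ, ℂ), HasCompactSupport η → tsupport η ⊆ Set.Ioi 0 →
      Λ (SchwartzMap.derivCLM ℂ ℂ η) = -∫ ξ, η ξ * h ξ := by
    intro η _ hη
    have h0 : (0 : ℝ) ∉ tsupport η := fun h => lt_irrefl (0 : ℝ) (hη h)
    have h1 := fourier_apply_flowFactor_deriv hF
      (SchwartzMap.zero_notMem_tsupport_dilation hc h0)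
    rw [SchwartzMap.derivCLM_dilation, map_smul, map_smul, smul_eq_mul] at h1
    have h2 := Measure.integral_comp_mul_right (fun y => η y * h y) c
    have h3 : (fun ξ => η (ξ * c) * h (ξ * c)) = fun ξ => (c : ℂ)⁻¹ *
        (SchwartzMap.dilation c hc η ξ * profileDeriv t F ξ) := by
      funext ξ
      simp only [hh, SchwartzMap.dilation_apply]
      rw [mul_inv_cancel_right₀ hc]; ring
    rw [h3, integral_const_mul, abs_inv, Complex.real_smul, Complex.ofReal_inv] at h2
    rw [hΛa]
    generalize (∫ ξ, SchwartzMap.dilation c hc η ξ * profileDeriv t F ξ) = I₁ at h1 h2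
    generalize (∫ ξ, η ξ * h ξ) = I₂ at h2 ⊢
    rw [inv_mul_eq_iff_eq_mul₀ hcC] at h2
    rw [h2] at h1
    refine mul_left_cancel₀ hcC ?_
    rw [mul_left_comm, h1]
    field_simp
  obtain ⟨w, hw1, hw2⟩ := exists_halfLineProfile Λ (by norm_num : (0 : ℝ) ≤ 26)
    (by norm_num : (0 : ℝ) ≤ 40) hm hi hiB hder (fun x hx => by
      obtain ⟨r, h1, h2, h3, h4⟩ := norm_fourier_apply_dilation_le (t := t) hψ hu hc hx
      refine ⟨r, h1, h2, h3, fun χ _ hχ hχ1 => ?_⟩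
      rw [hΛa, norm_mul, Complex.norm_real, Real.norm_eq_abs, abs_abs]
      exact h4 χ hχ hχ1)
  norm_num at hw1
  refine ⟨w, h, hw1, fun χ h1 h2 => ?_⟩
  rw [← hw2 χ h1 h2, hΛa, Complex.ofReal_inv, inv_mul_cancel_left₀ hcA]

end LinearKawahara

/-! ### Distributions given by a bounded function away from the origin -/

namespace LinearKawahara

namespace IsLPCutoff

variable {ψ : ℝ → ℂ}

theorem hasCompactSupport (hψ : IsLPCutoff ψ) : HasCompactSupport ψ :=
  HasCompactSupport.intro isCompact_Icc fun _ hz =>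
    by_contra fun h => hz (hψ.support_subset h)

theorem exists_norm_iteratedDeriv_le (hψ : IsLPCutoff ψ) (i : ℕ) :
    ∃ C, 0 ≤ C ∧ ∀ z, ‖iteratedDeriv i ψ z‖ ≤ C := by
  set f : 𝓢(ℝ, ℂ) := hψ.hasCompactSupport.toSchwartzMap hψ.smooth with hf
  refine ⟨SchwartzMap.seminorm ℝ 0 i f, by positivity, fun z => ?_⟩
  have h := SchwartzMap.le_seminorm' ℝ 0 i f z
  rw [pow_zero, one_mul] at h
  exact h

theorem exists_norm_le (hψ : IsLPCutoff ψ) : ∃ C, 0 ≤ C ∧ ∀ z, ‖ψ z‖ ≤ C := by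
  simpa using hψ.exists_norm_iteratedDeriv_le 0

/-- All derivatives of `ψ - 1` are bounded and vanish on `(-1, 1)`. -/
theorem exists_norm_iteratedDeriv_sub_one_le (hψ : IsLPCutoff ψ) (i : ℕ) :
    ∃ C, 0 ≤ C ∧ ∀ z, ‖iteratedDeriv i (fun z => ψ z - 1) z‖ ≤ C * |z| := by
  obtain ⟨C, hC0, hC⟩ := hψ.exists_norm_iteratedDeriv_le i
  refine ⟨C + 1, by positivity, fun z => ?_⟩
  rcases lt_or_ge |z| 1 with hz | hz
  · have h : (fun z => ψ z - 1) =ᶠ[𝓝 z] fun _ => (0 : ℂ) := by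
      filter_upwards [Ioo_mem_nhds (abs_lt.1 hz).1 (abs_lt.1 hz).2] with y hy
      rw [hψ.eq_one y ⟨hy.1.le, hy.2.le⟩, sub_self]
    rw [h.iteratedDeriv_eq]
    simp only [iteratedDeriv_const, ite_self, norm_zero]
    positivity
  · have h : ‖iteratedDeriv i (fun z => ψ z - 1) z‖ ≤ C + 1 := by
      cases i with
      | zero =>
        simp only [iteratedDeriv_zero] at hC ⊢
        exact (norm_sub_le _ _).trans (by simpa using hC z)
      | succ i =>
        have h1 : deriv (fun z => ψ z - 1) = deriv ψ := funext fun y => deriv_sub_const _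
        rw [iteratedDeriv_succ', h1, ← iteratedDeriv_succ']
        exact (hC z).trans (by linarith)
    exact h.trans (le_mul_of_one_le_right (by positivity) hz)

/-- Cutting off high frequencies of a Schwartz function converges in `𝓢`. -/
theorem tendsto_smulLeftCLM (hψ : IsLPCutoff ψ) (φ : 𝓢(ℝ, ℂ)) :
    Tendsto (fun n : ℕ => SchwartzMap.smulLeftCLM ℂ
      (fun ξ : ℝ => ψ (2 * Real.pi * ξ / ((n : ℝ) + 1))) φ) atTop (𝓝 φ) := by
  have hpi := Real.pi_pos
  refine ((schwartz_withSeminorms ℝ ℝ ℂ).tendsto_nhds _ _).2 fun ⟨k, m⟩ ε hε => ?_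
  choose C hC0 hC using hψ.exists_norm_iteratedDeriv_sub_one_le
  set S : ℝ := ∑ i ∈ Finset.range (m + 1), (m.choose i : ℝ) *
    ((2 * Real.pi) ^ i * C i * SchwartzMap.seminorm ℝ (k + 1) (m - i) φ) with hS
  have hS0 : 0 ≤ S := Finset.sum_nonneg fun i _ => by have := hC0 i; positivity
  have hb : ContDiff ℝ ∞ fun z => ψ z - 1 := hψ.smooth.sub contDiff_const
  have key : ∀ n : ℕ, SchwartzMap.seminorm ℝ k m (SchwartzMap.smulLeftCLM ℂ
      (fun ξ : ℝ => ψ (2 * Real.pi * ξ / ((n : ℝ) + 1))) φ - φ) ≤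
        2 * Real.pi / ((n : ℝ) + 1) * S := by
    intro n
    set a : ℝ := 2 * Real.pi / ((n : ℝ) + 1) with ha
    have ha0 : 0 ≤ a := by positivity
    have ha1 : a ≤ 2 * Real.pi := div_le_self (by positivity) (by simp)
    refine SchwartzMap.seminorm_le_bound' ℝ k m _ (by positivity) fun ξ => ?_
    have e : ((SchwartzMap.smulLeftCLM ℂ
        (fun ξ : ℝ => ψ (2 * Real.pi * ξ / ((n : ℝ) + 1))) φ - φ : 𝓢(ℝ, ℂ)) : ℝ → ℂ) =
        fun ξ => (fun z => ψ z - 1) (a * ξ) * φ ξ := by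
      funext ξ
      rw [sub_apply, SchwartzMap.smulLeftCLM_apply_apply
        (hψ.hasTemperateGrowth (by positivity)), smul_eq_mul, ha, div_mul_eq_mul_div]
      ring
    have hba : ContDiff ℝ ∞ fun ξ : ℝ => (fun z => ψ z - 1) (a * ξ) :=
      hb.comp (contDiff_const.mul contDiff_id)
    rw [e, iteratedDeriv_fun_mul (hba.of_le (mod_cast le_top)).contDiffAt
      ((φ.smooth ⊤).of_le (mod_cast le_top)).contDiffAt]
    calc |ξ| ^ k * ‖∑ i ∈ Finset.range (m + 1), (m.choose i : ℂ) *
          iteratedDeriv i (fun ξ : ℝ => (fun z => ψ z - 1) (a * ξ)) ξ *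
            iteratedDeriv (m - i) φ ξ‖
        ≤ |ξ| ^ k * ∑ i ∈ Finset.range (m + 1), (m.choose i : ℝ) *
          ((2 * Real.pi) ^ i * (C i * (a * |ξ|)) * ‖iteratedDeriv (m - i) φ ξ‖) := by
          gcongr
          refine (norm_sum_le _ _).trans (Finset.sum_le_sum fun i _ => ?_)
          rw [norm_mul, norm_mul, Complex.norm_natCast, mul_assoc,
            iteratedDeriv_comp_const_smul (hb.of_le (mod_cast le_top)) a, norm_smul, norm_pow,
            Real.norm_of_nonneg ha0]
          have h1 := hC i (a * ξ)
          rw [abs_mul, abs_of_nonneg ha0] at h1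
          gcongr
      _ = ∑ i ∈ Finset.range (m + 1), a * ((m.choose i : ℝ) * ((2 * Real.pi) ^ i * C i *
          (|ξ| ^ (k + 1) * ‖iteratedDeriv (m - i) φ ξ‖))) := by
          rw [Finset.mul_sum]
          refine Finset.sum_congr rfl fun i _ => ?_
          ring
      _ ≤ ∑ i ∈ Finset.range (m + 1), a * ((m.choose i : ℝ) * ((2 * Real.pi) ^ i * C i *
          SchwartzMap.seminorm ℝ (k + 1) (m - i) φ)) := by
          refine Finset.sum_le_sum fun i _ => ?_
          have h1 := SchwartzMap.le_seminorm' ℝ (k + 1) (m - i) φ ξ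
          have h2 := hC0 i
          gcongr
      _ = a * S := by rw [hS, Finset.mul_sum]
  have hlim : Tendsto (fun n : ℕ => 2 * Real.pi / ((n : ℝ) + 1) * S) atTop (𝓝 0) := by
    have h1 := (tendsto_one_div_add_atTop_nhds_zero_nat (𝕜 := ℝ)).const_mul (2 * Real.pi * S)
    rw [mul_zero] at h1
    refine h1.congr fun n => ?_
    ring
  filter_upwards [hlim.eventually (gt_mem_nhds hε)] with n hn
  exact (key n).trans_lt hn

end IsLPCutoff

theorem integrable_schwartz_mul {W : ℝ → ℂ} {A : ℝ} (hW : AEStronglyMeasurable W volume)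
    (hA : ∀ ξ, ‖W ξ‖ ≤ A) (φ : 𝓢(ℝ, ℂ)) : Integrable fun ξ => φ ξ * W ξ :=
  φ.integrable.mul_bdd hW (ae_of_all _ hA)

/-- Dominated convergence for pairings of a Schwartz function with a bounded function. -/
theorem tendsto_integral_cutoff_mul {ι : Type*} {l : Filter ι} [l.IsCountablyGenerated]
    {W : ℝ → ℂ} {A : ℝ} (hW : AEStronglyMeasurable W volume) (hA : ∀ ξ, ‖W ξ‖ ≤ A)
    (φ : 𝓢(ℝ, ℂ)) {g : ι → ℝ → ℂ} {C : ℝ} (hg : ∀ i, (g i).HasTemperateGrowth)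
    (hC : ∀ i ξ, ‖g i ξ‖ ≤ C) {z : ℂ}
    (hz : ∀ ξ ≠ 0, Tendsto (fun i => g i ξ) l (𝓝 z)) :
    Tendsto (fun i => ∫ ξ, SchwartzMap.smulLeftCLM ℂ (g i) φ ξ * W ξ) l
      (𝓝 (z * ∫ ξ, φ ξ * W ξ)) := by
  rw [← integral_const_mul]
  have hi := integrable_schwartz_mul hW hA φ
  refine tendsto_integral_filter_of_dominated_convergence (fun ξ => C * ‖φ ξ * W ξ‖)
    (Eventually.of_forall fun i => (integrable_schwartz_mul hW hA _).aestronglyMeasurable)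
    (Eventually.of_forall fun i => ae_of_all _ fun ξ => ?_) (hi.norm.const_mul C) ?_
  · rw [SchwartzMap.smulLeftCLM_apply_apply (hg i), smul_eq_mul, mul_assoc, norm_mul]
    exact mul_le_mul_of_nonneg_right (hC i ξ) (norm_nonneg _)
  · filter_upwards [compl_mem_ae_iff.2 (measure_singleton (0 : ℝ))] with ξ hξ
    simp only [SchwartzMap.smulLeftCLM_apply_apply (hg _), smul_eq_mul, mul_assoc]
    exact (hz ξ hξ).mul_const _

/-- If a tempered distribution agrees with a bounded function on test functions compactly supported
in one of the two half-lines, and has no component at the origin, then it is given by that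
function. -/
theorem apply_eq_integral_of_halfLines {ψ : ℝ → ℂ} (hψ : IsLPCutoff ψ) {T : 𝓢'(ℝ, ℂ)}
    {W : ℝ → ℂ} {A : ℝ} (hW : AEStronglyMeasurable W volume) (hA : ∀ ξ, ‖W ξ‖ ≤ A)
    (hpos : ∀ φ : 𝓢(ℝ, ℂ), HasCompactSupport φ → tsupport φ ⊆ Set.Ioi 0 →
      T φ = ∫ ξ, φ ξ * W ξ)
    (hneg : ∀ φ : 𝓢(ℝ, ℂ), HasCompactSupport φ → tsupport φ ⊆ Set.Iio 0 →
      T φ = ∫ ξ, φ ξ * W ξ)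
    (hzero : ∀ φ : 𝓢(ℝ, ℂ), Tendsto (fun j : ℤ => T (SchwartzMap.smulLeftCLM ℂ
      (fun ξ : ℝ => ψ (2 * Real.pi * ξ / (2 : ℝ) ^ j)) φ)) atBot (𝓝 0)) (φ : 𝓢(ℝ, ℂ)) :
    T φ = ∫ ξ, φ ξ * W ξ := by
  have hpi := Real.pi_pos
  obtain ⟨C, hC0, hC⟩ := hψ.exists_norm_le
  -- compactly supported test functions are split into two halves by a smooth step
  have h1 : ∀ φ : 𝓢(ℝ, ℂ), HasCompactSupport φ → (0 : ℝ) ∉ tsupport φ →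
      T φ = ∫ ξ, φ ξ * W ξ := by
    intro φ hφ h0
    obtain ⟨δ, hδ, hball⟩ := Metric.isOpen_iff.1 (isClosed_tsupport φ).isOpen_compl 0 h0
    have hφ0 : ∀ ξ, |ξ| < δ → φ ξ = 0 := fun ξ hξ =>
      image_eq_zero_of_notMem_tsupport (hball (by simpa using hξ))
    have hs : ContDiff ℝ ∞ fun ξ : ℝ => ((Real.smoothTransition (ξ / δ) : ℝ) : ℂ) * φ ξ :=
      (Complex.ofRealCLM.contDiff.comp
        (Real.smoothTransition.contDiff.comp (contDiff_id.div_const δ))).mul (φ.smooth ⊤)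
    have hsc : HasCompactSupport fun ξ : ℝ => ((Real.smoothTransition (ξ / δ) : ℝ) : ℂ) * φ ξ :=
      hφ.mul_left
    set φ₁ : 𝓢(ℝ, ℂ) := hsc.toSchwartzMap hs with hφ₁
    have hφ₁a : ∀ ξ, φ₁ ξ = ((Real.smoothTransition (ξ / δ) : ℝ) : ℂ) * φ ξ := fun _ => rfl
    have e1 : T φ₁ = ∫ ξ, φ₁ ξ * W ξ := by
      refine hpos φ₁ hsc fun ξ hξ => ?_
      have h2 : ξ ∈ tsupport φ := tsupport_mul_subset_right hξ
      have h3 : ξ ∈ Set.Ici (0 : ℝ) := by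
        refine closure_minimal (fun y hy => ?_) isClosed_Ici hξ
        by_contra h
        refine hy ?_
        rw [hφ₁a, Real.smoothTransition.zero_of_nonpos
          (div_nonpos_of_nonpos_of_nonneg (not_le.1 h).le hδ.le)]
        simp
      exact lt_of_le_of_ne (Set.mem_Ici.1 h3) fun h : (0 : ℝ) = ξ => h0 (h ▸ h2)
    have hdiff : ∀ ξ, (φ - φ₁) ξ = (1 - ((Real.smoothTransition (ξ / δ) : ℝ) : ℂ)) * φ ξ :=
      fun ξ => by rw [sub_apply, hφ₁a]; ring
    have hts : tsupport (φ - φ₁ : 𝓢(ℝ, ℂ)) ⊆ tsupport φ := by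
      rw [show ((φ - φ₁ : 𝓢(ℝ, ℂ)) : ℝ → ℂ) = fun ξ =>
        (1 - ((Real.smoothTransition (ξ / δ) : ℝ) : ℂ)) * φ ξ from funext hdiff]
      exact tsupport_mul_subset_right
    have e2 : T (φ - φ₁) = ∫ ξ, (φ - φ₁) ξ * W ξ := by
      refine hneg _ (hφ.of_isClosed_subset (isClosed_tsupport _) hts) fun ξ hξ => ?_
      have h3 : ξ ∈ Set.Iic (0 : ℝ) := by
        refine closure_minimal (fun y hy => ?_) isClosed_Iic hξ
        by_contra h
        refine hy ?_
        rw [hdiff]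
        rcases lt_or_ge y δ with h5 | h5
        · rw [hφ0 y (by rwa [abs_of_pos (not_le.1 h)]), mul_zero]
        · rw [Real.smoothTransition.one_of_one_le ((one_le_div hδ).2 h5)]
          simp
      exact lt_of_le_of_ne (Set.mem_Iic.1 h3) fun h : ξ = 0 => h0 (h ▸ hts hξ)
    have e3 : T φ = T φ₁ + T (φ - φ₁) := by rw [← map_add]; congr 1; abel
    rw [e3, e1, e2, ← integral_add (integrable_schwartz_mul hW hA _)
      (integrable_schwartz_mul hW hA _)]
    congr 1
    funext ξ
    rw [sub_apply]; ring
  -- compactness of the support is removed by a cutoff at infinity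
  have h2 : ∀ φ : 𝓢(ℝ, ℂ), (0 : ℝ) ∉ tsupport φ → T φ = ∫ ξ, φ ξ * W ξ := by
    intro φ h0
    have hg : ∀ n : ℕ, Function.HasTemperateGrowth
        (fun ξ : ℝ => ψ (2 * Real.pi * ξ / ((n : ℝ) + 1))) := fun n =>
      hψ.hasTemperateGrowth (by positivity)
    have l1 := ((T.cont.tendsto φ).comp (hψ.tendsto_smulLeftCLM φ))
    have l2 := tendsto_integral_cutoff_mul (l := atTop) hW hA φ hg (fun n ξ => hC _) (z := 1)
      (fun ξ _ => by
        have hz : Tendsto (fun n : ℕ => 2 * Real.pi * ξ / ((n : ℝ) + 1)) atTop (𝓝 0) := by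
          have h1 := (tendsto_one_div_add_atTop_nhds_zero_nat (𝕜 := ℝ)).const_mul
            (2 * Real.pi * ξ)
          rw [mul_zero] at h1
          refine h1.congr fun n => ?_
          ring
        have := (hψ.smooth.continuous.tendsto 0).comp hz
        rwa [hψ.eq_one 0 (by simp)] at this)
    rw [one_mul] at l2
    refine tendsto_nhds_unique l1 (l2.congr fun n => ?_)
    have e : ((SchwartzMap.smulLeftCLM ℂ
        (fun ξ : ℝ => ψ (2 * Real.pi * ξ / ((n : ℝ) + 1))) φ : 𝓢(ℝ, ℂ)) : ℝ → ℂ) =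
        fun ξ => ψ (2 * Real.pi * ξ / ((n : ℝ) + 1)) * φ ξ := by
      rw [SchwartzMap.smulLeftCLM_apply (hg n)]; rfl
    refine (h1 _ ?_ fun h => h0 ?_).symm
    · rw [e]
      refine HasCompactSupport.mul_right ?_
      have hne : (2 * Real.pi / ((n : ℝ) + 1)) ≠ 0 := by positivity
      have := hψ.hasCompactSupport.comp_homeomorph (Homeomorph.mulLeft₀ _ hne)
      simpa [Function.comp_def, div_mul_eq_mul_div] using this
    · rw [e] at h
      exact tsupport_mul_subset_right h
  -- the frequencies near zero are removed by the hypothesis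
  have hg : ∀ j : ℤ, Function.HasTemperateGrowth
      (fun ξ : ℝ => ψ (2 * Real.pi * ξ / (2 : ℝ) ^ j)) := fun j =>
    hψ.hasTemperateGrowth (by positivity)
  have l1 := tendsto_integral_cutoff_mul (l := atBot) hW hA φ hg (fun n ξ => hC _) (z := 0)
    (fun ξ hξ => by
      have hz : Tendsto (fun j : ℤ => (2 : ℝ) ^ j) atBot (𝓝 0) :=
        ((tendsto_rpow_atBot_of_base_gt_one 2 one_lt_two).comp
          (tendsto_intCast_atBot_iff.2 tendsto_id)).congr fun j => Real.rpow_intCast 2 j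
      refine tendsto_const_nhds.congr' ?_
      have hp : 0 < Real.pi * |ξ| / 2 := by have := abs_pos.2 hξ; positivity
      filter_upwards [hz.eventually (gt_mem_nhds hp)] with j hj
      by_contra h
      have h3 := abs_le.2 (hψ.support_subset (Ne.symm h))
      rw [abs_div, abs_mul, abs_of_pos (by positivity : (0 : ℝ) < 2 ^ j),
        abs_of_pos (by positivity : 0 < 2 * Real.pi), div_le_iff₀ (by positivity)] at h3
      linarith)
  rw [zero_mul] at l1
  have l2 : Tendsto (fun j : ℤ => T φ - T (SchwartzMap.smulLeftCLM ℂ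
      (fun ξ : ℝ => ψ (2 * Real.pi * ξ / (2 : ℝ) ^ j)) φ)) atBot (𝓝 (T φ - 0)) :=
    (hzero φ).const_sub _
  have l3 := l1.const_sub (∫ ξ, φ ξ * W ξ)
  rw [← sub_zero (T φ), ← sub_zero (∫ ξ, φ ξ * W ξ)]
  refine tendsto_nhds_unique l2 (l3.congr fun j => ?_)
  rw [← integral_sub (integrable_schwartz_mul hW hA _) (integrable_schwartz_mul hW hA _),
    ← map_sub]
  have e : ∀ ξ, (φ - SchwartzMap.smulLeftCLM ℂ
      (fun ξ : ℝ => ψ (2 * Real.pi * ξ / (2 : ℝ) ^ j)) φ : 𝓢(ℝ, ℂ)) ξ =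
      φ ξ - SchwartzMap.smulLeftCLM ℂ (fun ξ : ℝ => ψ (2 * Real.pi * ξ / (2 : ℝ) ^ j)) φ ξ :=
    fun ξ => by rw [sub_apply]
  rw [h2]
  · congr 1
    funext ξ
    rw [e]; ring
  · rw [notMem_tsupport_iff_eventuallyEq]
    have hp : (0 : ℝ) < 2 ^ j / (2 * Real.pi) := by positivity
    filter_upwards [Ioo_mem_nhds (neg_lt_zero.2 hp) hp] with ξ hξ
    have h3 : |2 * Real.pi * ξ / (2 : ℝ) ^ j| ≤ 1 := by
      rw [abs_div, abs_mul, abs_of_pos (by positivity : (0 : ℝ) < 2 ^ j),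
        abs_of_pos (by positivity : 0 < 2 * Real.pi), div_le_one (by positivity)]
      have := (lt_div_iff₀ (by positivity)).1 (abs_lt.2 hξ)
      linarith
    rw [e, SchwartzMap.smulLeftCLM_apply_apply (hg j), hψ.eq_one _ (abs_le.1 h3)]
    simp

end LinearKawahara

/-! ### The bounded symbol and its inverse Fourier transform -/

/-- The inverse Fourier transform may be moved from one integrable function to the other. -/
theorem integral_fourierInv_mul {f g : ℝ → ℂ} (hf : Integrable f) (hg : Integrable g) :
    ∫ ξ, 𝓕⁻ f ξ * g ξ = ∫ x, f x * 𝓕⁻ g x := by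
  have h1 := VectorFourier.integral_fourierIntegral_smul_eq_flip (μ := volume) (ν := volume)
    (L := innerₗ ℝ) (f := f) (g := fun ξ => g (-ξ)) Real.continuous_fourierChar
    continuous_inner hf hg.comp_neg
  rw [flip_innerₗ] at h1
  have h2 : ∫ ξ, 𝓕 f ξ * g (-ξ) = ∫ x, f x * 𝓕 (fun ξ => g (-ξ)) x := h1
  rw [Real.fourierInv_eq_fourier_comp_neg g, ← h2,
    ← integral_neg_eq_self (fun ξ => 𝓕 f ξ * g (-ξ))]
  simp only [neg_neg, Real.fourierInv_eq_fourier_neg]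

/-- Profiles are stable under conjugation, which reduces the left half-line to the right one. -/
theorem HalfLineProfile.conj {A : ℝ} {w h : ℝ → ℂ} (H : HalfLineProfile A w h) :
    HalfLineProfile A (fun ξ => (starRingEnd ℂ) (w ξ)) (fun ξ => (starRingEnd ℂ) (h ξ)) where
  one_le := H.one_le
  norm_le ξ hξ := by simpa using H.norm_le ξ hξ
  intervalIntegrable a b ha hb := by
    have := H.intervalIntegrable a b ha hb
    rw [intervalIntegrable_iff] at this ⊢
    exact (Complex.conjLIE.toContinuousLinearEquiv.toContinuousLinearMap).integrable_comp this
  sub_eq a b ha hb := by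
    rw [intervalIntegral.intervalIntegral_conj, ← map_sub, H.sub_eq a b ha hb]
  integrableOn := by simpa using H.integrableOn
  integral_le := by simpa using H.integral_le

namespace LinearKawahara

theorem flowFactor_mul_flowFactor_neg (t ξ : ℝ) : flowFactor t ξ * flowFactor (-t) ξ = 1 := by
  rw [flowFactor, flowFactor, ← Complex.exp_add]
  push_cast
  ring_nf
  exact Complex.exp_zero

theorem star_oscFactor (x ξ : ℝ) :
    (starRingEnd ℂ) (oscFactor x ξ) = Complex.exp (Complex.I * ((-(x * ξ + ξ ^ 5) : ℝ) : ℂ)) := by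
  rw [oscFactor, ← Complex.exp_conj, map_mul, Complex.conj_I, Complex.conj_ofReal]
  push_cast
  ring_nf

/-- The bounded function representing `û`, assembled from the profiles on the two half-lines, which
are dilated by `lam`; the one on the left is also reflected. Its value at `0` is irrelevant. -/
noncomputable def symbol (t lam : ℝ) (w₁ w₂ : ℝ → ℂ) (ξ : ℝ) : ℂ :=
  (Set.Ioi 0).indicator (fun ξ => flowFactor (-t) ξ * w₁ (ξ * lam⁻¹)) ξ +
    (Set.Iio 0).indicator (fun ξ => flowFactor (-t) ξ * w₂ (ξ * -lam⁻¹)) ξ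

theorem symbol_of_pos (t lam : ℝ) (w₁ w₂ : ℝ → ℂ) {ξ : ℝ} (hξ : 0 < ξ) :
    symbol t lam w₁ w₂ ξ = flowFactor (-t) ξ * w₁ (ξ * lam⁻¹) := by
  rw [symbol, Set.indicator_of_mem (Set.mem_Ioi.2 hξ),
    Set.indicator_of_notMem (by simpa using hξ.le), add_zero]

theorem symbol_of_neg (t lam : ℝ) (w₁ w₂ : ℝ → ℂ) {ξ : ℝ} (hξ : ξ < 0) :
    symbol t lam w₁ w₂ ξ = flowFactor (-t) ξ * w₂ (ξ * -lam⁻¹) := by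
  rw [symbol, Set.indicator_of_notMem (by simpa using hξ.le),
    Set.indicator_of_mem (Set.mem_Iio.2 hξ), zero_add]

theorem continuous_flowFactor (t : ℝ) : Continuous (flowFactor t) := by
  unfold flowFactor; fun_prop

section Symbol

variable {t lam A : ℝ} {w₁ w₂ h₁ h₂ : ℝ → ℂ}

theorem norm_symbol_le (hlam : 0 < lam) (H₁ : HalfLineProfile A w₁ h₁)
    (H₂ : HalfLineProfile A w₂ h₂) (ξ : ℝ) : ‖symbol t lam w₁ w₂ ξ‖ ≤ A := by
  have hl := inv_pos.2 hlam
  rcases lt_trichotomy ξ 0 with h | h | h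
  · rw [symbol_of_neg _ _ _ _ h, norm_mul, norm_flowFactor, one_mul]
    exact H₂.norm_le _ (by nlinarith)
  · rw [h, symbol, Set.indicator_of_notMem (by simp), Set.indicator_of_notMem (by simp), add_zero,
      norm_zero]
    exact zero_le_one.trans H₁.one_le
  · rw [symbol_of_pos _ _ _ _ h, norm_mul, norm_flowFactor, one_mul]
    exact H₁.norm_le _ (by positivity)

theorem aestronglyMeasurable_symbol (hlam : 0 < lam) (H₁ : HalfLineProfile A w₁ h₁)
    (H₂ : HalfLineProfile A w₂ h₂) : AEStronglyMeasurable (symbol t lam w₁ w₂) volume := by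
  have hl := inv_pos.2 hlam
  have hc := continuous_flowFactor (-t)
  refine AEStronglyMeasurable.add ?_ ?_
  · refine (aestronglyMeasurable_indicator_iff measurableSet_Ioi).2
      (ContinuousOn.aestronglyMeasurable (hc.continuousOn.mul
        (H₁.continuousOn.comp (by fun_prop) fun ξ hξ => ?_)) measurableSet_Ioi)
    have : (0 : ℝ) < ξ := hξ
    exact Set.mem_Ioi.2 (by positivity)
  · refine (aestronglyMeasurable_indicator_iff measurableSet_Iio).2
      (ContinuousOn.aestronglyMeasurable (hc.continuousOn.mul
        (H₂.continuousOn.comp (by fun_prop) fun ξ hξ => ?_)) measurableSet_Iio)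
    have : ξ < (0 : ℝ) := hξ
    exact Set.mem_Ioi.2 (by nlinarith)

/-- The truncated inverse Fourier transform of the symbol, in the self-similar variable
`2π lam x`. -/
theorem fourierInv_indicator_symbol (hlam : 0 < lam) (ht : t * (2 * Real.pi * lam) ^ 5 = 1)
    (H₁ : HalfLineProfile A w₁ h₁) (H₂ : HalfLineProfile A w₂ h₂) {R : ℝ} (hR : 0 ≤ R) (x : ℝ) :
    𝓕⁻ ((Set.Ioc (-(lam * R)) (lam * R)).indicator (symbol t lam w₁ w₂)) x =
      lam * (oscIntegral w₁ 0 (2 * Real.pi * lam * x) R +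
        (starRingEnd ℂ) (oscIntegral (fun ξ => (starRingEnd ℂ) (w₂ ξ)) 0
          (2 * Real.pi * lam * x) R)) := by
  have hlR : 0 ≤ lam * R := by positivity
  have hlC : (lam : ℂ) ≠ 0 := Complex.ofReal_ne_zero.2 hlam.ne'
  set e : ℝ → ℂ := fun ξ => Complex.exp (((2 * Real.pi * (ξ * x) : ℝ) : ℂ) * Complex.I) with he
  have hec : Continuous e := by simp only [he]; fun_prop
  have hint : ∀ a b, IntervalIntegrable (fun ξ => e ξ * symbol t lam w₁ w₂ ξ) volume a b := by
    intro a b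
    refine IntervalIntegrable.continuousOn_mul ?_ hec.continuousOn
    rw [intervalIntegrable_iff]
    exact IntegrableOn.of_bound (by simp) (aestronglyMeasurable_symbol hlam H₁ H₂).restrict A
      (ae_of_all _ (norm_symbol_le hlam H₁ H₂))
  have h0 : 𝓕⁻ ((Set.Ioc (-(lam * R)) (lam * R)).indicator (symbol t lam w₁ w₂)) x =
      ∫ ξ in (-(lam * R))..(lam * R), e ξ * symbol t lam w₁ w₂ ξ := by
    rw [intervalIntegral.integral_of_le (by linarith), ← integral_indicator measurableSet_Ioc,
      Real.fourierInv_eq']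
    congr 1
    funext ξ
    by_cases h : ξ ∈ Set.Ioc (-(lam * R)) (lam * R)
    · rw [Set.indicator_of_mem h, Set.indicator_of_mem h, smul_eq_mul, he]
      simp [mul_comm]
    · rw [Set.indicator_of_notMem h, Set.indicator_of_notMem h, smul_zero]
  have hph : ∀ η : ℝ, flowFactor (-t) (η * lam) * e (η * lam) =
      oscFactor (2 * Real.pi * lam * x) η := fun η => by
    rw [flowFactor, he, oscFactor, ← Complex.exp_add]
    congr 1
    have : -(-t * (2 * Real.pi * (η * lam)) ^ 5) = η ^ 5 := by
      linear_combination η ^ 5 * ht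
    rw [this]; push_cast; ring
  have hph2 : ∀ η : ℝ, flowFactor (-t) (-(η * lam)) * e (-(η * lam)) =
      (starRingEnd ℂ) (oscFactor (2 * Real.pi * lam * x) η) := fun η => by
    rw [flowFactor, he, star_oscFactor, ← Complex.exp_add]
    congr 1
    have : -(-t * (2 * Real.pi * -(η * lam)) ^ 5) = -η ^ 5 := by
      linear_combination -η ^ 5 * ht
    rw [this]; push_cast; ring
  have hplus : ∫ ξ in (0 : ℝ)..(lam * R), e ξ * symbol t lam w₁ w₂ ξ =
      lam * oscIntegral w₁ 0 (2 * Real.pi * lam * x) R := by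
    have h1 := intervalIntegral.integral_comp_mul_right (a := 0) (b := R)
      (fun ξ => e ξ * symbol t lam w₁ w₂ ξ) hlam.ne'
    rw [zero_mul, mul_comm R, Complex.real_smul, Complex.ofReal_inv,
      eq_inv_mul_iff_mul_eq₀ hlC] at h1
    rw [← h1, oscIntegral]
    congr 1
    refine intervalIntegral.integral_congr_ae (ae_of_all _ fun η hη => ?_)
    rw [Set.uIoc_of_le hR] at hη
    rw [symbol_of_pos _ _ _ _ (mul_pos hη.1 hlam), mul_inv_cancel_right₀ hlam.ne', ← hph]
    ring
  have hminus : ∫ ξ in (-(lam * R))..0, e ξ * symbol t lam w₁ w₂ ξ =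
      lam * (starRingEnd ℂ) (oscIntegral (fun ξ => (starRingEnd ℂ) (w₂ ξ)) 0
          (2 * Real.pi * lam * x) R) := by
    have h1 := intervalIntegral.integral_comp_mul_right (a := 0) (b := R)
      (fun ξ => e (-ξ) * symbol t lam w₁ w₂ (-ξ)) hlam.ne'
    rw [zero_mul, mul_comm R, Complex.real_smul, Complex.ofReal_inv,
      eq_inv_mul_iff_mul_eq₀ hlC,
      intervalIntegral.integral_comp_neg (fun ξ => e ξ * symbol t lam w₁ w₂ ξ), neg_zero] at h1
    rw [← h1, oscIntegral, ← intervalIntegral.intervalIntegral_conj]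
    congr 1
    refine intervalIntegral.integral_congr_ae (ae_of_all _ fun η hη => ?_)
    rw [Set.uIoc_of_le hR] at hη
    rw [symbol_of_neg _ _ _ _ (neg_lt_zero.2 (mul_pos hη.1 hlam)), neg_mul_neg,
      mul_inv_cancel_right₀ hlam.ne', map_mul, map_mul, ← hph2]
    simp
    ring
  rw [h0, ← intervalIntegral.integral_add_adjacent_intervals (hint _ 0) (hint 0 _), hplus, hminus]
  ring

end Symbol

/-- Undoing the dilation and the multiplication by the flow factor: on the half-line
`{ξ | 0 < ξ c}` the distribution is given by the profile. -/
theorem apply_eq_integral_of_dilation {T : 𝓢'(ℝ, ℂ)} {t c : ℝ} (hc : c ≠ 0) {w : ℝ → ℂ}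
    (hT : ∀ χ : 𝓢(ℝ, ℂ), HasCompactSupport χ → tsupport χ ⊆ Set.Ioi 0 →
      T (SchwartzMap.smulLeftCLM ℂ (flowFactor t) (SchwartzMap.dilation c hc χ)) =
        ((|c|⁻¹ : ℝ) : ℂ) * ∫ ξ, χ ξ * w ξ)
    {φ : 𝓢(ℝ, ℂ)} (hφ : HasCompactSupport φ) (hφs : ∀ ξ ∈ tsupport φ, 0 < ξ * c) :
    T φ = ∫ ξ, φ ξ * (flowFactor (-t) ξ * w (ξ * c)) := by
  have hg := hasTemperateGrowth_flowFactor t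
  have hg' := hasTemperateGrowth_flowFactor (-t)
  set φ' := SchwartzMap.smulLeftCLM ℂ (flowFactor (-t)) φ with hφ'
  have hφ'a : ∀ ξ, φ' ξ = flowFactor (-t) ξ * φ ξ := fun ξ => by
    rw [hφ', SchwartzMap.smulLeftCLM_apply_apply hg', smul_eq_mul]
  have hφ's : tsupport φ' ⊆ tsupport φ := by
    rw [show (φ' : ℝ → ℂ) = fun ξ => flowFactor (-t) ξ * φ ξ from funext hφ'a]
    exact tsupport_mul_subset_right
  set χ := SchwartzMap.dilation c⁻¹ (inv_ne_zero hc) φ' with hχ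
  have hχs : tsupport χ = (fun ξ => ξ * c⁻¹) ⁻¹' tsupport φ' := SchwartzMap.tsupport_dilation _ _
  have e1 : SchwartzMap.smulLeftCLM ℂ (flowFactor t) (SchwartzMap.dilation c hc χ) = φ := by
    ext ξ
    rw [SchwartzMap.smulLeftCLM_apply_apply hg, SchwartzMap.dilation_apply, hχ,
      SchwartzMap.dilation_apply, mul_inv_cancel_right₀ hc, hφ'a, smul_eq_mul, ← mul_assoc,
      flowFactor_mul_flowFactor_neg, one_mul]
  have h1 := hT χ ?_ ?_
  · have h2 := Measure.integral_comp_mul_right (fun y => χ y * w y) c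
    rw [e1] at h1
    rw [Complex.real_smul, abs_inv] at h2
    rw [h1, ← h2]
    congr 1
    funext ξ
    rw [hχ, SchwartzMap.dilation_apply, mul_inv_cancel_right₀ hc, hφ'a]
    ring
  · have h2 : HasCompactSupport φ' := hφ.of_isClosed_subset (isClosed_tsupport _) hφ's
    exact h2.comp_homeomorph (Homeomorph.mulRight₀ c⁻¹ (inv_ne_zero hc))
  · intro ξ hξ
    rw [hχs] at hξ
    have := hφs _ (hφ's hξ)
    rwa [inv_mul_cancel_right₀ hc] at this

/-- The tempered distribution whose Fourier transform is the symbol is given by the sum of two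
oscillatory integrals. -/
theorem isGivenBy_of_fourier_eq_symbol {u : 𝓢'(ℝ, ℂ)} {t lam A : ℝ} {w₁ w₂ h₁ h₂ : ℝ → ℂ}
    (hlam : 0 < lam) (ht : t * (2 * Real.pi * lam) ^ 5 = 1)
    (H₁ : HalfLineProfile A w₁ h₁) (H₂ : HalfLineProfile A w₂ h₂)
    (hu : ∀ φ : 𝓢(ℝ, ℂ), (𝓕 u) φ = ∫ ξ, φ ξ * symbol t lam w₁ w₂ ξ) :
    IsGivenBy u fun x => lam * (oscLimit w₁ 0 (2 * Real.pi * lam * x) +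
        (starRingEnd ℂ) (oscLimit (fun ξ => (starRingEnd ℂ) (w₂ ξ)) 0
          (2 * Real.pi * lam * x))) := by
  intro φ
  set s := 2 * Real.pi * lam with hs
  set W := symbol t lam w₁ w₂ with hW
  have hWm : AEStronglyMeasurable W volume := aestronglyMeasurable_symbol hlam H₁ H₂
  have hWA : ∀ ξ, ‖W ξ‖ ≤ A := norm_symbol_le hlam H₁ H₂
  set v : ℝ → ℂ := fun x => lam * (oscLimit w₁ 0 (s * x) +
        (starRingEnd ℂ) (oscLimit (fun ξ => (starRingEnd ℂ) (w₂ ξ)) 0 (s * x))) with hv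
  set vR : ℝ → ℝ → ℂ := fun R x => lam * (oscIntegral w₁ 0 (s * x) R +
        (starRingEnd ℂ) (oscIntegral (fun ξ => (starRingEnd ℂ) (w₂ ξ)) 0 (s * x) R)) with hvR
  have hvl : ∀ x, Tendsto (fun R => vR R x) atTop (𝓝 (v x)) := fun x =>
    ((H₁.tendsto_oscIntegral (Nat.zero_le _) _).add
      ((Complex.continuous_conj.tendsto _).comp
        (H₂.conj.tendsto_oscIntegral (Nat.zero_le _) _))).const_mul _
  have hvb : ∀ R, 0 ≤ R → ∀ x, ‖vR R x‖ ≤ lam * (12 * A) * (1 + |s * x|) := fun R hR x => by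
    have h1 := H₁.norm_oscIntegral_le (s * x) hR
    have h2 := H₂.conj.norm_oscIntegral_le (s * x) hR
    rw [hvR, norm_mul, Complex.norm_real, Real.norm_of_nonneg hlam.le, mul_assoc lam (12 * A)]
    refine mul_le_mul_of_nonneg_left ?_ hlam.le
    refine (norm_add_le _ _).trans ?_
    rw [RCLike.norm_conj]
    linarith
  have hvb' : ∀ x, ‖v x‖ ≤ lam * (12 * A) * (1 + |s * x|) := fun x =>
    le_of_tendsto (hvl x).norm ((eventually_ge_atTop 0).mono fun R hR => hvb R hR x)
  have hvc : Continuous v := by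
    have c1 := H₁.continuous_oscLimit (k := 0) (Nat.zero_le _)
    have c2 := H₂.conj.continuous_oscLimit (k := 0) (Nat.zero_le _)
    have hm : Continuous fun x : ℝ => s * x := by fun_prop
    exact continuous_const.mul ((c1.comp hm).add (Complex.continuous_conj.comp (c2.comp hm)))
  have hmaj : Integrable fun x => lam * (12 * A) * ((1 + |s * x|) * ‖φ x‖) := by
    have i1 := φ.integrable_pow_mul volume 1
    have i2 : Integrable fun x => ‖φ x‖ := φ.integrable.norm
    refine Integrable.const_mul ?_ _
    refine (i2.add (i1.const_mul |s|)).congr (ae_of_all _ fun x => ?_)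
    simp only [Pi.add_apply, pow_one, Real.norm_eq_abs, abs_mul]
    ring
  have hmajle : ∀ z x, ‖z‖ ≤ lam * (12 * A) * (1 + |s * x|) →
      ‖φ x * z‖ ≤ lam * (12 * A) * ((1 + |s * x|) * ‖φ x‖) := fun z x h => by
    rw [norm_mul]
    have := mul_le_mul_of_nonneg_left h (norm_nonneg (φ x))
    linarith
  refine ⟨hmaj.mono' (φ.continuous.mul hvc).aestronglyMeasurable
    (ae_of_all _ fun x => hmajle _ _ (hvb' x)), ?_⟩
  -- both sides are the limit of `∫ φ vR`
  have hFub : ∀ R, 0 ≤ R → ∫ ξ, (𝓕⁻ φ : 𝓢(ℝ, ℂ)) ξ *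
      (Set.Ioc (-(lam * R)) (lam * R)).indicator W ξ = ∫ x, φ x * vR R x := fun R hR => by
    have hWi : Integrable ((Set.Ioc (-(lam * R)) (lam * R)).indicator W) := by
      refine (integrable_indicator_iff measurableSet_Ioc).2 ?_
      exact IntegrableOn.of_bound (by simp) hWm.restrict A (ae_of_all _ hWA)
    have := integral_fourierInv_mul φ.integrable hWi
    rw [SchwartzMap.fourierInv_coe, this]
    congr 1
    funext x
    rw [fourierInv_indicator_symbol hlam ht H₁ H₂ hR]
  have e1 : u φ = ∫ ξ, (𝓕⁻ φ : 𝓢(ℝ, ℂ)) ξ * W ξ := by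
    rw [← hu, TemperedDistribution.fourier_apply, FourierTransform.fourier_fourierInv_eq]
  have l1 : Tendsto (fun R => ∫ x, φ x * vR R x) atTop (𝓝 (∫ x, φ x * v x)) := by
    refine tendsto_integral_filter_of_dominated_convergence _ ?_ ?_ hmaj
      (ae_of_all _ fun x => (hvl x).const_mul _)
    · filter_upwards [eventually_ge_atTop (0 : ℝ)] with R hR
      have hc : ∀ {w h : ℝ → ℂ}, HalfLineProfile A w h →
          Continuous fun x => oscIntegral w 0 x R := fun H =>
        continuous_iff_continuousAt.2 fun x => (H.hasDerivAt_oscIntegral 0 hR x).continuousAt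
      have hm : Continuous fun x : ℝ => s * x := by fun_prop
      exact (φ.continuous.mul (continuous_const.mul (((hc H₁).comp hm).add
        (Complex.continuous_conj.comp ((hc H₂.conj).comp hm))))).aestronglyMeasurable
    · filter_upwards [eventually_ge_atTop (0 : ℝ)] with R hR
      exact ae_of_all _ fun x => hmajle _ _ (hvb R hR x)
  have l2 : Tendsto (fun R : ℝ => ∫ ξ, (𝓕⁻ φ : 𝓢(ℝ, ℂ)) ξ *
      (Set.Ioc (-(lam * R)) (lam * R)).indicator W ξ) atTop
      (𝓝 (∫ ξ, (𝓕⁻ φ : 𝓢(ℝ, ℂ)) ξ * W ξ)) := by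
    have hi := integrable_schwartz_mul hWm hWA (𝓕⁻ φ)
    refine tendsto_integral_filter_of_dominated_convergence
      (fun ξ => ‖(𝓕⁻ φ : 𝓢(ℝ, ℂ)) ξ * W ξ‖) (Eventually.of_forall fun R =>
        (𝓕⁻ φ : 𝓢(ℝ, ℂ)).continuous.aestronglyMeasurable.mul
          (hWm.indicator measurableSet_Ioc))
      (Eventually.of_forall fun R => ae_of_all _ fun ξ => ?_) hi.norm (ae_of_all _ fun ξ => ?_)
    · rw [norm_mul, norm_mul]
      exact mul_le_mul_of_nonneg_left (norm_indicator_le_norm_self _ _) (norm_nonneg _)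
    · refine tendsto_const_nhds.congr' ?_
      filter_upwards [eventually_gt_atTop (|ξ| / lam)] with R hR
      rw [div_lt_iff₀ hlam, mul_comm] at hR
      have hm : ξ ∈ Set.Ioc (-(lam * R)) (lam * R) := ⟨(abs_lt.1 hR).1, (abs_lt.1 hR).2.le⟩
      rw [Set.indicator_of_mem hm]
  rw [e1]
  refine tendsto_nhds_unique l2 (l1.congr' ?_)
  filter_upwards [eventually_ge_atTop (0 : ℝ)] with R hR
  rw [hFub R hR]

/-- The representation of `u` by two oscillatory integrals. -/
theorem exists_isGivenBy {ψ : ℝ → ℂ} (hψ : IsLPCutoff ψ) {t lam : ℝ} (hlam : 0 < lam)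
    (ht : t * (2 * Real.pi * lam) ^ 5 = 1) {u : 𝓢'(ℝ, ℂ)} (hu0 : VanishesAtZeroFrequency ψ u)
    (hu : besovNorm ψ (-(1 / 2)) u ≤ 1) (hL : sobolevNorm (1 / 2) (opL t u) ≤ 1) :
    ∃ w₁ h₁ w₂ h₂ : ℝ → ℂ, HalfLineProfile 134 w₁ h₁ ∧ HalfLineProfile 134 w₂ h₂ ∧
      IsGivenBy u fun x => lam * (oscLimit w₁ 0 (2 * Real.pi * lam * x) +
        (starRingEnd ℂ) (oscLimit w₂ 0 (2 * Real.pi * lam * x))) := by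
  obtain ⟨F, hF, hF2⟩ := exists_of_sobolevNorm_le hL
  have hl : (lam⁻¹ : ℝ) ≠ 0 := inv_ne_zero hlam.ne'
  have hl' := inv_pos.2 hlam
  obtain ⟨w₁, h₁, H₁, hw₁⟩ := exists_profile hψ hu hF hF2 hl
  obtain ⟨w₂, h₂, H₂, hw₂⟩ := exists_profile hψ hu hF hF2 (neg_ne_zero.2 hl)
  refine ⟨w₁, h₁, _, _, H₁, H₂.conj, isGivenBy_of_fourier_eq_symbol hlam ht H₁ H₂ ?_⟩
  refine apply_eq_integral_of_halfLines hψ (aestronglyMeasurable_symbol hlam H₁ H₂)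
    (norm_symbol_le hlam H₁ H₂) (fun φ hφ hφs => ?_) (fun φ hφ hφs => ?_) fun φ => ?_
  · rw [apply_eq_integral_of_dilation hl hw₁ hφ fun ξ hξ => mul_pos (hφs hξ) hl']
    congr 1
    funext ξ
    by_cases h : φ ξ = 0
    · simp [h]
    · rw [symbol_of_pos _ _ _ _ (hφs (subset_tsupport _ h))]
  · rw [apply_eq_integral_of_dilation (neg_ne_zero.2 hl) hw₂ hφ fun ξ hξ =>
      mul_pos_of_neg_of_neg (hφs hξ) (neg_lt_zero.2 hl')]
    congr 1
    funext ξ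
    by_cases h : φ ξ = 0
    · simp [h]
    · rw [symbol_of_neg _ _ _ _ (hφs (subset_tsupport _ h))]
  · refine (hu0 (𝓕 φ)).congr fun j => ?_
    rw [← TemperedDistribution.fourier_apply, fourier_lpLow_apply]

end LinearKawahara

/-! ### The pointwise bounds -/

theorem iteratedDeriv_eq_of_hasDerivAt {D : ℕ → ℝ → ℂ} {n : ℕ}
    (hD : ∀ k < n, ∀ x, HasDerivAt (D k) (D (k + 1) x) x) {k : ℕ} (hk : k ≤ n) :
    iteratedDeriv k (D 0) = D k := by
  induction k with
  | zero => exact iteratedDeriv_zero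
  | succ k ih =>
    rw [iteratedDeriv_succ, ih (by omega)]
    exact funext fun x => (hD k (by omega) x).deriv

theorem contDiff_of_hasDerivAt {D : ℕ → ℝ → ℂ} {n : ℕ}
    (hD : ∀ k < n, ∀ x, HasDerivAt (D k) (D (k + 1) x) x) (hc : Continuous (D n)) :
    ContDiff ℝ n (D 0) := by
  have hcont : ∀ k ≤ n, Continuous (D k) := fun k hk => by
    rcases hk.lt_or_eq with h | rfl
    · exact continuous_iff_continuousAt.2 fun x => (hD k h x).continuousAt
    · exact hc
  refine contDiff_iff_iteratedDeriv.2 ⟨fun k hk => ?_, fun k hk => ?_⟩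
  · have hk' : k ≤ n := by exact_mod_cast hk
    rw [iteratedDeriv_eq_of_hasDerivAt hD hk']
    exact hcont k hk'
  · have hk' : k < n := by exact_mod_cast hk
    rw [iteratedDeriv_eq_of_hasDerivAt hD hk'.le]
    exact fun x => (hD k hk' x).differentiableAt

namespace LinearKawahara

/-- The bracket in the self-similar variable `t^(-1/5) x`. -/
theorem bracket_eq {t : ℝ} (ht : 0 < t) (x : ℝ) :
    bracket t x = t ^ (1 / 5 : ℝ) * Real.sqrt ((t ^ (-(1 / 5) : ℝ) * x) ^ 2 + 1) := by
  have h0 : 0 ≤ t ^ (1 / 5 : ℝ) := by positivity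
  have h1 : t ^ (2 / 5 : ℝ) = (t ^ (1 / 5 : ℝ)) ^ 2 := by
    rw [← Real.rpow_mul_natCast ht.le]; norm_num
  have h2 : t ^ (1 / 5 : ℝ) * t ^ (-(1 / 5) : ℝ) = 1 := by
    rw [← Real.rpow_add ht]; norm_num
  rw [bracket, h1, ← Real.sqrt_sq h0, ← Real.sqrt_mul (sq_nonneg _), Real.sqrt_sq h0]
  congr 1
  linear_combination -(t ^ (1 / 5 : ℝ) * t ^ (-(1 / 5) : ℝ) + 1) * x ^ 2 * h2

end LinearKawahara

theorem proposition3p3 :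
    ∃ (C : ℝ) (K : ℝ → ℝ), ∀ ψ : ℝ → ℂ, LinearKawahara.IsLPCutoff ψ →
      ∀ (t : ℝ), 0 < t → ∀ u : 𝓢'(ℝ, ℂ),
        LinearKawahara.VanishesAtZeroFrequency ψ u →
        LinearKawahara.besovNorm ψ (-(1 / 2)) u +
          LinearKawahara.sobolevNorm (1 / 2) (LinearKawahara.opL t u) ≤ 1 →
        ∃ v : ℝ → ℂ, ContDiff ℝ 3 v ∧ LinearKawahara.IsGivenBy u v ∧
          (∀ k : ℕ, k ≤ 3 → ∀ x : ℝ,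
            t ^ (1 / 8 + (k : ℝ) / 4) * LinearKawahara.bracket t x ^ (3 / 8 - (k : ℝ) / 4) *
              ‖iteratedDeriv k v x‖ ≤ C) ∧
          (∀ c : ℝ, 0 < c → ∀ k : ℕ, k ≤ 3 → ∀ x : ℝ, c * t ^ (1 / 5 : ℝ) ≤ x →
            t ^ ((k : ℝ) / 4) * LinearKawahara.bracket t x ^ (1 - (k : ℝ) / 4) *
              ‖iteratedDeriv k v x‖ ≤
                K c * Real.log (t ^ (-(1 / 5) : ℝ) * LinearKawahara.bracket t x)) := by
  have hpi := Real.pi_pos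
  refine ⟨(2 * Real.pi)⁻¹ * (2 * (6528 * 134)), fun c => (2 * Real.pi)⁻¹ *
    (2 * ((4080 + 108 / Real.log (Real.sqrt (c ^ 2 + 1))) * 134)), ?_⟩
  intro ψ hψ t ht u hu0 hu
  set s : ℝ := t ^ (-(1 / 5) : ℝ) with hs
  have hs0 : 0 < s := Real.rpow_pos_of_pos ht _
  have hs1 : t ^ (1 / 5 : ℝ) * s = 1 := by
    rw [hs, ← Real.rpow_add ht]; norm_num
  -- this dilation turns the flow factor `exp (i t (2πξ)⁵)` into `exp (i η⁵)`
  set lam : ℝ := s / (2 * Real.pi) with hlam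
  have hlam0 : 0 < lam := by positivity
  have hls : 2 * Real.pi * lam = s := by rw [hlam]; field_simp
  have hts : t * (2 * Real.pi * lam) ^ 5 = 1 := by
    rw [hls, hs, ← Real.rpow_mul_natCast ht.le]
    nth_rewrite 1 [← Real.rpow_one t]
    rw [← Real.rpow_add ht]; norm_num
  obtain ⟨w₁, h₁, w₂, h₂, H₁, H₂, hgiven⟩ := LinearKawahara.exists_isGivenBy hψ hlam0 hts hu0
    (le_self_add.trans hu) (le_add_self.trans hu)
  rw [hls] at hgiven
  -- `D k` is the `k`-th derivative of the function representing `u`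
  set D : ℕ → ℝ → ℂ := fun k x => (lam * s ^ k : ℝ) * (Complex.I ^ k * oscLimit w₁ k (s * x) +
    (starRingEnd ℂ) (Complex.I ^ k * oscLimit w₂ k (s * x))) with hD
  have hv : (fun x => lam * (oscLimit w₁ 0 (s * x) +
      (starRingEnd ℂ) (oscLimit w₂ 0 (s * x)))) = D 0 := by
    funext x; simp [hD]
  have hder : ∀ k < 3, ∀ x, HasDerivAt (D k) (D (k + 1) x) x := fun k hk x => by
    have hx : HasDerivAt (fun x : ℝ => s * x) s x := by
      simpa using (hasDerivAt_id x).const_mul s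
    have d1 := ((H₁.hasDerivAt_oscLimit hk (s * x)).scomp x hx).const_mul (Complex.I ^ k)
    have d2 := (((H₂.hasDerivAt_oscLimit hk (s * x)).scomp x hx).const_mul (Complex.I ^ k)).star
    refine ((d1.add d2).const_mul ((lam * s ^ k : ℝ) : ℂ)).congr_deriv ?_
    simp only [hD, Complex.real_smul, ← starRingEnd_apply, map_mul, Complex.conj_ofReal]
    push_cast
    simp only [map_mul, map_pow, pow_succ, Complex.conj_I]
    ring
  have hcont : Continuous (D 3) := by
    have hm : Continuous fun x : ℝ => s * x := by fun_prop
    exact continuous_const.mul ((continuous_const.mul ((H₁.continuous_oscLimit le_rfl).comp hm)).add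
      (Complex.continuous_conj.comp
        (continuous_const.mul ((H₂.continuous_oscLimit le_rfl).comp hm))))
  have hnorm : ∀ k x, ‖D k x‖ ≤ lam * s ^ k * (‖oscLimit w₁ k (s * x)‖ +
      ‖oscLimit w₂ k (s * x)‖) := fun k x => by
    simp only [hD]
    rw [norm_mul, Complex.norm_real, Real.norm_of_nonneg (by positivity)]
    refine mul_le_mul_of_nonneg_left ((norm_add_le _ _).trans ?_) (by positivity)
    simp
  -- all powers of `t` cancel
  have hscale : ∀ (k : ℕ) (a b x : ℝ), a + b / 5 = 1 / 5 + (k : ℝ) / 5 →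
      t ^ a * LinearKawahara.bracket t x ^ b * (lam * s ^ k) =
        (2 * Real.pi)⁻¹ * Real.sqrt ((s * x) ^ 2 + 1) ^ b := fun k a b x hab => by
    have e1 : s ^ k = t ^ (-(k : ℝ) / 5) := by
      rw [hs, ← Real.rpow_mul_natCast ht.le]; congr 1; ring
    have e2 : t ^ a * t ^ (1 / 5 * b : ℝ) * (s * s ^ k) = 1 := by
      rw [e1, hs, ← Real.rpow_add ht, ← Real.rpow_add ht, ← Real.rpow_add ht,
        show a + 1 / 5 * b + (-(1 / 5) + -(k : ℝ) / 5) = 0 by linarith, Real.rpow_zero]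
    rw [LinearKawahara.bracket_eq ht, Real.mul_rpow (by positivity) (by positivity),
      ← Real.rpow_mul ht.le, hlam]
    linear_combination (2 * Real.pi)⁻¹ * Real.sqrt ((s * x) ^ 2 + 1) ^ b * e2
  have hbound : ∀ (k : ℕ) (a b x B : ℝ), a + b / 5 = 1 / 5 + (k : ℝ) / 5 →
      Real.sqrt ((s * x) ^ 2 + 1) ^ b * ‖oscLimit w₁ k (s * x)‖ ≤ B →
      Real.sqrt ((s * x) ^ 2 + 1) ^ b * ‖oscLimit w₂ k (s * x)‖ ≤ B →
      t ^ a * LinearKawahara.bracket t x ^ b * ‖D k x‖ ≤ (2 * Real.pi)⁻¹ * (2 * B) := by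
    intro k a b x B hab hB₁ hB₂
    have h0 : 0 ≤ t ^ a * LinearKawahara.bracket t x ^ b :=
      mul_nonneg (by positivity) (Real.rpow_nonneg (Real.sqrt_nonneg _) _)
    calc t ^ a * LinearKawahara.bracket t x ^ b * ‖D k x‖
        ≤ t ^ a * LinearKawahara.bracket t x ^ b * (lam * s ^ k * (‖oscLimit w₁ k (s * x)‖ +
          ‖oscLimit w₂ k (s * x)‖)) := mul_le_mul_of_nonneg_left (hnorm k x) h0
      _ = (2 * Real.pi)⁻¹ * (Real.sqrt ((s * x) ^ 2 + 1) ^ b * ‖oscLimit w₁ k (s * x)‖ +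
          Real.sqrt ((s * x) ^ 2 + 1) ^ b * ‖oscLimit w₂ k (s * x)‖) := by
        rw [← mul_assoc, hscale k a b x hab]; ring
      _ ≤ _ := by
        refine mul_le_mul_of_nonneg_left ?_ (by positivity)
        linarith
  refine ⟨D 0, contDiff_of_hasDerivAt hder hcont, hv ▸ hgiven, fun k hk x => ?_,
    fun c hc k hk x hx => ?_⟩
  · rw [iteratedDeriv_eq_of_hasDerivAt hder hk]
    exact hbound k _ _ x _ (by ring) (H₁.oscLimit_decay hk _) (H₂.oscLimit_decay hk _)
  · rw [iteratedDeriv_eq_of_hasDerivAt hder hk]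
    have hcx : c ≤ s * x := by
      have := mul_le_mul_of_nonneg_left hx hs0.le
      calc c = s * (c * t ^ (1 / 5 : ℝ)) := by linear_combination -c * hs1
        _ ≤ s * x := this
    have hJ : s * LinearKawahara.bracket t x = Real.sqrt ((s * x) ^ 2 + 1) := by
      rw [LinearKawahara.bracket_eq ht, ← mul_assoc, mul_comm s, hs1, one_mul]
    rw [hJ]
    refine (hbound k _ _ x _ (by ring) (H₁.oscLimit_elliptic hk hc hcx)
      (H₂.oscLimit_elliptic hk hc hcx)).trans (le_of_eq ?_)
    ring
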